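/- **Conventions.** A pointed matched circle $\mathcal Z$ of genus $k$ is an oriented circle with a basepoint $z$ and $4k$ marked points $\mathbf a$, labelled in order $1,\dots,4k$ starting from $z$, matched in pairs by a two-to-one map $M\colon\{1,\dots,4k\}\to\{1,\dots,2k\}$, such that surgery on all $2k$ matched pairs yields a connected $1$-manifold; $-\mathcal Z$ is $\mathcal Z$ with reversed orientation and $r\colon\mathcal Z\to-\mathcal Z$ the obvious identification. $\mathcal A(\mathcal Z)$ is the associated bordered Floer strands algebra over $\mathbb F_2$, a differential algebra whose basis consists of the strands diagrams ("basic generators"; horizontal strands come in matched pairs); the product is concatenation (zero if strands do not match up or two strands cross twice), and the differential $d$ is the sum of all resolutions of crossings that create no double crossing. $\operatorname{supp}(a)\in H_1(\mathcal Z\setminus\{z\},\mathbf a)$ is the one-chain of local multiplicities of $a$. For $S\subset\{1,\dots,2k\}$, $I(S)$ is the idempotent of horizontal strands at $M^{-1}(S)$; a pair of complementary idempotents is $I=i\otimes i_o=I(S)\otimes I(T)\in\mathcal A(\mathcal Z)\otimes\mathcal A(-\mathcal Z)$ where $T$ is the complement of $S$ (all $\otimes$ are over $\mathbb F_2$). A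 chord is an interval $\xi=[i,j]$, $1\le i<j\le 4k$, of length $j-i$; $a(\xi)$ is the sum of all strands diagrams whose only non-horizontal strand goes from $i$ to $j$, and $\widetilde a(\xi)=a(\xi)\otimes a(r(\xi))$. The diagonal subalgebra of $\mathcal A(\mathcal Z)\otimes\mathcal A(-\mathcal Z)$ is the (not necessarily unital) algebra generated by the elements $(j\cdot a\cdot i)\otimes(j_o\cdot b\cdot i_o)$ with $a,b$ basic generators, $r_*\operatorname{supp}(a)=-\operatorname{supp}(b)$, and $i\otimes i_o$, $j\otimes j_o$ pairs of complementary idempotents. The grading group $G'(\mathcal Z)$ consists of the pairs $(j,\alpha)$ with $j\in\frac12\mathbb Z$, $\alpha\in H_1(\mathcal Z\setminus\{z\},\mathbf a)$, and $j\equiv\frac14\#\{\text{parity changes of }\alpha\}\pmod 1$, with $(j_1,\alpha_1)(j_2,\alpha_2)=(j_1+j_2+m(\alpha_2,\partial\alpha_1),\alpha_1+\alpha_2)$, where $m(\alpha,p)$ is the average local multiplicity of $\alpha$ at $p$; $\lambda=(1,0)$. Basic generators have the grading $\mathrm{gr}'(a)=(\mathrm{inv}(a)-m(\operatorname{supp}(a),S),\operatorname{supp}(a))$,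 with $\mathrm{inv}(a)$ the number of crossings and $S$ the set of initial points. $DD(\mathrm{Id}_{\mathcal Z})$ is the left module $\bigoplus_I(\mathcal A(\mathcal Z)\otimes\mathcal A(-\mathcal Z))\cdot I$, over all pairs $I$ of complementary idempotents, with the differential $$\partial(c\cdot I)=(dc)\cdot I+\sum_J\sum_\xi c\cdot I\cdot\widetilde a(\xi)\cdot J$$ ($J$ over all pairs of complementary idempotents, $\xi$ over all chords). **Proposition.** Let $\mathcal Z$ be a pointed matched circle of genus $k>1$, and let $M$ be a differential left module over $\mathcal A(\mathcal Z)\otimes\mathcal A(-\mathcal Z)$ (so $\partial^2=0$ and $\partial(b\,m)=(db)\,m+b\,\partial m$) with the following properties. 1. $M$ has generators $\mathbf x(I)$ in one-to-one correspondence with the pairs $I$ of complementary idempotents, with $I\cdot\mathbf x(I)=\mathbf x(I)$; that is, $M$ is the direct sum of the submodules generated by the $\mathbf x(I)$, and $c\mapsto c\cdot\mathbf x(I)$ is an isomorphism from $(\mathcal A(\mathcal Z)\otimes\mathcal A(-\mathcal Z))\cdot I$ onto the $I$-th summand. (Thus $M$ is a type DD bimodule.) 2. If $\partial\mathbf x(I)=\sum_J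 a(I,J)\cdot\mathbf x(J)$ with $a(I,J)=a(I,J)\cdot J$, then all $a(I,J)$ lie in the diagonal subalgebra. 3. $M$ is graded by a $\lambda$-free set $S$: there are a set $S$ with commuting left actions of $G'(\mathcal Z)$ and $G'(-\mathcal Z)$ in which both $\lambda$'s act in the same way and $\lambda^n s\ne s$ for all $s\in S$ and all integers $n\neq0$, and degrees $\mathrm{gr}'(\mathbf x(I))\in S$, such that $\partial\mathbf x(I)$ is a sum of elements $(a\otimes b)\cdot\mathbf x(J)$, with $a,b$ basic generators, for which $\mathrm{gr}'(a)\,\mathrm{gr}'(b)\,\mathrm{gr}'(\mathbf x(J))=\lambda^{-1}\mathrm{gr}'(\mathbf x(I))$. 4. For each chord $\xi$ of length one and all $I,J$ for which $I\cdot\widetilde a(\xi)\cdot J$ is nonzero (it then is a single basic generator $a\otimes b$), this generator occurs in $a(I,J)$ with nonzero coefficient. Then $M$ is isomorphic to $DD(\mathrm{Id}_{\mathcal Z})$ as a differential module over $\mathcal A(\mathcal Z)\otimes\mathcal A(-\mathcal Z)$. -/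

import Mathlib

open scoped TensorProduct

namespace BorderedFloer

/-! ### Pointed matched circles -/

/-- A pointed matched circle of genus `k`. The circle is cut open at the basepoint `z`, and the
`4k` marked points are labelled in order by `Fin (4 * k)`; the matching is a two-to-one map `M`.
Surgery on all matched pairs turns the circle into a 1-manifold along which, on arriving at a
marked point `p`, one jumps to the point `p'` matched with `p` and moves on to the cyclic successor
of `p'`; connectedness of that 1-manifold says that this walk passes through all marked points. -/
structure PointedMatchedCircle (k : ℕ) where
  M : Fin (4 * k) → Fin (2 * k)
  two_to_one : ∀ a, (Finset.univ.filter fun p => M p = a).card = 2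
  connected : ∀ p q : Fin (4 * k), Relation.ReflTransGen
    (fun p q => ∃ p', p' ≠ p ∧ M p' = M p ∧ q = finRotate (4 * k) p') p q

theorem finRotate_rev_finRotate {n : ℕ} (q : Fin n) :
    finRotate n (Fin.rev (finRotate n q)) = Fin.rev q := by
  cases n with
  | zero => exact q.elim0
  | succ n =>
    rcases Fin.eq_castSucc_or_eq_last q with ⟨i, rfl⟩ | rfl
    · have h : finRotate (n + 1) i.castSucc = i.succ := by
        simp
      rw [h, Fin.rev_succ, Fin.rev_castSucc]
      simp
    · simp

/-- The reverse `-Z`: the same circle with the opposite orientation. The orientation-reversing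
identification `r : Z → -Z` is `Fin.rev` on marked points; matched pairs keep their names. -/
def PointedMatchedCircle.reverse {k : ℕ} (Z : PointedMatchedCircle k) :
    PointedMatchedCircle k where
  M p := Z.M p.rev
  two_to_one a := by
    refine Eq.trans ?_ (Z.two_to_one a)
    refine Finset.card_bij (fun p _ => p.rev) ?_ ?_ ?_
    · intro p hp
      simpa using hp
    · intro p _ q _ h
      exact Fin.rev_injective h
    · intro p hp
      exact ⟨p.rev, by simpa using hp, by simp⟩
  connected p q := by
    have key : ∀ p q : Fin (4 * k), Relation.ReflTransGen
        (fun p q => ∃ p', p' ≠ p ∧ Z.M p' = Z.M p ∧ q = finRotate (4 * k) p') p q →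
        ∀ P Q : Fin (4 * k), p = finRotate _ P.rev → q = finRotate _ Q.rev →
        Relation.ReflTransGen
        (fun p q => ∃ p', p' ≠ p ∧ Z.M (Fin.rev p') = Z.M (Fin.rev p) ∧
          q = finRotate (4 * k) p') Q P := by
      intro p q h
      induction h with
      | refl =>
        intro P Q hP hQ
        have : P = Q := Fin.rev_injective ((finRotate _).injective (hP.symm.trans hQ))
        subst this
        exact Relation.ReflTransGen.refl
      | @tail b c _ hbc ih =>
        intro P Q hP hQ
        obtain ⟨b', hne, hM, hc⟩ := hbc
        have hb' : b' = Q.rev := (finRotate _).injective (hc.symm.trans hQ)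
        have e1 : b = finRotate _ (Fin.rev (finRotate _ (Fin.rev b))) := by
          rw [finRotate_rev_finRotate, Fin.rev_rev]
        refine Relation.ReflTransGen.head ?_ (ih P (finRotate _ (Fin.rev b)) hP e1)
        refine ⟨Fin.rev b, ?_, ?_, rfl⟩
        · intro h
          apply hne
          rw [hb', ← h, Fin.rev_rev]
        · rw [Fin.rev_rev, ← hM, hb']
    exact key _ _ (Z.connected (finRotate _ q.rev) (finRotate _ p.rev)) q p rfl rfl

/-! ### Strands diagrams -/

/-- A strands diagram, recorded as the set of pairs (initial point, terminal point) of its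
strands. Horizontal strands come in matching pairs, and a non-horizontal strand from `i` to `j` is
the only strand that begins at `i` or at its mate, and the only one that ends at `j` or at its
mate. -/
@[ext]
structure StrandDiagram {k : ℕ} (Z : PointedMatchedCircle k) where
  strands : Finset (Fin (4 * k) × Fin (4 * k))
  nondecreasing : ∀ i j, (i, j) ∈ strands → i ≤ j
  horizontal_mate : ∀ i j, (i, i) ∈ strands → Z.M j = Z.M i → (j, j) ∈ strands
  initial_unique : ∀ i j i' j', (i, j) ∈ strands → i < j → (i', j') ∈ strands →
    Z.M i' = Z.M i → i' = i ∧ j' = j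
  terminal_unique : ∀ i j i' j', (i, j) ∈ strands → i < j → (i', j') ∈ strands →
    Z.M j' = Z.M j → i' = i ∧ j' = j

namespace StrandDiagram

variable {k : ℕ} {Z : PointedMatchedCircle k}

theorem strands_injective :
    Function.Injective (strands : StrandDiagram Z → Finset (Fin (4 * k) × Fin (4 * k))) :=
  fun _ _ h => StrandDiagram.ext h

noncomputable instance : Fintype (StrandDiagram Z) :=
  Fintype.ofInjective _ strands_injective

/-- Two strands diagrams can be concatenated to a nonzero product: none of the five reasons for
vanishing occurs (a moving strand of `X` that does not continue in `Y`; a moving strand of `Y`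
that does not come from `X`; a pair of horizontal strands of `X` neither of which continues in
`Y`; a pair of horizontal strands of `Y` neither of which comes from `X`; two strands of the
concatenation that cross twice). -/
structure Composable (X Y : StrandDiagram Z) : Prop where
  moving_left : ∀ i j, (i, j) ∈ X.strands → i < j → ∃ l, (j, l) ∈ Y.strands
  moving_right : ∀ j l, (j, l) ∈ Y.strands → j < l → ∃ i, (i, j) ∈ X.strands
  horizontal_left : ∀ j, (j, j) ∈ X.strands → ∃ j' l, Z.M j' = Z.M j ∧ (j', l) ∈ Y.strands
  horizontal_right : ∀ j, (j, j) ∈ Y.strands → ∃ j' i, Z.M j' = Z.M j ∧ (i, j') ∈ X.strands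
  no_double_crossing : ∀ i j l i' j' l', (i, j) ∈ X.strands → (j, l) ∈ Y.strands →
    (i', j') ∈ X.strands → (j', l') ∈ Y.strands → ¬ (i < i' ∧ j' < j ∧ l < l')

theorem functional (X : StrandDiagram Z) {i j j' : Fin (4 * k)}
    (h : (i, j) ∈ X.strands) (h' : (i, j') ∈ X.strands) : j = j' := by
  have a := X.nondecreasing _ _ h
  have b := X.nondecreasing _ _ h'
  rcases a.lt_or_eq with a | a
  · exact (X.initial_unique _ _ _ _ h a h' rfl).2.symm
  · rcases b.lt_or_eq with b | b
    · exact (X.initial_unique _ _ _ _ h' b h rfl).2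
    · exact a.symm.trans b

theorem injective (X : StrandDiagram Z) {i i' j : Fin (4 * k)}
    (h : (i, j) ∈ X.strands) (h' : (i', j) ∈ X.strands) : i = i' := by
  have a := X.nondecreasing _ _ h
  have b := X.nondecreasing _ _ h'
  rcases a.lt_or_eq with a | a
  · exact (X.terminal_unique _ _ _ _ h a h' rfl).1.symm
  · rcases b.lt_or_eq with b | b
    · exact (X.terminal_unique _ _ _ _ h' b h rfl).1
    · exact a.trans b.symm

/-- The concatenation of two strands diagrams, pulled straight; only the strands that go all the
way across are kept. -/
def comp (X Y : StrandDiagram Z) : StrandDiagram Z where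
  strands := Finset.univ.filter fun p => ∃ j, (p.1, j) ∈ X.strands ∧ (j, p.2) ∈ Y.strands
  nondecreasing i l h := by
    simp only [Finset.mem_filter, Finset.mem_univ, true_and] at h
    obtain ⟨j, h1, h2⟩ := h
    exact (X.nondecreasing _ _ h1).trans (Y.nondecreasing _ _ h2)
  horizontal_mate i i' h hM := by
    simp only [Finset.mem_filter, Finset.mem_univ, true_and] at h ⊢
    obtain ⟨j, h1, h2⟩ := h
    have : i = j := le_antisymm (X.nondecreasing _ _ h1) (Y.nondecreasing _ _ h2)
    subst this
    exact ⟨i', X.horizontal_mate _ _ h1 hM, Y.horizontal_mate _ _ h2 hM⟩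
  initial_unique i l i' l' h hlt h' hM := by
    simp only [Finset.mem_filter, Finset.mem_univ, true_and] at h h'
    obtain ⟨j, h1, h2⟩ := h
    obtain ⟨j', h1', h2'⟩ := h'
    rcases (X.nondecreasing _ _ h1).lt_or_eq with a | a
    · obtain ⟨rfl, rfl⟩ := X.initial_unique _ _ _ _ h1 a h1' hM
      exact ⟨rfl, Y.functional h2' h2⟩
    · subst a
      rcases (X.nondecreasing _ _ h1').lt_or_eq with b | b
      · obtain ⟨rfl, rfl⟩ := X.initial_unique _ _ _ _ h1' b h1 hM.symm
        exact absurd b (lt_irrefl _)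
      · subst b
        exact Y.initial_unique _ _ _ _ h2 hlt h2' hM
  terminal_unique i l i' l' h hlt h' hM := by
    simp only [Finset.mem_filter, Finset.mem_univ, true_and] at h h'
    obtain ⟨j, h1, h2⟩ := h
    obtain ⟨j', h1', h2'⟩ := h'
    rcases (Y.nondecreasing _ _ h2).lt_or_eq with a | a
    · obtain ⟨rfl, rfl⟩ := Y.terminal_unique _ _ _ _ h2 a h2' hM
      exact ⟨X.injective h1' h1, rfl⟩
    · subst a
      rcases (Y.nondecreasing _ _ h2').lt_or_eq with b | b
      · obtain ⟨rfl, rfl⟩ := Y.terminal_unique _ _ _ _ h2' b h2 hM.symm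
        exact absurd b (lt_irrefl _)
      · subst b
        exact X.terminal_unique _ _ _ _ h1 hlt h1' hM

theorem mem_comp {X Y : StrandDiagram Z} {i l : Fin (4 * k)} :
    (i, l) ∈ (comp X Y).strands ↔ ∃ j, (i, j) ∈ X.strands ∧ (j, l) ∈ Y.strands := by
  simp [comp]

theorem comp_assoc (X Y W : StrandDiagram Z) : comp (comp X Y) W = comp X (comp Y W) := by
  apply StrandDiagram.ext
  ext ⟨i, l⟩
  simp only [mem_comp]
  constructor
  · rintro ⟨j, ⟨j', h1, h2⟩, h3⟩
    exact ⟨j', h1, j, h2, h3⟩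
  · rintro ⟨j, h1, j', h2, h3⟩
    exact ⟨j', ⟨j, h1, h2⟩, h3⟩

theorem Composable.assoc_right {X Y W : StrandDiagram Z} (h : Composable X Y)
    (h' : Composable (comp X Y) W) : Composable Y W ∧ Composable X (comp Y W) := by
  refine ⟨⟨?_, ?_, ?_, ?_, ?_⟩, ⟨?_, ?_, ?_, ?_, ?_⟩⟩
  · intro i j hij hlt
    obtain ⟨g, hg⟩ := h.moving_right _ _ hij hlt
    exact h'.moving_left g j (mem_comp.2 ⟨i, hg, hij⟩)
      ((X.nondecreasing _ _ hg).trans_lt hlt)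
  · intro j l hjl hlt
    obtain ⟨i, hi⟩ := h'.moving_right _ _ hjl hlt
    obtain ⟨m, _, hm⟩ := mem_comp.1 hi
    exact ⟨m, hm⟩
  · intro j hj
    obtain ⟨j', i, hM, hi⟩ := h.horizontal_right j hj
    have hj' := Y.horizontal_mate _ _ hj hM
    have hc := mem_comp.2 ⟨j', hi, hj'⟩
    rcases (X.nondecreasing _ _ hi).lt_or_eq with a | a
    · obtain ⟨l, hl⟩ := h'.moving_left _ _ hc a
      exact ⟨j', l, hM, hl⟩
    · subst a
      obtain ⟨m, l, hm, hl⟩ := h'.horizontal_left _ hc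
      exact ⟨m, l, hm.trans hM, hl⟩
  · intro j hj
    obtain ⟨j', i, hM, hi⟩ := h'.horizontal_right j hj
    obtain ⟨m, _, hm⟩ := mem_comp.1 hi
    exact ⟨j', m, hM, hm⟩
  · rintro i j l i' j' l' h1 h2 h3 h4 ⟨c1, c2, c3⟩
    have l1 := Y.nondecreasing _ _ h1
    have l2 := W.nondecreasing _ _ h2
    have l3 := Y.nondecreasing _ _ h3
    have l4 := W.nondecreasing _ _ h4
    obtain ⟨g, hg⟩ := h.moving_right _ _ h1 (by omega)
    have : ∃ g', (g', i') ∈ X.strands := by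
      rcases l3.lt_or_eq with a | a
      · exact h.moving_right _ _ h3 a
      · obtain ⟨g', hg'⟩ := h'.moving_right _ _ h4 (by omega)
        obtain ⟨m, hm, hm'⟩ := mem_comp.1 hg'
        have := Y.injective hm' h3
        subst this
        exact ⟨g', hm⟩
    obtain ⟨g', hg'⟩ := this
    rcases lt_trichotomy g g' with a | a | a
    · exact h'.no_double_crossing _ _ _ _ _ _ (mem_comp.2 ⟨_, hg, h1⟩) h2
        (mem_comp.2 ⟨_, hg', h3⟩) h4 ⟨a, c2, c3⟩
    · subst a
      exact c1.ne (X.functional hg hg')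
    · exact h.no_double_crossing _ _ _ _ _ _ hg' h3 hg h1 ⟨a, c1, c2⟩
  · intro i j hij hlt
    obtain ⟨l, hl⟩ := h.moving_left _ _ hij hlt
    obtain ⟨m, hm⟩ := h'.moving_left i l (mem_comp.2 ⟨j, hij, hl⟩)
      (hlt.trans_le (Y.nondecreasing _ _ hl))
    exact ⟨m, mem_comp.2 ⟨l, hl, hm⟩⟩
  · intro j l hjl hlt
    obtain ⟨m, h1, h2⟩ := mem_comp.1 hjl
    rcases (Y.nondecreasing _ _ h1).lt_or_eq with a | a
    · exact h.moving_right _ _ h1 a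
    · subst a
      obtain ⟨i, hi⟩ := h'.moving_right _ _ h2 hlt
      obtain ⟨g, hg, hg'⟩ := mem_comp.1 hi
      have := Y.injective hg' h1
      subst this
      exact ⟨i, hg⟩
  · intro j hj
    obtain ⟨j', l, hM, hl⟩ := h.horizontal_left j hj
    rcases (Y.nondecreasing _ _ hl).lt_or_eq with a | a
    · obtain ⟨x, hx⟩ := h.moving_right _ _ hl a
      obtain ⟨m, hm⟩ := h'.moving_left x l (mem_comp.2 ⟨_, hx, hl⟩)
        ((X.nondecreasing _ _ hx).trans_lt a)
      exact ⟨j', m, hM, mem_comp.2 ⟨_, hl, hm⟩⟩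
    · subst a
      have hY := Y.horizontal_mate _ _ hl hM.symm
      obtain ⟨j'', m, hM', hm⟩ := h'.horizontal_left j (mem_comp.2 ⟨_, hj, hY⟩)
      exact ⟨j'', m, hM', mem_comp.2 ⟨_, Y.horizontal_mate _ _ hY hM', hm⟩⟩
  · intro j hj
    obtain ⟨m, h1, h2⟩ := mem_comp.1 hj
    have : j = m := le_antisymm (Y.nondecreasing _ _ h1) (W.nondecreasing _ _ h2)
    subst this
    exact h.horizontal_right _ h1
  · rintro i j l i' j' l' h1 h2 h3 h4 ⟨c1, c2, c3⟩
    obtain ⟨m, h5, h6⟩ := mem_comp.1 h2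
    obtain ⟨m', h7, h8⟩ := mem_comp.1 h4
    rcases lt_trichotomy m m' with a | a | a
    · exact h.no_double_crossing _ _ _ _ _ _ h1 h5 h3 h7 ⟨c1, c2, a⟩
    · subst a
      exact c2.ne (Y.injective h7 h5)
    · exact h'.no_double_crossing _ _ _ _ _ _ (mem_comp.2 ⟨_, h1, h5⟩) h6
        (mem_comp.2 ⟨_, h3, h7⟩) h8 ⟨c1, a, c3⟩

theorem Composable.assoc_left {X Y W : StrandDiagram Z} (h : Composable Y W)
    (h' : Composable X (comp Y W)) : Composable X Y ∧ Composable (comp X Y) W := by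
  refine ⟨⟨?_, ?_, ?_, ?_, ?_⟩, ⟨?_, ?_, ?_, ?_, ?_⟩⟩
  · intro i j hij hlt
    obtain ⟨l, hl⟩ := h'.moving_left _ _ hij hlt
    obtain ⟨m, hm, _⟩ := mem_comp.1 hl
    exact ⟨m, hm⟩
  · intro i j hij hlt
    obtain ⟨l, hl⟩ := h.moving_left _ _ hij hlt
    exact h'.moving_right i l (mem_comp.2 ⟨j, hij, hl⟩)
      (hlt.trans_le (W.nondecreasing _ _ hl))
  · intro j hj
    obtain ⟨j', l, hM, hl⟩ := h'.horizontal_left j hj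
    obtain ⟨m, hm, _⟩ := mem_comp.1 hl
    exact ⟨j', m, hM, hm⟩
  · intro j hj
    obtain ⟨j', l, hM, hl⟩ := h.horizontal_left j hj
    have hj' := Y.horizontal_mate _ _ hj hM
    have hc := mem_comp.2 ⟨j', hj', hl⟩
    rcases (W.nondecreasing _ _ hl).lt_or_eq with a | a
    · obtain ⟨i, hi⟩ := h'.moving_right _ _ hc a
      exact ⟨j', i, hM, hi⟩
    · subst a
      obtain ⟨m, i, hm, hi⟩ := h'.horizontal_right _ hc
      exact ⟨m, i, hm.trans hM, hi⟩
  · rintro i j l i' j' l' h1 h2 h3 h4 ⟨c1, c2, c3⟩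
    have l1 := X.nondecreasing _ _ h1
    have l2 := Y.nondecreasing _ _ h2
    have l3 := X.nondecreasing _ _ h3
    have l4 := Y.nondecreasing _ _ h4
    obtain ⟨g', hg'⟩ := h.moving_left _ _ h4 (by omega)
    have : ∃ g, (l, g) ∈ W.strands := by
      rcases l2.lt_or_eq with a | a
      · exact h.moving_left _ _ h2 a
      · obtain ⟨g, hg⟩ := h'.moving_left _ _ h1 (by omega)
        obtain ⟨m, hm, hm'⟩ := mem_comp.1 hg
        have := Y.functional hm h2
        subst this
        exact ⟨g, hm'⟩
    obtain ⟨g, hg⟩ := this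
    rcases lt_trichotomy g g' with a | a | a
    · exact h'.no_double_crossing _ _ _ _ _ _ h1 (mem_comp.2 ⟨_, h2, hg⟩) h3
        (mem_comp.2 ⟨_, h4, hg'⟩) ⟨c1, c2, a⟩
    · subst a
      exact c3.ne (W.injective hg hg')
    · exact h.no_double_crossing _ _ _ _ _ _ h4 hg' h2 hg ⟨c2, c3, a⟩
  · intro i l hil hlt
    obtain ⟨j, h1, h2⟩ := mem_comp.1 hil
    rcases (Y.nondecreasing _ _ h2).lt_or_eq with a | a
    · exact h.moving_left _ _ h2 a
    · subst a
      obtain ⟨m, hm⟩ := h'.moving_left _ _ h1 hlt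
      obtain ⟨g, hg, hg'⟩ := mem_comp.1 hm
      have := Y.functional hg h2
      subst this
      exact ⟨m, hg'⟩
  · intro j l hjl hlt
    obtain ⟨i, hi⟩ := h.moving_right _ _ hjl hlt
    obtain ⟨m, hm⟩ := h'.moving_right i l (mem_comp.2 ⟨j, hi, hjl⟩)
      ((Y.nondecreasing _ _ hi).trans_lt hlt)
    exact ⟨m, mem_comp.2 ⟨i, hm, hi⟩⟩
  · intro j hj
    obtain ⟨m, h1, h2⟩ := mem_comp.1 hj
    have : j = m := le_antisymm (X.nondecreasing _ _ h1) (Y.nondecreasing _ _ h2)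
    subst this
    exact h.horizontal_left _ h2
  · intro j hj
    obtain ⟨j', i, hM, hi⟩ := h.horizontal_right j hj
    rcases (Y.nondecreasing _ _ hi).lt_or_eq with a | a
    · obtain ⟨x, hx⟩ := h.moving_left _ _ hi a
      obtain ⟨m, hm⟩ := h'.moving_right i x (mem_comp.2 ⟨_, hi, hx⟩)
        (a.trans_le (W.nondecreasing _ _ hx))
      exact ⟨j', m, hM, mem_comp.2 ⟨_, hm, hi⟩⟩
    · subst a
      have hY := Y.horizontal_mate _ _ hi hM.symm
      obtain ⟨j'', m, hM', hm⟩ := h'.horizontal_right j (mem_comp.2 ⟨_, hY, hj⟩)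
      exact ⟨j'', m, hM', mem_comp.2 ⟨_, hm, Y.horizontal_mate _ _ hY hM'⟩⟩
  · rintro i j l i' j' l' h1 h2 h3 h4 ⟨c1, c2, c3⟩
    obtain ⟨m, h5, h6⟩ := mem_comp.1 h1
    obtain ⟨m', h7, h8⟩ := mem_comp.1 h3
    rcases lt_trichotomy m m' with a | a | a
    · exact h.no_double_crossing _ _ _ _ _ _ h6 h2 h8 h4 ⟨a, c2, c3⟩
    · subst a
      exact c2.ne (Y.functional h8 h6)
    · exact h'.no_double_crossing _ _ _ _ _ _ h5 (mem_comp.2 ⟨_, h6, h2⟩)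
        h7 (mem_comp.2 ⟨_, h8, h4⟩) ⟨c1, a, c3⟩

/-- The horizontal diagram `[0,1] × M⁻¹(S)` of a set `S` of matched pairs. -/
def idem (Z : PointedMatchedCircle k) (S : Finset (Fin (2 * k))) : StrandDiagram Z where
  strands := Finset.univ.filter fun p => p.1 = p.2 ∧ Z.M p.1 ∈ S
  nondecreasing i j h := by
    simp only [Finset.mem_filter, Finset.mem_univ, true_and] at h
    exact h.1.le
  horizontal_mate i j h hM := by
    simp only [Finset.mem_filter, Finset.mem_univ, true_and] at h ⊢
    rw [hM]
    exact h
  initial_unique i j i' j' h hlt _ _ := by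
    simp only [Finset.mem_filter, Finset.mem_univ, true_and] at h
    exact absurd h.1 hlt.ne
  terminal_unique i j i' j' h hlt _ _ := by
    simp only [Finset.mem_filter, Finset.mem_univ, true_and] at h
    exact absurd h.1 hlt.ne

theorem mem_idem {S : Finset (Fin (2 * k))} {i j : Fin (4 * k)} :
    (i, j) ∈ (idem Z S).strands ↔ i = j ∧ Z.M i ∈ S := by
  simp [idem]

/-- The set of matched pairs at which the strands of `X` begin. -/
def initialPairs (X : StrandDiagram Z) : Finset (Fin (2 * k)) :=
  X.strands.image fun p => Z.M p.1

/-- The set of matched pairs at which the strands of `X` end. -/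
def terminalPairs (X : StrandDiagram Z) : Finset (Fin (2 * k)) :=
  X.strands.image fun p => Z.M p.2

theorem mem_initialPairs {X : StrandDiagram Z} {a : Fin (2 * k)} :
    a ∈ X.initialPairs ↔ ∃ i j, (i, j) ∈ X.strands ∧ Z.M i = a := by
  simp [initialPairs]

theorem mem_terminalPairs {X : StrandDiagram Z} {a : Fin (2 * k)} :
    a ∈ X.terminalPairs ↔ ∃ i j, (i, j) ∈ X.strands ∧ Z.M j = a := by
  simp [terminalPairs]

theorem exists_point (Z : PointedMatchedCircle k) (a : Fin (2 * k)) : ∃ p, Z.M p = a := by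
  have h : 0 < (Finset.univ.filter fun p => Z.M p = a).card := by
    rw [Z.two_to_one a]
    exact two_pos
  obtain ⟨p, hp⟩ := Finset.card_pos.1 h
  exact ⟨p, by simpa using hp⟩

theorem composable_idem_left {S : Finset (Fin (2 * k))} {X : StrandDiagram Z} :
    Composable (idem Z S) X ↔ S = X.initialPairs := by
  constructor
  · intro h
    ext a
    rw [mem_initialPairs]
    constructor
    · intro ha
      obtain ⟨p, hp⟩ := exists_point Z a
      obtain ⟨j, l, hM, hl⟩ := h.horizontal_left p (mem_idem.2 ⟨rfl, by rwa [hp]⟩)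
      exact ⟨j, l, hl, hM.trans hp⟩
    · rintro ⟨i, j, hij, rfl⟩
      rcases (X.nondecreasing _ _ hij).lt_or_eq with a | a
      · obtain ⟨m, hm⟩ := h.moving_right _ _ hij a
        obtain ⟨rfl, h2⟩ := mem_idem.1 hm
        exact h2
      · subst a
        obtain ⟨j', m, hM, hm⟩ := h.horizontal_right _ hij
        obtain ⟨rfl, h2⟩ := mem_idem.1 hm
        rwa [← hM]
  · rintro rfl
    refine ⟨?_, ?_, ?_, ?_, ?_⟩
    · intro i j hij hlt
      exact absurd (mem_idem.1 hij).1 hlt.ne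
    · intro j l hjl _
      exact ⟨j, mem_idem.2 ⟨rfl, mem_initialPairs.2 ⟨j, l, hjl, rfl⟩⟩⟩
    · intro j hj
      obtain ⟨i, l, h1, h2⟩ := mem_initialPairs.1 (mem_idem.1 hj).2
      exact ⟨i, l, h2, h1⟩
    · intro j hj
      exact ⟨j, j, rfl, mem_idem.2 ⟨rfl, mem_initialPairs.2 ⟨j, j, hj, rfl⟩⟩⟩
    · rintro i j l i' j' l' h1 _ h3 _ ⟨c1, c2, _⟩
      have e1 := (mem_idem.1 h1).1
      have e3 := (mem_idem.1 h3).1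
      subst e1 e3
      exact lt_asymm c1 c2

theorem composable_idem_right {S : Finset (Fin (2 * k))} {X : StrandDiagram Z} :
    Composable X (idem Z S) ↔ S = X.terminalPairs := by
  constructor
  · intro h
    ext a
    rw [mem_terminalPairs]
    constructor
    · intro ha
      obtain ⟨p, hp⟩ := exists_point Z a
      obtain ⟨j, l, hM, hl⟩ := h.horizontal_right p (mem_idem.2 ⟨rfl, by rwa [hp]⟩)
      exact ⟨l, j, hl, hM.trans hp⟩
    · rintro ⟨i, j, hij, rfl⟩
      rcases (X.nondecreasing _ _ hij).lt_or_eq with a | a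
      · obtain ⟨m, hm⟩ := h.moving_left _ _ hij a
        exact (mem_idem.1 hm).2
      · subst a
        obtain ⟨j', m, hM, hm⟩ := h.horizontal_left _ hij
        have := (mem_idem.1 hm).2
        rwa [← hM]
  · rintro rfl
    refine ⟨?_, ?_, ?_, ?_, ?_⟩
    · intro i j hij _
      exact ⟨j, mem_idem.2 ⟨rfl, mem_terminalPairs.2 ⟨i, j, hij, rfl⟩⟩⟩
    · intro i j hij hlt
      exact absurd (mem_idem.1 hij).1 hlt.ne
    · intro j hj
      exact ⟨j, j, rfl, mem_idem.2 ⟨rfl, mem_terminalPairs.2 ⟨j, j, hj, rfl⟩⟩⟩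
    · intro j hj
      obtain ⟨i, l, h1, h2⟩ := mem_terminalPairs.1 (mem_idem.1 hj).2
      exact ⟨l, i, h2, h1⟩
    · rintro i j l i' j' l' _ h2 _ h4 ⟨_, c2, c3⟩
      have e1 := (mem_idem.1 h2).1
      have e3 := (mem_idem.1 h4).1
      subst e1 e3
      exact lt_asymm c2 c3

theorem idem_comp (X : StrandDiagram Z) : comp (idem Z X.initialPairs) X = X := by
  apply StrandDiagram.ext
  ext ⟨i, j⟩
  rw [mem_comp]
  constructor
  · rintro ⟨m, h1, h2⟩
    obtain ⟨rfl, _⟩ := mem_idem.1 h1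
    exact h2
  · intro h
    exact ⟨i, mem_idem.2 ⟨rfl, mem_initialPairs.2 ⟨i, j, h, rfl⟩⟩, h⟩

theorem comp_idem (X : StrandDiagram Z) : comp X (idem Z X.terminalPairs) = X := by
  apply StrandDiagram.ext
  ext ⟨i, j⟩
  rw [mem_comp]
  constructor
  · rintro ⟨m, h1, h2⟩
    obtain ⟨rfl, _⟩ := mem_idem.1 h2
    exact h1
  · intro h
    exact ⟨j, h, mem_idem.2 ⟨rfl, mem_terminalPairs.2 ⟨i, j, h, rfl⟩⟩⟩

/-- The strands `σ` and `τ` of `X` cross, and the resolution of this crossing does not contain a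
double crossing (i.e. no third strand crosses both `σ` and `τ` while beginning between them and
ending between them). -/
structure ResolvableCrossing (X : StrandDiagram Z) (σ τ : Fin (4 * k) × Fin (4 * k)) : Prop where
  left_mem : σ ∈ X.strands
  right_mem : τ ∈ X.strands
  initial_lt : σ.1 < τ.1
  terminal_lt : τ.2 < σ.2
  no_double_crossing : ∀ ρ ∈ X.strands,
    ¬ (σ.1 < ρ.1 ∧ ρ.1 < τ.1 ∧ τ.2 < ρ.2 ∧ ρ.2 < σ.2)

theorem ResolvableCrossing.facts {X : StrandDiagram Z} {σ τ : Fin (4 * k) × Fin (4 * k)}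
    (h : X.ResolvableCrossing σ τ) :
    τ.1 ≤ τ.2 ∧ (∀ i j, (i, j) ∈ X.strands → Z.M i = Z.M σ.1 → i = σ.1 ∧ j = σ.2) ∧
    (∀ i j, (i, j) ∈ X.strands → Z.M j = Z.M σ.2 → i = σ.1 ∧ j = σ.2) ∧
    (∀ i j, (i, j) ∈ X.strands → Z.M j = Z.M τ.2 → Z.M i = Z.M τ.1) := by
  obtain ⟨s, t⟩ := σ
  obtain ⟨s', t'⟩ := τ
  have h1 := h.left_mem
  have h2 := h.right_mem
  have h3 := h.initial_lt
  have h4 := h.terminal_lt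
  have h5 := X.nondecreasing _ _ h2
  simp only at h3 h4 ⊢
  have h6 : s < t := h3.trans_le (h5.trans h4.le)
  refine ⟨h5, fun i j hij hM => X.initial_unique _ _ _ _ h1 h6 hij hM,
    fun i j hij hM => X.terminal_unique _ _ _ _ h1 h6 hij hM, fun i j hij hM => ?_⟩
  rcases h5.lt_or_eq with a | a
  · rw [(X.terminal_unique _ _ _ _ h2 a hij hM).1]
  · subst a
    rcases (X.nondecreasing _ _ hij).lt_or_eq with b | b
    · rw [(X.terminal_unique _ _ _ _ hij b h2 hM.symm).1]
    · rw [b, hM]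

/-- The resolution of a crossing: `σ` and `τ` are replaced by the two non-crossing strands with
the same initial and the same terminal points, and if one of them was horizontal, its mate is
dropped. -/
def resolve (X : StrandDiagram Z) (σ τ : Fin (4 * k) × Fin (4 * k))
    (h : X.ResolvableCrossing σ τ) : StrandDiagram Z where
  strands := X.strands.filter (fun ρ => Z.M ρ.1 ≠ Z.M σ.1 ∧ Z.M ρ.1 ≠ Z.M τ.1) ∪
    {(σ.1, τ.2), (τ.1, σ.2)}
  nondecreasing i j hij := by
    obtain ⟨h0, -, -, -⟩ := h.facts
    have h1 := h.initial_lt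
    have h2 := h.terminal_lt
    simp only [Finset.mem_union, Finset.mem_filter, Finset.mem_insert, Finset.mem_singleton,
      Prod.mk.injEq] at hij
    rcases hij with hij | ⟨rfl, rfl⟩ | ⟨rfl, rfl⟩
    · exact X.nondecreasing _ _ hij.1
    · exact h1.le.trans h0
    · exact h0.trans h2.le
  horizontal_mate i j hi hM := by
    obtain ⟨h0, -, -, -⟩ := h.facts
    have h1 := h.initial_lt
    have h2 := h.terminal_lt
    simp only [Finset.mem_union, Finset.mem_filter, Finset.mem_insert, Finset.mem_singleton,
      Prod.mk.injEq] at hi ⊢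
    rcases hi with hi | ⟨e1, e2⟩ | ⟨e1, e2⟩
    · exact Or.inl ⟨X.horizontal_mate _ _ hi.1 hM, by rw [hM]; exact hi.2⟩
    · exact absurd (e1.symm.trans e2) (h1.trans_le h0).ne
    · exact absurd (e1.symm.trans e2) (h0.trans_lt h2).ne
  initial_unique i j i' j' hij hlt hij' hM := by
    obtain ⟨h0, h1, h2, h3⟩ := h.facts
    have h4 : Z.M τ.1 ≠ Z.M σ.1 := fun e => h.initial_lt.ne' (h1 _ _ h.right_mem e).1
    simp only [Finset.mem_union, Finset.mem_filter, Finset.mem_insert, Finset.mem_singleton,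
      Prod.mk.injEq] at hij hij'
    rcases hij with ⟨g1, g2, g3⟩ | ⟨rfl, rfl⟩ | ⟨rfl, rfl⟩ <;>
    rcases hij' with ⟨f1, f2, f3⟩ | ⟨rfl, rfl⟩ | ⟨rfl, rfl⟩
    · exact X.initial_unique _ _ _ _ g1 hlt f1 hM
    · exact absurd hM.symm g2
    · exact absurd hM.symm g3
    · exact absurd hM f2
    · exact ⟨rfl, rfl⟩
    · exact absurd hM h4
    · exact absurd hM f3
    · exact absurd hM.symm h4
    · exact ⟨rfl, rfl⟩
  terminal_unique i j i' j' hij hlt hij' hM := by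
    obtain ⟨h0, h1, h2, h3⟩ := h.facts
    have h4 : Z.M τ.2 ≠ Z.M σ.2 := fun e => h.initial_lt.ne' (h2 _ _ h.right_mem e).1
    simp only [Finset.mem_union, Finset.mem_filter, Finset.mem_insert, Finset.mem_singleton,
      Prod.mk.injEq] at hij hij'
    have key : ∀ a b, (a, b) ∈ X.strands → Z.M a ≠ Z.M σ.1 → Z.M b ≠ Z.M σ.2 :=
      fun a b hab hne e => hne (by rw [(h2 _ _ hab e).1])
    rcases hij with ⟨g1, g2, g3⟩ | ⟨rfl, rfl⟩ | ⟨rfl, rfl⟩ <;>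
    rcases hij' with ⟨f1, f2, f3⟩ | ⟨rfl, rfl⟩ | ⟨rfl, rfl⟩
    · exact X.terminal_unique _ _ _ _ g1 hlt f1 hM
    · exact absurd (h3 _ _ g1 hM.symm) g3
    · exact absurd hM.symm (key _ _ g1 g2)
    · exact absurd (h3 _ _ f1 hM) f3
    · exact ⟨rfl, rfl⟩
    · exact absurd hM.symm h4
    · exact absurd hM (key _ _ f1 f2)
    · exact absurd hM h4
    · exact ⟨rfl, rfl⟩

/-- The local multiplicity of the one-chain `supp X` at the interval between the marked points
`q` and `q + 1` (labels starting from `0`), i.e. the number of strands that pass over it. -/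
def supp (X : StrandDiagram Z) : Fin (4 * k - 1) → ℤ := fun q =>
  ((X.strands.filter fun σ => σ.1.val ≤ q.val ∧ q.val < σ.2.val).card : ℤ)

/-- The non-horizontal strands. -/
def moving (X : StrandDiagram Z) : Finset (Fin (4 * k) × Fin (4 * k)) :=
  X.strands.filter fun σ => σ.1 < σ.2

end StrandDiagram

/-! ### The algebra of a pointed matched circle -/

open StrandDiagram

/-- The algebra `A(Z)`: the `𝔽₂`-vector space with basis the strands diagrams. -/
def StrandAlg {k : ℕ} (Z : PointedMatchedCircle k) : Type := StrandDiagram Z →₀ ZMod 2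

namespace StrandAlg

variable {k : ℕ} {Z : PointedMatchedCircle k}

noncomputable instance : AddCommGroup (StrandAlg Z) :=
  inferInstanceAs (AddCommGroup (StrandDiagram Z →₀ ZMod 2))

noncomputable instance : Module (ZMod 2) (StrandAlg Z) :=
  inferInstanceAs (Module (ZMod 2) (StrandDiagram Z →₀ ZMod 2))

/-- The basis of `A(Z)` given by the strands diagrams. -/
noncomputable def basis (Z : PointedMatchedCircle k) :
    Module.Basis (StrandDiagram Z) (ZMod 2) (StrandAlg Z) :=
  Module.Basis.ofRepr (LinearEquiv.refl (ZMod 2) (StrandDiagram Z →₀ ZMod 2))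

open Classical in
/-- The product of two basic generators. -/
noncomputable def basicMul (X Y : StrandDiagram Z) : StrandAlg Z :=
  if Composable X Y then basis Z (comp X Y) else 0

/-- The product of `A(Z)`, the bilinear extension of the product of basic generators. -/
noncomputable def mulHom (Z : PointedMatchedCircle k) :
    StrandAlg Z →ₗ[ZMod 2] StrandAlg Z →ₗ[ZMod 2] StrandAlg Z :=
  (basis Z).constr (ZMod 2) fun X => (basis Z).constr (ZMod 2) fun Y => basicMul X Y

noncomputable instance : Mul (StrandAlg Z) := ⟨fun a b => mulHom Z a b⟩

noncomputable instance : One (StrandAlg Z) := ⟨∑ S, basis Z (idem Z S)⟩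

theorem mul_def (a b : StrandAlg Z) : a * b = mulHom Z a b := rfl

theorem one_def : (1 : StrandAlg Z) = ∑ S, basis Z (idem Z S) := rfl

theorem basis_mul_basis (X Y : StrandDiagram Z) :
    basis Z X * basis Z Y = basicMul X Y := by
  rw [mul_def, mulHom, Module.Basis.constr_basis, Module.Basis.constr_basis]

theorem basicMul_assoc (X Y W : StrandDiagram Z) :
    mulHom Z (basicMul X Y) (basis Z W) = mulHom Z (basis Z X) (basicMul Y W) := by
  unfold basicMul
  by_cases h : Composable X Y
  · by_cases h' : Composable (comp X Y) W
    · obtain ⟨h1, h2⟩ := h.assoc_right h'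
      rw [if_pos h, if_pos h1, ← mul_def, ← mul_def, basis_mul_basis, basis_mul_basis, basicMul,
        basicMul, if_pos h', if_pos h2, comp_assoc]
    · rw [if_pos h, ← mul_def, basis_mul_basis, basicMul, if_neg h']
      by_cases h1 : Composable Y W
      · have h2 : ¬ Composable X (comp Y W) := fun h2 => h' (h1.assoc_left h2).2
        rw [if_pos h1, ← mul_def, basis_mul_basis, basicMul, if_neg h2]
      · rw [if_neg h1, map_zero]
  · rw [if_neg h, map_zero, LinearMap.zero_apply]
    by_cases h1 : Composable Y W
    · have h2 : ¬ Composable X (comp Y W) := fun h2 => h (h1.assoc_left h2).1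
      rw [if_pos h1, ← mul_def, basis_mul_basis, basicMul, if_neg h2]
    · rw [if_neg h1, map_zero]

theorem induct {p : StrandAlg Z → Prop} (hb : ∀ X, p (basis Z X)) (h0 : p 0)
    (ha : ∀ x y, p x → p y → p (x + y)) (hs : ∀ (c : ZMod 2) x, p x → p (c • x))
    (a : StrandAlg Z) : p a := by
  refine Submodule.span_induction (p := fun x _ => p x) ?_ h0 (fun x y _ _ => ha x y)
    (fun c x _ => hs c x) ((basis Z).mem_span a)
  rintro _ ⟨X, rfl⟩
  exact hb X

protected theorem mul_assoc (a b c : StrandAlg Z) : a * b * c = a * (b * c) := by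
  simp only [mul_def]
  induction a using induct with
  | hb X =>
    induction b using induct with
    | hb Y =>
      induction c using induct with
      | hb W =>
        rw [← mul_def (basis Z X) (basis Z Y), ← mul_def (basis Z Y) (basis Z W), basis_mul_basis,
          basis_mul_basis, basicMul_assoc]
      | h0 => simp
      | ha x y hx hy => simp only [map_add, hx, hy]
      | hs r x hx => simp only [map_smul, hx]
    | h0 => simp
    | ha x y hx hy => simp only [map_add, LinearMap.add_apply, hx, hy]
    | hs r x hx => simp only [map_smul, LinearMap.smul_apply, hx]
  | h0 => simp
  | ha x y hx hy => simp only [map_add, LinearMap.add_apply, hx, hy]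
  | hs r x hx => simp only [map_smul, LinearMap.smul_apply, hx]

protected theorem one_mul (a : StrandAlg Z) : 1 * a = a := by
  rw [mul_def, one_def]
  induction a using induct with
  | hb X =>
    rw [map_sum, LinearMap.sum_apply, Finset.sum_eq_single X.initialPairs]
    · rw [← mul_def, basis_mul_basis, basicMul, if_pos (composable_idem_left.2 rfl), idem_comp]
    · intro S _ hS
      rw [← mul_def, basis_mul_basis, basicMul, if_neg fun h => hS (composable_idem_left.1 h)]
    · intro h
      exact absurd (Finset.mem_univ _) h
  | h0 => exact map_zero _
  | ha x y hx hy => rw [map_add, hx, hy]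
  | hs r x hx => rw [map_smul, hx]

protected theorem mul_one (a : StrandAlg Z) : a * 1 = a := by
  rw [mul_def, one_def]
  induction a using induct with
  | hb X =>
    rw [map_sum, Finset.sum_eq_single X.terminalPairs]
    · rw [← mul_def, basis_mul_basis, basicMul, if_pos (composable_idem_right.2 rfl), comp_idem]
    · intro S _ hS
      rw [← mul_def, basis_mul_basis, basicMul, if_neg fun h => hS (composable_idem_right.1 h)]
    · intro h
      exact absurd (Finset.mem_univ _) h
  | h0 => simp
  | ha x y hx hy => rw [map_add, LinearMap.add_apply, hx, hy]
  | hs r x hx => rw [map_smul, LinearMap.smul_apply, hx]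

noncomputable instance : Ring (StrandAlg Z) :=
  { (inferInstance : AddCommGroup (StrandAlg Z)) with
    mul := (· * ·)
    one := 1
    mul_assoc := StrandAlg.mul_assoc
    one_mul := StrandAlg.one_mul
    mul_one := StrandAlg.mul_one
    left_distrib := fun a b c => map_add (mulHom Z a) b c
    right_distrib := fun a b c => by
      simp only [mul_def, map_add, LinearMap.add_apply]
    zero_mul := fun a => by simp only [mul_def, map_zero, LinearMap.zero_apply]
    mul_zero := fun a => map_zero (mulHom Z a) }

noncomputable instance : Algebra (ZMod 2) (StrandAlg Z) :=
  Algebra.ofModule (fun r a b => by simp only [mul_def, map_smul, LinearMap.smul_apply])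
    (fun r a b => by simp only [mul_def, map_smul])

open Classical in
/-- The differential of a basic generator: the sum of the resolutions of its crossings, where a
resolution with a double crossing counts as zero. -/
noncomputable def basicDiff (X : StrandDiagram Z) : StrandAlg Z :=
  ∑ σ, ∑ τ, if h : X.ResolvableCrossing σ τ then basis Z (X.resolve σ τ h) else 0

/-- The differential of `A(Z)`. -/
noncomputable def diff (Z : PointedMatchedCircle k) : StrandAlg Z →ₗ[ZMod 2] StrandAlg Z :=
  (basis Z).constr (ZMod 2) basicDiff

/-- The basic idempotent `I(S)` of a set `S` of matched pairs. -/
noncomputable def idempotent (Z : PointedMatchedCircle k) (S : Finset (Fin (2 * k))) :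
    StrandAlg Z :=
  basis Z (idem Z S)

open Classical in
/-- The algebra element `a(ξ)` of the chord `ξ = [i, j]`: the sum of all strands diagrams in which
the strand from `i` to `j` is the only non-horizontal strand. -/
noncomputable def chordElement (Z : PointedMatchedCircle k) (i j : Fin (4 * k)) : StrandAlg Z :=
  ∑ X : StrandDiagram Z, if X.moving = {(i, j)} then basis Z X else 0

end StrandAlg

/-! ### The grading group -/

section Chains

variable {n : ℕ}

/-- For a one-chain `α`, an element of `H₁(Z ∖ {z}, 𝐚)` given by its local multiplicities at the
`n - 1` intervals between consecutive marked points: the local multiplicity just before `p`. -/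
def multBefore (α : Fin (n - 1) → ℤ) (p : Fin n) : ℤ :=
  if h : 1 ≤ p.val then α ⟨p.val - 1, by omega⟩ else 0

/-- The local multiplicity of `α` just after the marked point `p`. -/
def multAfter (α : Fin (n - 1) → ℤ) (p : Fin n) : ℤ :=
  if h : p.val < n - 1 then α ⟨p.val, h⟩ else 0

/-- The coefficient of `p` in the boundary `∂α`; for an interval `[s, t]` this is `t - s`. -/
def boundaryAt (α : Fin (n - 1) → ℤ) (p : Fin n) : ℤ := multBefore α p - multAfter α p

/-- The local multiplicity `m(α, p)` at a marked point: the average of those on both sides. -/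
def multAt (α : Fin (n - 1) → ℤ) (p : Fin n) : ℚ := ((multBefore α p + multAfter α p : ℤ) : ℚ) / 2

/-- The pairing `m(α, ∂β)`. -/
def multBoundary (α β : Fin (n - 1) → ℤ) : ℚ := ∑ p, (boundaryAt β p : ℚ) * multAt α p

/-- The number of marked points at which the local multiplicity of `α` changes its parity. -/
def parityChanges (α : Fin (n - 1) → ℤ) : ℕ :=
  (Finset.univ.filter fun p => boundaryAt α p % 2 ≠ 0).card

theorem multBefore_add (α β : Fin (n - 1) → ℤ) (p : Fin n) :
    multBefore (α + β) p = multBefore α p + multBefore β p := by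
  unfold multBefore; split <;> simp

theorem multAfter_add (α β : Fin (n - 1) → ℤ) (p : Fin n) :
    multAfter (α + β) p = multAfter α p + multAfter β p := by
  unfold multAfter; split <;> simp

theorem multBefore_neg (α : Fin (n - 1) → ℤ) (p : Fin n) :
    multBefore (-α) p = -multBefore α p := by
  unfold multBefore; split <;> simp

theorem multAfter_neg (α : Fin (n - 1) → ℤ) (p : Fin n) :
    multAfter (-α) p = -multAfter α p := by
  unfold multAfter; split <;> simp

theorem boundaryAt_add (α β : Fin (n - 1) → ℤ) (p : Fin n) :
    boundaryAt (α + β) p = boundaryAt α p + boundaryAt β p := by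
  unfold boundaryAt; rw [multBefore_add, multAfter_add]; ring

theorem boundaryAt_neg (α : Fin (n - 1) → ℤ) (p : Fin n) :
    boundaryAt (-α) p = -boundaryAt α p := by
  unfold boundaryAt; rw [multBefore_neg, multAfter_neg]; ring

theorem multAt_add (α β : Fin (n - 1) → ℤ) (p : Fin n) :
    multAt (α + β) p = multAt α p + multAt β p := by
  unfold multAt; rw [multBefore_add, multAfter_add]; push_cast; ring

theorem multAt_neg (α : Fin (n - 1) → ℤ) (p : Fin n) : multAt (-α) p = -multAt α p := by
  unfold multAt; rw [multBefore_neg, multAfter_neg]; push_cast; ring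

theorem multBoundary_add_left (α β γ : Fin (n - 1) → ℤ) :
    multBoundary (α + β) γ = multBoundary α γ + multBoundary β γ := by
  simp only [multBoundary, multAt_add, mul_add, Finset.sum_add_distrib]

theorem multBoundary_add_right (α β γ : Fin (n - 1) → ℤ) :
    multBoundary α (β + γ) = multBoundary α β + multBoundary α γ := by
  simp only [multBoundary, boundaryAt_add, Int.cast_add, add_mul, Finset.sum_add_distrib]

theorem multBoundary_neg_right (α β : Fin (n - 1) → ℤ) :
    multBoundary α (-β) = -multBoundary α β := by
  simp only [multBoundary, boundaryAt_neg, Int.cast_neg, neg_mul, Finset.sum_neg_distrib]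

theorem multBoundary_neg_left (α β : Fin (n - 1) → ℤ) :
    multBoundary (-α) β = -multBoundary α β := by
  simp only [multBoundary, multAt_neg, mul_neg, Finset.sum_neg_distrib]

theorem multBoundary_zero_left (β : Fin (n - 1) → ℤ) : multBoundary 0 β = 0 := by
  have := multBoundary_add_left 0 0 β
  simpa using this

theorem multBoundary_zero_right (α : Fin (n - 1) → ℤ) : multBoundary α 0 = 0 := by
  have := multBoundary_add_right α 0 0
  simpa using this

theorem parityChanges_eq (α : Fin (n - 1) → ℤ) :
    (parityChanges α : ℤ) = ∑ p, boundaryAt α p % 2 := by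
  rw [parityChanges, Finset.card_filter, Nat.cast_sum]
  refine Finset.sum_congr rfl fun p _ => ?_
  split_ifs with h
  · push_cast
    omega
  · push_cast
    omega

theorem parityChanges_zero : parityChanges (0 : Fin (n - 1) → ℤ) = 0 := by
  simp [parityChanges, boundaryAt, multBefore, multAfter]

theorem parityChanges_neg (α : Fin (n - 1) → ℤ) : parityChanges (-α) = parityChanges α := by
  simp only [parityChanges, boundaryAt_neg]
  congr 1
  refine Finset.filter_congr fun p _ => ?_
  omega

theorem parityChanges_add (α β : Fin (n - 1) → ℤ) : ∃ c : ℤ,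
    (parityChanges α : ℚ) / 4 + parityChanges β / 4 + multBoundary β α =
      parityChanges (α + β) / 4 + c := by
  have key : ∀ p : Fin n, ∃ c : ℤ, boundaryAt α p % 2 + boundaryAt β p % 2 +
      2 * (boundaryAt α p * (multBefore β p + multAfter β p)) =
      boundaryAt (α + β) p % 2 + 4 * c := by
    intro p
    rw [boundaryAt_add]
    have hb : boundaryAt β p = multBefore β p + multAfter β p - 2 * multAfter β p := by
      unfold boundaryAt; ring
    generalize boundaryAt α p = x at *
    generalize boundaryAt β p = y at *
    generalize hm : multBefore β p + multAfter β p = m at *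
    have hm2 : m % 2 = y % 2 := by omega
    rcases Int.even_or_odd' x with ⟨u, rfl | rfl⟩ <;> rcases Int.even_or_odd' m with ⟨v, rfl | rfl⟩
    · exact ⟨2 * u * v, by
        have e : 2 * (2 * u * (2 * v)) = 4 * (2 * u * v) := by ring
        omega⟩
    · exact ⟨2 * u * v + u, by
        have e : 2 * (2 * u * (2 * v + 1)) = 4 * (2 * u * v + u) := by ring
        omega⟩
    · exact ⟨2 * u * v + v, by
        have e : 2 * ((2 * u + 1) * (2 * v)) = 4 * (2 * u * v + v) := by ring
        omega⟩
    · exact ⟨2 * u * v + u + v + 1, by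
        have e : 2 * ((2 * u + 1) * (2 * v + 1)) = 4 * (2 * u * v + u + v) + 2 := by ring
        omega⟩
  choose c hc using key
  have hs := Finset.sum_congr (rfl : (Finset.univ : Finset (Fin n)) = Finset.univ)
    fun p _ => hc p
  simp only [Finset.sum_add_distrib, ← Finset.mul_sum, ← parityChanges_eq] at hs
  refine ⟨∑ p, c p, ?_⟩
  have hm : multBoundary β α =
      ((∑ p, boundaryAt α p * (multBefore β p + multAfter β p) : ℤ) : ℚ) / 2 := by
    simp only [multBoundary, multAt, Int.cast_sum, Finset.sum_div]
    refine Finset.sum_congr rfl fun p _ => ?_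
    push_cast
    ring
  have hs' := congrArg (Int.cast : ℤ → ℚ) hs
  push_cast at hs'
  rw [hm]
  push_cast
  linarith

end Chains

/-- The big grading group `G'(Z)`: pairs `(j, α)` with `α ∈ H₁(Z ∖ {z}, 𝐚)` and `j ∈ ½ℤ` congruent
modulo `1` to a quarter of the number of parity changes of `α`. -/
@[ext]
structure GradingGroup {k : ℕ} (Z : PointedMatchedCircle k) where
  maslov : ℚ
  chain : Fin (4 * k - 1) → ℤ
  congruence : ∃ c : ℤ, maslov = parityChanges chain / 4 + c

namespace GradingGroup

variable {k : ℕ} {Z : PointedMatchedCircle k}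

instance : Mul (GradingGroup Z) where
  mul g h :=
    { maslov := g.maslov + h.maslov + multBoundary h.chain g.chain
      chain := g.chain + h.chain
      congruence := by
        obtain ⟨a, ha⟩ := g.congruence
        obtain ⟨b, hb⟩ := h.congruence
        obtain ⟨c, hc⟩ := parityChanges_add g.chain h.chain
        refine ⟨a + b + c, ?_⟩
        rw [ha, hb]
        push_cast
        linarith }

instance : One (GradingGroup Z) where
  one :=
    { maslov := 0
      chain := 0
      congruence := ⟨0, by rw [parityChanges_zero]; norm_num⟩ }

instance : Inv (GradingGroup Z) where
  inv g :=
    { maslov := -g.maslov + multBoundary g.chain g.chain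
      chain := -g.chain
      congruence := by
        obtain ⟨a, ha⟩ := g.congruence
        obtain ⟨c, hc⟩ := parityChanges_add g.chain (-g.chain)
        rw [add_neg_cancel, parityChanges_zero, parityChanges_neg, multBoundary_neg_left] at hc
        refine ⟨-a - c, ?_⟩
        rw [ha, parityChanges_neg]
        push_cast at hc ⊢
        linarith }

theorem mul_maslov (g h : GradingGroup Z) :
    (g * h).maslov = g.maslov + h.maslov + multBoundary h.chain g.chain := rfl

theorem mul_chain (g h : GradingGroup Z) : (g * h).chain = g.chain + h.chain := rfl

theorem one_maslov : (1 : GradingGroup Z).maslov = 0 := rfl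

theorem one_chain : (1 : GradingGroup Z).chain = 0 := rfl

theorem inv_maslov (g : GradingGroup Z) :
    g⁻¹.maslov = -g.maslov + multBoundary g.chain g.chain := rfl

theorem inv_chain (g : GradingGroup Z) : g⁻¹.chain = -g.chain := rfl

instance : Group (GradingGroup Z) :=
  Group.ofLeftAxioms
    (fun a b c => by
      ext1
      · simp only [mul_maslov, mul_chain, multBoundary_add_left, multBoundary_add_right]
        ring
      · simp only [mul_chain, add_assoc])
    (fun a => by
      ext1
      · simp only [mul_maslov, one_maslov, one_chain, multBoundary_zero_right]
        ring
      · simp only [mul_chain, one_chain, zero_add])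
    (fun a => by
      ext1
      · simp only [mul_maslov, inv_maslov, inv_chain, one_maslov, multBoundary_neg_right]
        ring
      · simp only [mul_chain, one_chain, inv_chain, neg_add_cancel])

/-- The distinguished central element `λ = (1, 0)`. -/
def lam (Z : PointedMatchedCircle k) : GradingGroup Z where
  maslov := 1
  chain := 0
  congruence := ⟨1, by rw [parityChanges_zero]; norm_num⟩

end GradingGroup

namespace StrandDiagram

variable {k : ℕ} {Z : PointedMatchedCircle k}

/-- The number of crossings between non-horizontal strands. -/
def inv (X : StrandDiagram Z) : ℕ :=
  ((X.moving ×ˢ X.moving).filter fun c => c.1.1 < c.2.1 ∧ c.2.2 < c.1.2).card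

/-- The number `ι(X) = inv(X) - m(supp X, S)`, where `S` is the set of initial points. Only the
non-horizontal strands are counted in both terms: if `X` has a horizontal strand at `p`, then no
non-horizontal strand begins or ends at `p`, so both the number of crossings on this horizontal
strand and `m(supp X, p)` are equal to the number of strands passing over `p`, and its
contributions to the two terms cancel (whichever weight one gives to it). -/
def iota (X : StrandDiagram Z) : ℚ := X.inv - ∑ σ ∈ X.moving, multAt X.supp σ.1

theorem multBefore_supp (X : StrandDiagram Z) (p : Fin (4 * k)) :
    multBefore X.supp p = ((X.strands.filter fun σ => σ.1 < p ∧ p ≤ σ.2).card : ℤ) := by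
  unfold multBefore supp
  split_ifs with h
  · congr 2
    refine Finset.filter_congr fun σ _ => ?_
    rw [Fin.lt_def, Fin.le_def]
    simp only
    omega
  · rw [eq_comm, Nat.cast_eq_zero, Finset.card_eq_zero, Finset.filter_eq_empty_iff]
    intro σ _
    rw [Fin.lt_def]
    omega

theorem multAfter_supp (X : StrandDiagram Z) (p : Fin (4 * k)) :
    multAfter X.supp p = ((X.strands.filter fun σ => σ.1 ≤ p ∧ p < σ.2).card : ℤ) := by
  unfold multAfter supp
  split_ifs with h
  · congr 2
  · rw [eq_comm, Nat.cast_eq_zero, Finset.card_eq_zero, Finset.filter_eq_empty_iff]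
    intro σ _
    have := σ.2.isLt
    rw [Fin.lt_def]
    omega

theorem boundaryAt_supp (X : StrandDiagram Z) (p : Fin (4 * k)) :
    boundaryAt X.supp p = ((X.moving.filter fun σ => σ.2 = p).card : ℤ) -
      ((X.moving.filter fun σ => σ.1 = p).card : ℤ) := by
  have e1 : (X.strands.filter fun σ => σ.1 < p ∧ p ≤ σ.2).card =
      (X.strands.filter fun σ => σ.1 < p ∧ p < σ.2).card +
      (X.moving.filter fun σ => σ.2 = p).card := by
    rw [moving, Finset.filter_filter, ← Finset.card_union_of_disjoint]
    · congr 1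
      ext σ
      simp only [Finset.mem_filter, Finset.mem_union]
      constructor
      · rintro ⟨h, h1, h2⟩
        rcases h2.lt_or_eq with a | a
        · exact Or.inl ⟨h, h1, a⟩
        · exact Or.inr ⟨h, a ▸ h1, a.symm⟩
      · rintro (⟨h, h1, h2⟩ | ⟨h, h1, h2⟩)
        · exact ⟨h, h1, h2.le⟩
        · exact ⟨h, h2 ▸ h1, h2.ge⟩
    · rw [Finset.disjoint_left]
      intro σ h1 h2
      simp only [Finset.mem_filter] at h1 h2
      exact h1.2.2.ne' h2.2.2
  have e2 : (X.strands.filter fun σ => σ.1 ≤ p ∧ p < σ.2).card =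
      (X.strands.filter fun σ => σ.1 < p ∧ p < σ.2).card +
      (X.moving.filter fun σ => σ.1 = p).card := by
    rw [moving, Finset.filter_filter, ← Finset.card_union_of_disjoint]
    · congr 1
      ext σ
      simp only [Finset.mem_filter, Finset.mem_union]
      constructor
      · rintro ⟨h, h1, h2⟩
        rcases h1.lt_or_eq with a | a
        · exact Or.inl ⟨h, a, h2⟩
        · exact Or.inr ⟨h, a ▸ h2, a⟩
      · rintro (⟨h, h1, h2⟩ | ⟨h, h1, h2⟩)
        · exact ⟨h, h1.le, h2⟩
        · exact ⟨h, h2.le, h2 ▸ h1⟩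
    · rw [Finset.disjoint_left]
      intro σ h1 h2
      simp only [Finset.mem_filter] at h1 h2
      exact h1.2.1.ne h2.2.2
  rw [boundaryAt, multBefore_supp, multAfter_supp, e1, e2]
  push_cast
  ring

theorem card_initial_le_one (X : StrandDiagram Z) (p : Fin (4 * k)) :
    (X.moving.filter fun σ => σ.1 = p).card ≤ 1 := by
  rw [Finset.card_le_one]
  rintro ⟨a, b⟩ h ⟨c, d⟩ h'
  simp only [moving, Finset.mem_filter] at h h'
  obtain ⟨⟨h1, _⟩, rfl⟩ := h
  obtain ⟨⟨h2, _⟩, rfl⟩ := h'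
  rw [X.functional h1 h2]

theorem card_terminal_le_one (X : StrandDiagram Z) (p : Fin (4 * k)) :
    (X.moving.filter fun σ => σ.2 = p).card ≤ 1 := by
  rw [Finset.card_le_one]
  rintro ⟨a, b⟩ h ⟨c, d⟩ h'
  simp only [moving, Finset.mem_filter] at h h'
  obtain ⟨⟨h1, _⟩, rfl⟩ := h
  obtain ⟨⟨h2, _⟩, rfl⟩ := h'
  rw [X.injective h1 h2]

theorem iota_congruence (X : StrandDiagram Z) :
    ∃ c : ℤ, X.iota = parityChanges X.supp / 4 + c := by
  have key : ∀ p : Fin (4 * k), ∃ c : ℤ, boundaryAt X.supp p % 2 +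
      2 * (((X.moving.filter fun σ => σ.1 = p).card : ℤ) *
        (multBefore X.supp p + multAfter X.supp p)) =
      boundaryAt X.supp p + 4 * c := by
    intro p
    have h1 := X.card_initial_le_one p
    have h2 := X.card_terminal_le_one p
    have h3 := X.boundaryAt_supp p
    have h4 : boundaryAt X.supp p = multBefore X.supp p - multAfter X.supp p := rfl
    generalize (X.moving.filter fun σ => σ.1 = p).card = s at *
    generalize (X.moving.filter fun σ => σ.2 = p).card = e at *
    rw [h3] at h4 ⊢
    have hl : multBefore X.supp p = multAfter X.supp p + (e - s) := by omega
    rw [hl]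
    generalize multAfter X.supp p = r
    interval_cases s
    · exact ⟨0, by push_cast; omega⟩
    · interval_cases e
      · exact ⟨r, by push_cast; omega⟩
      · exact ⟨r, by push_cast; omega⟩
  choose c hc using key
  have hs := Finset.sum_congr (rfl : (Finset.univ : Finset (Fin (4 * k))) = Finset.univ)
    fun p _ => hc p
  simp only [Finset.sum_add_distrib, ← Finset.mul_sum, ← parityChanges_eq] at hs
  have hb : ∑ p, boundaryAt X.supp p = 0 := by
    simp only [boundaryAt_supp, Finset.sum_sub_distrib]
    rw [sub_eq_zero, ← Nat.cast_sum, ← Nat.cast_sum,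
      ← Finset.card_eq_sum_card_fiberwise (fun _ _ => Finset.mem_coe.2 (Finset.mem_univ _)),
      ← Finset.card_eq_sum_card_fiberwise (fun _ _ => Finset.mem_coe.2 (Finset.mem_univ _))]
  have hm : ∑ σ ∈ X.moving, multAt X.supp σ.1 =
      ((∑ p, ((X.moving.filter fun σ => σ.1 = p).card : ℤ) *
        (multBefore X.supp p + multAfter X.supp p) : ℤ) : ℚ) / 2 := by
    rw [← Finset.sum_fiberwise X.moving (fun σ => σ.1), Int.cast_sum, Finset.sum_div]
    refine Finset.sum_congr rfl fun p _ => ?_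
    rw [Finset.sum_congr rfl (g := fun _ => multAt X.supp p)
      (fun σ hσ => by rw [(Finset.mem_filter.1 hσ).2]), Finset.sum_const, nsmul_eq_mul, multAt]
    push_cast
    ring
  refine ⟨X.inv - ∑ p, c p, ?_⟩
  have hs' := congrArg (Int.cast : ℤ → ℚ) hs
  rw [hb] at hs'
  push_cast at hs'
  rw [iota, hm]
  push_cast
  linarith

/-- The grading `gr'(X) = (ι(X), supp X)` of a basic generator. -/
def gr (X : StrandDiagram Z) : GradingGroup Z where
  maslov := X.iota
  chain := X.supp
  congruence := X.iota_congruence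

end StrandDiagram

/-! ### Bimodules over `A(Z)` and `A(-Z)` -/

section Bimodules

variable {k : ℕ} (Z : PointedMatchedCircle k)

/-- `A(Z) ⊗ A(-Z)`, the tensor product being taken over `𝔽₂`. -/
abbrev BiAlg : Type := StrandAlg Z ⊗[ZMod 2] StrandAlg Z.reverse

/-- The differential of `A(Z) ⊗ A(-Z)`. -/
noncomputable def biDiff : BiAlg Z →ₗ[ZMod 2] BiAlg Z :=
  TensorProduct.map (StrandAlg.diff Z) LinearMap.id +
    TensorProduct.map LinearMap.id (StrandAlg.diff Z.reverse)

/-- The basis of `A(Z) ⊗ A(-Z)` given by pairs of strands diagrams. -/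
noncomputable def biBasis :
    Module.Basis (StrandDiagram Z × StrandDiagram Z.reverse) (ZMod 2) (BiAlg Z) :=
  (StrandAlg.basis Z).tensorProduct (StrandAlg.basis Z.reverse)

/-- The pair of complementary idempotents `I(S) ⊗ I(T)`, where `T` is the complement of `S`. All
pairs of complementary idempotents are of this form, so they are indexed by the sets `S` of matched
pairs. -/
noncomputable def compIdem (S : Finset (Fin (2 * k))) : BiAlg Z :=
  StrandAlg.idempotent Z S ⊗ₜ[ZMod 2] StrandAlg.idempotent Z.reverse Sᶜ

/-- The map on one-chains induced by the orientation-reversing map `r : Z → -Z`. -/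
def reverseChain {n : ℕ} (α : Fin n → ℤ) : Fin n → ℤ := fun q => -α q.rev

/-- The diagonal subalgebra of `A(Z) ⊗ A(-Z)`. -/
noncomputable def diagonalSubalgebra : NonUnitalSubalgebra (ZMod 2) (BiAlg Z) :=
  NonUnitalAlgebra.adjoin (ZMod 2)
    {x | ∃ (X : StrandDiagram Z) (Y : StrandDiagram Z.reverse) (S T : Finset (Fin (2 * k))),
      reverseChain X.supp = -Y.supp ∧
      x = (StrandAlg.idempotent Z S * StrandAlg.basis Z X * StrandAlg.idempotent Z T) ⊗ₜ[ZMod 2]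
        (StrandAlg.idempotent Z.reverse Sᶜ * StrandAlg.basis Z.reverse Y *
          StrandAlg.idempotent Z.reverse Tᶜ)}

/-- The element `ã(ξ) = a(ξ) ⊗ a(r(ξ))` of the chord `ξ = [i, j]`. -/
noncomputable def chordPair (i j : Fin (4 * k)) : BiAlg Z :=
  StrandAlg.chordElement Z i j ⊗ₜ[ZMod 2] StrandAlg.chordElement Z.reverse j.rev i.rev

/-- The underlying module of `DD(Id)`: the direct sum, over all pairs `I` of complementary
idempotents, of the left modules `(A(Z) ⊗ A(-Z)) · I`. -/
noncomputable def DDId : Submodule (BiAlg Z) (Finset (Fin (2 * k)) → BiAlg Z) where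
  carrier := {c | ∀ S, c S * compIdem Z S = c S}
  add_mem' {c d} hc hd S := by
    rw [Pi.add_apply, add_mul, hc S, hd S]
  zero_mem' S := by
    rw [Pi.zero_apply, zero_mul]
  smul_mem' b c hc S := by
    rw [Pi.smul_apply, smul_eq_mul, mul_assoc, hc S]

theorem compIdem_mul_self (S : Finset (Fin (2 * k))) :
    compIdem Z S * compIdem Z S = compIdem Z S := by
  have key : ∀ (W : PointedMatchedCircle k) (R : Finset (Fin (2 * k))),
      StrandAlg.idempotent W R * StrandAlg.idempotent W R = StrandAlg.idempotent W R := by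
    intro W R
    have hR : R = (idem W R).initialPairs := by
      ext a
      rw [mem_initialPairs]
      constructor
      · intro ha
        obtain ⟨p, hp⟩ := exists_point W a
        exact ⟨p, p, mem_idem.2 ⟨rfl, by rwa [hp]⟩, hp⟩
      · rintro ⟨i, j, hij, rfl⟩
        exact (mem_idem.1 hij).2
    have h1 : comp (idem W R) (idem W R) = idem W R := by
      conv_lhs => rw [hR]
      rw [← hR]
      have := idem_comp (idem W R)
      rwa [← hR] at this
    rw [StrandAlg.idempotent, StrandAlg.basis_mul_basis, StrandAlg.basicMul,
      if_pos (composable_idem_left.2 hR), h1]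
  rw [compIdem, Algebra.TensorProduct.tmul_mul_tmul, key, key]

/-- The differential of `DD(Id)`. An element is a sum of terms `c · I`, and
`∂(c · I) = (dc) · I + ∑_J ∑_ξ c · I · ã(ξ) · J`, where `J` runs through all pairs of complementary
idempotents and `ξ = [i, j]` through all chords. -/
noncomputable def ddIdDiff : DDId Z →+ DDId Z where
  toFun c := ⟨fun T => biDiff Z (c.1 T) * compIdem Z T +
      ∑ S, ∑ i, ∑ j, if i < j then c.1 S * chordPair Z i j * compIdem Z T else 0, by
    intro T
    simp only [add_mul, Finset.sum_mul, ite_mul, zero_mul, mul_assoc, compIdem_mul_self]⟩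
  map_zero' := by
    apply Subtype.ext
    funext T
    simp
  map_add' c d := by
    apply Subtype.ext
    funext T
    simp only [Submodule.coe_add, Pi.add_apply, map_add, add_mul]
    rw [add_add_add_comm, ← Finset.sum_add_distrib]
    congr 1
    refine Finset.sum_congr rfl fun S _ => ?_
    rw [← Finset.sum_add_distrib]
    refine Finset.sum_congr rfl fun i _ => ?_
    rw [← Finset.sum_add_distrib]
    refine Finset.sum_congr rfl fun j _ => ?_
    split_ifs <;> simp

variable {M : Type*} [AddCommGroup M] [Module (BiAlg Z) M]

/-- `D` makes the left module `M` over `A(Z) ⊗ A(-Z)` into a differential graded module (in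
characteristic two, with the grading left aside). -/
structure IsDGModule (D : M →+ M) : Prop where
  sq_zero : ∀ m, D (D m) = 0
  leibniz : ∀ (b : BiAlg Z) (m : M), D (b • m) = biDiff Z b • m + b • D m

/-- The elements `x S` are generators of `M` that correspond to the pairs `I = compIdem Z S` of
complementary idempotents: `I · x(I) = x(I)`, and `M` is the direct sum of the submodules generated
by the `x(I)`, each of which is isomorphic to `(A(Z) ⊗ A(-Z)) · I` through `c ↦ c · x(I)`. -/
structure IsComplementaryGenerators (x : Finset (Fin (2 * k)) → M) : Prop where
  idem_smul : ∀ S, compIdem Z S • x S = x S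
  existsUnique_coeff : ∀ m : M, ∃! c : Finset (Fin (2 * k)) → BiAlg Z,
    (∀ S, c S * compIdem Z S = c S) ∧ m = ∑ S, c S • x S

/-- The elements `a S T = a(I, J)` of `A(Z) ⊗ A(-Z) · J` are the coefficients of the differential:
`∂ x(I) = ∑_J a(I, J) · x(J)`. -/
structure IsCoefficients (D : M →+ M) (x : Finset (Fin (2 * k)) → M)
    (a : Finset (Fin (2 * k)) → Finset (Fin (2 * k)) → BiAlg Z) : Prop where
  mul_idem : ∀ S T, a S T * compIdem Z T = a S T
  diff_gen : ∀ S, D (x S) = ∑ T, a S T • x T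

variable (S : Type*) [MulAction (GradingGroup Z) S] [MulAction (GradingGroup Z.reverse) S]

/-- `S` is a `λ`-free set with commuting actions of `G'(Z)` and of `G'(-Z)` in which the two actions
of `λ` agree, i.e. with an action of the amalgamated product of these groups over `⟨λ⟩`. -/
structure IsLambdaFreeGradingSet : Prop where
  commute : ∀ (g : GradingGroup Z) (h : GradingGroup Z.reverse) (s : S), g • h • s = h • g • s
  lam_agree : ∀ s : S, GradingGroup.lam Z • s = GradingGroup.lam Z.reverse • s
  lam_free : ∀ (s : S) (n : ℤ), n ≠ 0 → GradingGroup.lam Z ^ n • s ≠ s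

variable {S}

/-- The homogeneous part of degree `s` of `M`, if the generator `x T` has degree `deg T`: it is
spanned by the elements `(X ⊗ Y) · x T` with `gr'(X) gr'(Y) deg T = s`. -/
def homogeneousPart (x : Finset (Fin (2 * k)) → M) (deg : Finset (Fin (2 * k)) → S) (s : S) :
    AddSubgroup M :=
  AddSubgroup.closure {m | ∃ (X : StrandDiagram Z) (Y : StrandDiagram Z.reverse)
    (T : Finset (Fin (2 * k))), X.gr • Y.gr • deg T = s ∧ m = biBasis Z (X, Y) • x T}

/-- The degrees `deg T` of the generators `x T` define an `S`-grading on the type DD bimodule `M`: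
the differential lowers it by `λ`. -/
def IsGradedBy (D : M →+ M) (x : Finset (Fin (2 * k)) → M) (deg : Finset (Fin (2 * k)) → S) :
    Prop :=
  ∀ T, D (x T) ∈ homogeneousPart Z x deg ((GradingGroup.lam Z)⁻¹ • deg T)

end Bimodules

end BorderedFloer

namespace BorderedFloer

/-! ### Matched points and an induction principle for chords -/

/-! The gradings leave only chord terms in the differential of `M`, and `∂² = 0` then fixes the
coefficient of every chord.

Gradings. Suppose that `X ⊗ Y` occurs in `a(I, J)`. Since `a(I, J)` lies in the diagonal subalgebra,
the supports of `X` and `Y` correspond under `r`. For group elements with corresponding chains the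
twisting terms `m(α₂, ∂α₁)` on the two sides are opposite, because `r` reverses orientation
(`multBoundary_reverseChain`). The total Maslov component is therefore additive along paths of
degrees, and by `λ`-freeness it is determined by the chain and the two degrees (`related_unique`).
The chords of length one occur in `∂`, and each contributes `-1/2 - 1/2 + 1 = 0`. So all paths built
from them have total Maslov component zero, and such paths connect the degrees of the initial and
terminal idempotents of any `X` along its support, as long as some matched pair is vacant
(`related_supp`). For a term of `∂` this gives `ι(X) + ι(Y) = -1`. Since `ι` is at most minus half
the number of moving strands (`iota_le`), and since `X` and `Y` move or stand still together, each
has exactly one moving strand, and these strands correspond under `r` (`moving_eq_singleton`). So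
`a(I, J)` is a combination of chord terms `I · ã(ξ) · J`.

Rigidity. Let a chord `[i, j]` pass over a point `r` that is matched with neither endpoint. The pair
of `r` is horizontal in exactly one of the two factors, and resolving the crossing there gives a
term of `da(I, J)`. In `∂² = 0` only a product of the terms for `[i, r]` and `[r, j]` can cancel it,
so the coefficient of `[i, j]` is the product of the coefficients of the two parts
(`chordCoeff_free`, `chordCoeff_occupied`, according to the side on which `r` is horizontal).
Induction on the length reduces to chords of length one, whose coefficient is `1`, except when every
interior point is matched with an endpoint. This happens only for length three with crosswise
matching `i ~ i+2`, `i+1 ~ i+3` (`chord_induction`). As `4k > 4`, such a chord extends by a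
neighbouring point to a chord of length four, and two different splittings of the latter give the
missing coefficient (`chordCoeff_eq_one`).

Hence the coefficients of `∂` are those of `DD(Id)`, and sending a family `c` to the sum of the `c_S
· x(S)` is the required isomorphism, up to taking its inverse. -/

theorem finRotate_eq_of_val_succ {n : ℕ} {i j : Fin n} (h : j.val = i.val + 1) :
    finRotate n i = j := by
  cases n with
  | zero => exact i.elim0
  | succ n =>
    have := j.isLt
    apply Fin.ext
    rw [coe_finRotate_of_ne_last, h]
    rintro rfl
    rw [Fin.val_last] at h
    omega

namespace PointedMatchedCircle

variable {k : ℕ} (Z : PointedMatchedCircle k)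

/-- If `i` and `i + 1` were matched, the walk on the surgered circle would jump from `i + 1` to `i`
and move on to `i + 1` again. It would never reach `i`, against connectedness. -/
theorem M_ne_of_succ {i j : Fin (4 * k)} (h : j.val = i.val + 1) : Z.M i ≠ Z.M j := by
  intro hM
  have hij : i ≠ j := by
    rintro rfl
    omega
  have hrot : j = finRotate (4 * k) i := (finRotate_eq_of_val_succ h).symm
  have key : ∀ q, Relation.ReflTransGen
      (fun p q => ∃ p', p' ≠ p ∧ Z.M p' = Z.M p ∧ q = finRotate (4 * k) p') j q → q = j := by
    intro q hq
    induction hq with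
    | refl => rfl
    | @tail b c _ hbc ih =>
      subst ih
      obtain ⟨p', h1, h2, h3⟩ := hbc
      have : p' = i := by
        by_contra h4
        have hsub : ({i, b, p'} : Finset (Fin (4 * k))) ⊆
            Finset.univ.filter fun p => Z.M p = Z.M b := by
          intro x hx
          simp only [Finset.mem_insert, Finset.mem_singleton] at hx
          rcases hx with rfl | rfl | rfl <;> simp [hM, h2]
        have := Finset.card_le_card hsub
        rw [Z.two_to_one, Finset.card_eq_three.2 ⟨i, b, p', hij, Ne.symm h4, h1.symm, rfl⟩] at this
        omega
      rw [h3, this, ← hrot]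
  exact hij (key i (Z.connected j i))

theorem not_three {p q r : Fin (4 * k)} (h1 : p ≠ q) (h2 : q ≠ r) (h3 : p ≠ r)
    (e1 : Z.M p = Z.M r) (e2 : Z.M q = Z.M r) : False := by
  have hsub : ({p, q, r} : Finset (Fin (4 * k))) ⊆
      Finset.univ.filter fun x => Z.M x = Z.M r := by
    intro x hx
    simp only [Finset.mem_insert, Finset.mem_singleton] at hx
    rcases hx with rfl | rfl | rfl <;> simp [e1, e2]
  have := Finset.card_le_card hsub
  rw [Z.two_to_one, Finset.card_eq_three.2 ⟨p, q, r, h1, h3, h2, rfl⟩] at this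
  omega

/-- A property of chords `[i, j]` together with a set `B` of further occupied matched pairs holds in
general if it holds for chords of length one, is compatible with both ways of splitting a chord
at an interior point that is not matched with an endpoint, and holds for chords of length three
whose four marked points are matched crosswise. -/
theorem chord_induction {P : Finset (Fin (2 * k)) → Fin (4 * k) → Fin (4 * k) → Prop}
    (length_one : ∀ B i j, j.val = i.val + 1 → Z.M i ∉ B → Z.M j ∉ B → P B i j)
    (split_free : ∀ B i r j, i < r → r < j → Z.M i ≠ Z.M r → Z.M r ≠ Z.M j → Z.M i ≠ Z.M j →
      Z.M i ∉ B → Z.M r ∉ B → Z.M j ∉ B → P B i r → P B r j → P B i j)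
    (split_occupied : ∀ B i r j, i < r → r < j → Z.M i ≠ Z.M r → Z.M r ≠ Z.M j → Z.M i ≠ Z.M j →
      Z.M i ∉ B → Z.M r ∉ B → Z.M j ∉ B → P (insert (Z.M i) B) r j → P (insert (Z.M j) B) i r →
      P (insert (Z.M r) B) i j)
    (crossed : ∀ B i r s j, r.val = i.val + 1 → s.val = i.val + 2 → j.val = i.val + 3 →
      Z.M i = Z.M s → Z.M r = Z.M j → Z.M i ≠ Z.M j → Z.M i ∉ B → Z.M j ∉ B →
      (∀ C p q, p < q → q.val ≤ p.val + 2 → Z.M p ≠ Z.M q → Z.M p ∉ C → Z.M q ∉ C → P C p q) →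
      P B i j) :
    ∀ B i j, i < j → Z.M i ≠ Z.M j → Z.M i ∉ B → Z.M j ∉ B → P B i j := by
  -- The induction on the length runs over all `B` at once, since splitting at an occupied point
  -- changes `B`.
  suffices H : ∀ n, ∀ B i j, i < j → j.val = i.val + n → Z.M i ≠ Z.M j → Z.M i ∉ B →
      Z.M j ∉ B → P B i j by
    intro B i j hij
    exact H (j.val - i.val) B i j hij (by rw [Fin.lt_def] at hij; omega)
  intro n
  induction n using Nat.strong_induction_on with
  | _ n ih =>
    intro B i j hij hn hne hi hj
    have hjlt := j.isLt
    rw [Fin.lt_def] at hij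
    have ih' : ∀ C p q, p < q → q.val < p.val + n → Z.M p ≠ Z.M q → Z.M p ∉ C → Z.M q ∉ C →
        P C p q := by
      intro C p q hpq hlt
      exact ih (q.val - p.val) (by rw [Fin.lt_def] at hpq; omega) C p q hpq
        (by rw [Fin.lt_def] at hpq; omega)
    by_cases h1 : n = 1
    · exact length_one B i j (by omega) hi hj
    by_cases hr : ∃ r, i < r ∧ r < j ∧ Z.M i ≠ Z.M r ∧ Z.M r ≠ Z.M j
    · obtain ⟨r, hir, hrj, hne1, hne2⟩ := hr
      have hir' := Fin.lt_def.1 hir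
      have hrj' := Fin.lt_def.1 hrj
      by_cases hrB : Z.M r ∈ B
      · have hB : B = insert (Z.M r) (B.erase (Z.M r)) := (Finset.insert_erase hrB).symm
        have hi' : Z.M i ∉ B.erase (Z.M r) := fun h => hi (Finset.mem_of_mem_erase h)
        have hj' : Z.M j ∉ B.erase (Z.M r) := fun h => hj (Finset.mem_of_mem_erase h)
        have hr' : Z.M r ∉ B.erase (Z.M r) := Finset.notMem_erase _ _
        rw [hB]
        refine split_occupied _ i r j hir hrj hne1 hne2 hne hi' hr' hj' ?_ ?_
        · refine ih' _ r j hrj (by omega) hne2 ?_ ?_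
          · simp [hne1.symm]
          · simp [hne.symm, hj]
        · refine ih' _ i r hir (by omega) hne1 ?_ ?_
          · simp [hne, hi]
          · simp [hne2]
      · exact split_free B i r j hir hrj hne1 hne2 hne hi hrB hj
          (ih' _ i r hir (by omega) hne1 hi hrB) (ih' _ r j hrj (by omega) hne2 hrB hj)
    -- Now every interior point is matched with `i` or `j`. Neighbours are never matched, so `i + 1`
    -- belongs to `j` and `i + 2` to `i`. A further interior point `i + 3` would have to belong to
    -- `j`, which would then have two partners, so the length is three.
    · push Not at hr
      have hr' : ∀ r : Fin (4 * k), i.val < r.val → r.val < j.val → Z.M i ≠ Z.M r →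
          Z.M r = Z.M j := hr
      let r : Fin (4 * k) := ⟨i.val + 1, by omega⟩
      have e1 : Z.M r = Z.M j :=
        hr' r (by simp [r]) (by simp [r]; omega) (Z.M_ne_of_succ rfl)
      have h2 : n ≠ 2 := fun h2 => Z.M_ne_of_succ (i := r) (j := j) (by simp [r]; omega) e1
      let s : Fin (4 * k) := ⟨i.val + 2, by omega⟩
      have e2 : Z.M i = Z.M s := by
        by_contra h
        exact Z.M_ne_of_succ (i := r) (j := s) rfl
          (e1.trans (hr' s (by simp [s]) (by simp [s]; omega) h).symm)
      have h3 : n = 3 := by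
        by_contra h3
        let t : Fin (4 * k) := ⟨i.val + 3, by omega⟩
        have e3 : Z.M t = Z.M j := hr' t (by simp [t]) (by simp [t]; omega)
          (by rw [e2]; exact Z.M_ne_of_succ rfl)
        exact Z.not_three (p := r) (q := t) (r := j)
          (by simp [r, t, Fin.ext_iff]) (by simp [t, Fin.ext_iff]; omega)
          (by simp [r, Fin.ext_iff]; omega) e1 e3
      subst h3
      exact crossed B i r s j rfl rfl hn e2 e1 hne hi hj
        fun C p q hpq hle => ih' C p q hpq (by omega)

end PointedMatchedCircle

/-! ### Strands diagrams with prescribed non-horizontal strands -/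

namespace StrandDiagram

variable {k : ℕ} {Z : PointedMatchedCircle k}

theorem mem_moving {X : StrandDiagram Z} {i j : Fin (4 * k)} :
    (i, j) ∈ X.moving ↔ (i, j) ∈ X.strands ∧ i < j := by
  simp [moving]

/-- The horizontal strands are those at the initial pairs where no moving strand begins, so they
carry no further information. -/
theorem ext_of_moving {X Y : StrandDiagram Z} (hm : X.moving = Y.moving)
    (hi : X.initialPairs = Y.initialPairs) : X = Y := by
  have key : ∀ {X Y : StrandDiagram Z}, X.moving = Y.moving → X.initialPairs = Y.initialPairs →
      X.strands ⊆ Y.strands := by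
    rintro X Y hm hi ⟨i, j⟩ h
    rcases (X.nondecreasing _ _ h).lt_or_eq with a | a
    · exact (mem_moving.1 (hm ▸ mem_moving.2 ⟨h, a⟩)).1
    · subst a
      have : Z.M i ∈ Y.initialPairs := hi ▸ mem_initialPairs.2 ⟨i, i, h, rfl⟩
      obtain ⟨p, q, hpq, hM⟩ := mem_initialPairs.1 this
      rcases (Y.nondecreasing _ _ hpq).lt_or_eq with b | b
      · have h' := (mem_moving.1 (hm.symm ▸ mem_moving.2 ⟨hpq, b⟩ : (p, q) ∈ X.moving)).1
        obtain ⟨rfl, rfl⟩ := X.initial_unique _ _ _ _ h' b h hM.symm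
        exact absurd b (lt_irrefl _)
      · subst b
        exact Y.horizontal_mate _ _ hpq hM.symm
  exact StrandDiagram.ext (Finset.Subset.antisymm (key hm hi) (key hm.symm hi.symm))

/-- The conditions under which the strands in `F` and the horizontal strands at the matched pairs in
`A` form a strands diagram. -/
structure Admissible (Z : PointedMatchedCircle k) (F : Finset (Fin (4 * k) × Fin (4 * k)))
    (A : Finset (Fin (2 * k))) : Prop where
  lt : ∀ i j, (i, j) ∈ F → i < j
  initial_notMem : ∀ i j, (i, j) ∈ F → Z.M i ∉ A
  terminal_notMem : ∀ i j, (i, j) ∈ F → Z.M j ∉ A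
  initial_inj : ∀ i j i' j', (i, j) ∈ F → (i', j') ∈ F → Z.M i' = Z.M i → i' = i ∧ j' = j
  terminal_inj : ∀ i j i' j', (i, j) ∈ F → (i', j') ∈ F → Z.M j' = Z.M j → i' = i ∧ j' = j

open Classical in
/-- The strands diagram with non-horizontal strands `F` and horizontal strands at `A`. -/
noncomputable def build (Z : PointedMatchedCircle k) (F : Finset (Fin (4 * k) × Fin (4 * k)))
    (A : Finset (Fin (2 * k))) : StrandDiagram Z :=
  if h : Admissible Z F A then
    { strands := F ∪ Finset.univ.filter fun p => p.1 = p.2 ∧ Z.M p.1 ∈ A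
      nondecreasing i j hij := by
        simp only [Finset.mem_union, Finset.mem_filter, Finset.mem_univ, true_and] at hij
        rcases hij with hij | hij
        · exact (h.lt _ _ hij).le
        · exact hij.1.le
      horizontal_mate i j hi hM := by
        simp only [Finset.mem_union, Finset.mem_filter, Finset.mem_univ, true_and] at hi ⊢
        rcases hi with hi | hi
        · exact absurd (h.lt _ _ hi) (lt_irrefl _)
        · exact Or.inr (hM ▸ hi)
      initial_unique i j i' j' hij hlt hij' hM := by
        simp only [Finset.mem_union, Finset.mem_filter, Finset.mem_univ, true_and] at hij hij'
        rcases hij with hij | hij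
        · rcases hij' with hij' | hij'
          · exact h.initial_inj _ _ _ _ hij hij' hM
          · exact absurd (hM ▸ hij'.2) (h.initial_notMem _ _ hij)
        · exact absurd hij.1 hlt.ne
      terminal_unique i j i' j' hij hlt hij' hM := by
        simp only [Finset.mem_union, Finset.mem_filter, Finset.mem_univ, true_and] at hij hij'
        rcases hij with hij | hij
        · rcases hij' with hij' | hij'
          · exact h.terminal_inj _ _ _ _ hij hij' hM
          · exact absurd (hM ▸ hij'.1 ▸ hij'.2) (h.terminal_notMem _ _ hij)
        · exact absurd hij.1 hlt.ne }
  -- A default value; the lemmas that describe `build` assume `Admissible`.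
  else idem Z A

variable {F : Finset (Fin (4 * k) × Fin (4 * k))} {A : Finset (Fin (2 * k))}

theorem mem_build (h : Admissible Z F A) {i j : Fin (4 * k)} :
    (i, j) ∈ (build Z F A).strands ↔ (i, j) ∈ F ∨ i = j ∧ Z.M i ∈ A := by
  simp [build, h]

theorem moving_build (h : Admissible Z F A) : (build Z F A).moving = F := by
  ext ⟨i, j⟩
  rw [mem_moving, mem_build h]
  constructor
  · rintro ⟨h1 | h1, h2⟩
    · exact h1
    · exact absurd h1.1 h2.ne
  · exact fun h1 => ⟨Or.inl h1, h.lt _ _ h1⟩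

theorem initialPairs_build (h : Admissible Z F A) :
    (build Z F A).initialPairs = A ∪ F.image fun p => Z.M p.1 := by
  ext a
  simp only [mem_initialPairs, mem_build h, Finset.mem_union, Finset.mem_image, Prod.exists]
  constructor
  · rintro ⟨i, j, h1 | h1, rfl⟩
    · exact Or.inr ⟨i, j, h1, rfl⟩
    · exact Or.inl h1.2
  · rintro (h1 | ⟨i, j, h1, rfl⟩)
    · obtain ⟨p, rfl⟩ := exists_point Z a
      exact ⟨p, p, Or.inr ⟨rfl, h1⟩, rfl⟩
    · exact ⟨i, j, Or.inl h1, rfl⟩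

theorem terminalPairs_build (h : Admissible Z F A) :
    (build Z F A).terminalPairs = A ∪ F.image fun p => Z.M p.2 := by
  ext a
  simp only [mem_terminalPairs, mem_build h, Finset.mem_union, Finset.mem_image, Prod.exists]
  constructor
  · rintro ⟨i, j, h1 | ⟨rfl, h1⟩, rfl⟩
    · exact Or.inr ⟨i, j, h1, rfl⟩
    · exact Or.inl h1
  · rintro (h1 | ⟨i, j, h1, rfl⟩)
    · obtain ⟨p, rfl⟩ := exists_point Z a
      exact ⟨p, p, Or.inr ⟨rfl, h1⟩, rfl⟩
    · exact ⟨i, j, Or.inl h1, rfl⟩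

/-- The matched pairs at which `X` has horizontal strands. -/
def horizontalPairs (X : StrandDiagram Z) : Finset (Fin (2 * k)) :=
  (X.strands.filter fun σ => σ.1 = σ.2).image fun p => Z.M p.1

theorem mem_horizontalPairs {X : StrandDiagram Z} {p : Fin (4 * k)} :
    Z.M p ∈ X.horizontalPairs ↔ (p, p) ∈ X.strands := by
  simp only [horizontalPairs, Finset.mem_image, Finset.mem_filter, Prod.exists]
  constructor
  · rintro ⟨a, b, ⟨h1, h2⟩, h3⟩
    obtain rfl : a = b := h2
    exact X.horizontal_mate _ _ h1 h3.symm
  · exact fun h => ⟨p, p, ⟨h, rfl⟩, rfl⟩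

theorem admissible (X : StrandDiagram Z) : Admissible Z X.moving X.horizontalPairs where
  lt _ _ h := (mem_moving.1 h).2
  initial_notMem i j h h' := by
    obtain ⟨h1, h2⟩ := mem_moving.1 h
    obtain ⟨-, rfl⟩ := X.initial_unique _ _ _ _ h1 h2 (mem_horizontalPairs.1 h') rfl
    exact lt_irrefl _ h2
  terminal_notMem i j h h' := by
    obtain ⟨h1, h2⟩ := mem_moving.1 h
    obtain ⟨rfl, -⟩ := X.terminal_unique _ _ _ _ h1 h2 (mem_horizontalPairs.1 h') rfl
    exact lt_irrefl _ h2
  initial_inj i j i' j' h h' hM :=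
    X.initial_unique _ _ _ _ (mem_moving.1 h).1 (mem_moving.1 h).2 (mem_moving.1 h').1 hM
  terminal_inj i j i' j' h h' hM :=
    X.terminal_unique _ _ _ _ (mem_moving.1 h).1 (mem_moving.1 h).2 (mem_moving.1 h').1 hM

theorem build_moving (X : StrandDiagram Z) : build Z X.moving X.horizontalPairs = X := by
  apply StrandDiagram.ext
  ext ⟨i, j⟩
  rw [mem_build X.admissible, mem_moving, mem_horizontalPairs]
  constructor
  · rintro (h | ⟨rfl, h⟩)
    · exact h.1
    · exact h
  · intro h
    rcases (X.nondecreasing _ _ h).lt_or_eq with a | a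
    · exact Or.inl ⟨h, a⟩
    · exact Or.inr ⟨a, a ▸ h⟩

/-! ### Chords and products of two chords -/

section Chords

variable {i r j : Fin (4 * k)}

theorem admissible_singleton (hij : i < j) (hi : Z.M i ∉ A) (hj : Z.M j ∉ A) :
    Admissible Z {(i, j)} A := by
  constructor <;> simp only [Finset.mem_singleton, Prod.mk.injEq] <;> grind

theorem admissible_pair (hir : i < r) (hrj : r < j) (h1 : Z.M i ≠ Z.M r) (h2 : Z.M r ≠ Z.M j)
    (hi : Z.M i ∉ A) (hr : Z.M r ∉ A) (hj : Z.M j ∉ A) :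
    Admissible Z {(i, r), (r, j)} A := by
  constructor <;> simp only [Finset.mem_insert, Finset.mem_singleton, Prod.mk.injEq] <;> grind

/-- The only strand ending at `r` is continued by the only strand beginning there, and all others
are horizontal in both factors, so nothing can cross twice. -/
theorem composable_free (hir : i < r) (hrj : r < j)
    (hi : Z.M i ∉ A) (hr : Z.M r ∉ A) (hj : Z.M j ∉ A) :
    Composable (build Z {(i, r)} A) (build Z {(r, j)} A) ∧
      comp (build Z {(i, r)} A) (build Z {(r, j)} A) = build Z {(i, j)} A := by
  have a1 := admissible_singleton hir hi hr
  have a2 := admissible_singleton hrj hr hj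
  have a3 := admissible_singleton (hir.trans hrj) hi hj
  constructor
  · constructor <;>
      simp only [mem_build a1, mem_build a2, Finset.mem_singleton, Prod.mk.injEq] <;> grind
  · apply StrandDiagram.ext
    ext ⟨p, q⟩
    simp only [mem_comp, mem_build a1, mem_build a2, mem_build a3, Finset.mem_singleton,
      Prod.mk.injEq]
    grind

/-- In the opposite order the two chords do not join. First `[r, j]` moves while a horizontal strand
waits at `i`, then `[i, r]` moves while one waits at `j`; the product has two moving strands that
abut at `r`. By `repr_basicDiff_chord` the same diagram is a resolution of the chord `[i, j]`
crossing a horizontal strand at `r`. This coincidence is the source of all relations between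
coefficients. -/
theorem composable_occupied (hir : i < r) (hrj : r < j) (h1 : Z.M i ≠ Z.M r)
    (h2 : Z.M r ≠ Z.M j) (h3 : Z.M i ≠ Z.M j) (hi : Z.M i ∉ A) (hr : Z.M r ∉ A)
    (hj : Z.M j ∉ A) :
    Composable (build Z {(r, j)} (insert (Z.M i) A)) (build Z {(i, r)} (insert (Z.M j) A)) ∧
      comp (build Z {(r, j)} (insert (Z.M i) A)) (build Z {(i, r)} (insert (Z.M j) A)) =
        build Z {(i, r), (r, j)} A := by
  have a1 : Admissible Z {(r, j)} (insert (Z.M i) A) :=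
    admissible_singleton hrj (by simp [h1.symm, hr]) (by simp [h3.symm, hj])
  have a2 : Admissible Z {(i, r)} (insert (Z.M j) A) :=
    admissible_singleton hir (by simp [h3, hi]) (by simp [h2, hr])
  have a3 := admissible_pair hir hrj h1 h2 hi hr hj
  constructor
  · refine ⟨?_, ?_, fun p hp => ?_, fun p hp => ?_, ?_⟩ <;>
      simp only [mem_build a1, mem_build a2, Finset.mem_singleton, Finset.mem_insert,
        Prod.mk.injEq] at *
    · grind
    · grind
    · rcases hp with hp | ⟨-, hp | hp⟩
      · grind
      -- Of the two horizontal strands at the pair of `i`, the one at `i` itself continues as `[i,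
      -- r]`; its mate is dropped.
      · exact ⟨i, r, hp.symm, Or.inl ⟨rfl, rfl⟩⟩
      · exact ⟨p, p, rfl, Or.inr ⟨rfl, Or.inr hp⟩⟩
    · rcases hp with hp | ⟨-, hp | hp⟩
      · grind
      · exact ⟨j, r, hp.symm, Or.inl ⟨rfl, rfl⟩⟩
      · exact ⟨p, p, rfl, Or.inr ⟨rfl, Or.inr hp⟩⟩
    · grind
  · apply StrandDiagram.ext
    ext ⟨p, q⟩
    simp only [mem_comp, mem_build a1, mem_build a2, mem_build a3, Finset.mem_singleton,
      Finset.mem_insert, Prod.mk.injEq]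
    grind

/-- If `[i, r]` moved in the first factor, its strand would reach `r` at the middle, where the
strand beginning at `r` still waits; two strands cannot share a middle point. So the factorization
in `composable_occupied` is the only one with a single moving strand in each factor. -/
theorem moving_of_comp_eq_pair {X Y : StrandDiagram Z} (hir : i < r) (hrj : r < j)
    {s t u v : Fin (4 * k)} (hX : X.moving = {(s, t)}) (hY : Y.moving = {(u, v)})
    (h : (comp X Y).moving = {(i, r), (r, j)}) :
    s = r ∧ t = j ∧ u = i ∧ v = r := by
  have hX' : ∀ {p q}, (p, q) ∈ X.strands → p = q ∨ p = s ∧ q = t := by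
    intro p q hpq
    rcases (X.nondecreasing _ _ hpq).eq_or_lt with a | a
    · exact Or.inl a
    · have := mem_moving.2 ⟨hpq, a⟩
      simpa [hX] using Or.inr this
  have hY' : ∀ {p q}, (p, q) ∈ Y.strands → p = q ∨ p = u ∧ q = v := by
    intro p q hpq
    rcases (Y.nondecreasing _ _ hpq).eq_or_lt with a | a
    · exact Or.inl a
    · have := mem_moving.2 ⟨hpq, a⟩
      simpa [hY] using Or.inr this
  have e1 : (i, r) ∈ (comp X Y).moving := by simp [h]
  have e2 : (r, j) ∈ (comp X Y).moving := by simp [h]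
  obtain ⟨m, h1, h2⟩ := mem_comp.1 (mem_moving.1 e1).1
  obtain ⟨n, h3, h4⟩ := mem_comp.1 (mem_moving.1 e2).1
  have g1 := hX' h1
  have g2 := hY' h2
  have g3 := hX' h3
  have g4 := hY' h4
  have inj : m = n → i = r := by
    rintro rfl
    exact X.injective h1 h3
  grind

end Chords

/-! ### Resolutions of a chord crossing a horizontal strand -/

theorem repr_basicDiff (X W : StrandDiagram Z) [∀ σ τ, Decidable (X.ResolvableCrossing σ τ)]
    [DecidableEq (StrandDiagram Z)] :
    (StrandAlg.basis Z).repr (StrandAlg.basicDiff X) W =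
      ∑ σ, ∑ τ, if h : X.ResolvableCrossing σ τ then
        (if X.resolve σ τ h = W then 1 else 0) else 0 := by
  rw [StrandAlg.basicDiff]
  simp only [map_sum, Finsupp.finsetSum_apply]
  refine Finset.sum_congr rfl fun σ _ => Finset.sum_congr rfl fun τ _ => ?_
  split_ifs with h h'
  · rw [h', Module.Basis.repr_self, Finsupp.single_eq_same]
  · rw [Module.Basis.repr_self, Finsupp.single_eq_of_ne (Ne.symm h')]
  · simp

/-- Every crossing is between the chord and a horizontal strand at some `p`, and its resolution
contains a strand from `i` to `p`. Hence `p` can be read off from the resolution and exactly one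
crossing contributes. If the mate of `r` also lies under the chord, its crossing gives a different
diagram. -/
theorem repr_basicDiff_chord {A : Finset (Fin (2 * k))} {i r j : Fin (4 * k)} (hir : i < r)
    (hrj : r < j) (h1 : Z.M i ≠ Z.M r) (h2 : Z.M r ≠ Z.M j) (hi : Z.M i ∉ A) (hr : Z.M r ∉ A)
    (hj : Z.M j ∉ A) :
    (StrandAlg.basis Z).repr (StrandAlg.basicDiff (build Z {(i, j)} (insert (Z.M r) A)))
      (build Z {(i, r), (r, j)} A) = 1 := by
  classical
  have a1 : Admissible Z {(i, j)} (insert (Z.M r) A) :=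
    admissible_singleton (hir.trans hrj) (by simp [h1, hi]) (by simp [h2.symm, hj])
  have a2 := admissible_pair hir hrj h1 h2 hi hr hj
  have hX : ∀ {p q}, (p, q) ∈ (build Z {(i, j)} (insert (Z.M r) A)).strands →
      p = q ∨ p = i ∧ q = j := by
    intro p q h
    rw [mem_build a1] at h
    simp only [Finset.mem_singleton, Prod.mk.injEq] at h
    tauto
  have hres : (build Z {(i, j)} (insert (Z.M r) A)).ResolvableCrossing (i, j) (r, r) := by
    refine ⟨(mem_build a1).2 (by simp), (mem_build a1).2 (by simp), hir, hrj, ?_⟩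
    rintro ⟨p, q⟩ hpq ⟨h3, h4, h5, h6⟩
    rcases hX hpq with rfl | ⟨rfl, rfl⟩
    · exact lt_asymm h4 h5
    · exact lt_irrefl _ h3
  have heq : (build Z {(i, j)} (insert (Z.M r) A)).resolve (i, j) (r, r) hres =
      build Z {(i, r), (r, j)} A := by
    apply StrandDiagram.ext
    ext ⟨p, q⟩
    rw [mem_build a2]
    simp only [resolve, Finset.mem_union, Finset.mem_filter, Finset.mem_insert,
      Finset.mem_singleton, Prod.mk.injEq, mem_build a1]
    grind
  rw [repr_basicDiff, Finset.sum_eq_single (i, j), Finset.sum_eq_single (r, r)]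
  · rw [dif_pos hres, if_pos heq]
  · rintro ⟨p, q⟩ - hne
    split_ifs with h h'
    · exfalso
      have h3 := h.initial_lt
      have h4 := h.terminal_lt
      -- The resolved strand that leaves `i` ends at the terminal point of the other crossing
      -- strand, which must therefore be `r`.
      have hm : (i, q) ∈ (build Z {(i, r), (r, j)} A).strands := by
        rw [← h']
        simp [resolve]
      rcases hX h.right_mem with rfl | ⟨rfl, rfl⟩
      · have hm' := mem_moving.2 ⟨hm, h3⟩
        rw [moving_build a2] at hm'
        simp only [Finset.mem_insert, Finset.mem_singleton, Prod.mk.injEq, true_and] at hm'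
        rcases hm' with rfl | ⟨rfl, -⟩
        · exact hne rfl
        · exact lt_irrefl _ hir
      · exact lt_irrefl _ h3
    · rfl
    · rfl
  · simp
  · rintro ⟨p, q⟩ - hne
    refine Finset.sum_eq_zero fun τ _ => ?_
    rw [dif_neg]
    intro h
    have h3 := h.initial_lt
    have h4 := h.terminal_lt
    have h5 := (build Z {(i, j)} (insert (Z.M r) A)).nondecreasing τ.1 τ.2 h.right_mem
    rcases hX h.left_mem with rfl | ⟨rfl, rfl⟩
    · exact absurd (h3.trans_le h5) (lt_asymm h4)
    · exact hne rfl
  · simp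

theorem basicDiff_idem (S : Finset (Fin (2 * k))) : StrandAlg.basicDiff (idem Z S) = 0 := by
  rw [StrandAlg.basicDiff]
  refine Finset.sum_eq_zero fun σ _ => Finset.sum_eq_zero fun τ _ => ?_
  rw [dif_neg]
  intro h
  have h1 := (mem_idem.1 h.left_mem).1
  have h2 := (mem_idem.1 h.right_mem).1
  have h3 := h.initial_lt
  have h4 := h.terminal_lt
  rw [h1, h2] at h3
  exact lt_asymm h3 h4

/-! ### Supports -/

/-- The one-chain from the first marked point to `p`. -/
def initialChain {n : ℕ} (p : Fin n) : Fin (n - 1) → ℤ := fun q => if q.val < p.val then 1 else 0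

theorem supp_eq_sum_strands (X : StrandDiagram Z) :
    X.supp = ∑ σ ∈ X.strands, (initialChain σ.2 - initialChain σ.1) := by
  funext q
  rw [supp, Finset.card_filter, Nat.cast_sum, Finset.sum_apply]
  refine Finset.sum_congr rfl fun σ hσ => ?_
  have := Fin.le_def.1 (X.nondecreasing σ.1 σ.2 hσ)
  simp only [initialChain, Pi.sub_apply]
  split_ifs <;> first | rfl | omega

theorem supp_eq_sum_moving (X : StrandDiagram Z) :
    X.supp = ∑ σ ∈ X.moving, (initialChain σ.2 - initialChain σ.1) := by
  rw [supp_eq_sum_strands, moving, Finset.sum_filter]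
  refine Finset.sum_congr rfl fun σ hσ => ?_
  split_ifs with h
  · rfl
  · rw [le_antisymm (X.nondecreasing σ.1 σ.2 hσ) (not_lt.1 h), sub_self]

/-- Summing over all matching pairs of strands, the intervals telescope. Composability ensures that
only horizontal strands are left without a partner, and these have no support. -/
theorem supp_comp {X Y : StrandDiagram Z} (h : Composable X Y) :
    (comp X Y).supp = X.supp + Y.supp := by
  set T : Finset (Fin (4 * k) × Fin (4 * k) × Fin (4 * k)) :=
    Finset.univ.filter fun t => (t.1, t.2.1) ∈ X.strands ∧ (t.2.1, t.2.2) ∈ Y.strands with hT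
  have mT : ∀ {a b c}, (a, b, c) ∈ T ↔ (a, b) ∈ X.strands ∧ (b, c) ∈ Y.strands := by
    simp [hT]
  have e1 : ∑ t ∈ T, (initialChain t.2.1 - initialChain t.1) = X.supp := by
    rw [supp_eq_sum_strands]
    refine Finset.sum_of_injOn (fun t => (t.1, t.2.1)) ?_ ?_ ?_ fun _ _ => rfl
    · rintro ⟨a, b, c⟩ ht ⟨a', b', c'⟩ ht' heq
      simp only [Prod.mk.injEq] at heq
      obtain ⟨rfl, rfl⟩ := heq
      rw [Y.functional (mT.1 ht).2 (mT.1 ht').2]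
    · rintro ⟨a, b, c⟩ ht
      exact (mT.1 ht).1
    · rintro ⟨a, b⟩ hab hn
      rcases (X.nondecreasing _ _ hab).eq_or_lt with rfl | hlt
      · exact sub_self _
      · obtain ⟨c, hc⟩ := h.moving_left _ _ hab hlt
        exact absurd ⟨(a, b, c), mT.2 ⟨hab, hc⟩, rfl⟩ hn
  have e2 : ∑ t ∈ T, (initialChain t.2.2 - initialChain t.2.1) = Y.supp := by
    rw [supp_eq_sum_strands]
    refine Finset.sum_of_injOn (fun t => (t.2.1, t.2.2)) ?_ ?_ ?_ fun _ _ => rfl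
    · rintro ⟨a, b, c⟩ ht ⟨a', b', c'⟩ ht' heq
      simp only [Prod.mk.injEq] at heq
      obtain ⟨rfl, rfl⟩ := heq
      rw [X.injective (mT.1 ht).1 (mT.1 ht').1]
    · rintro ⟨a, b, c⟩ ht
      exact (mT.1 ht).2
    · rintro ⟨b, c⟩ hbc hn
      rcases (Y.nondecreasing _ _ hbc).eq_or_lt with rfl | hlt
      · exact sub_self _
      · obtain ⟨a, ha⟩ := h.moving_right _ _ hbc hlt
        exact absurd ⟨(a, b, c), mT.2 ⟨ha, hbc⟩, rfl⟩ hn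
  rw [← e1, ← e2, ← Finset.sum_add_distrib, supp_eq_sum_strands]
  symm
  refine Finset.sum_of_injOn (fun t => (t.1, t.2.2)) ?_ ?_ ?_ fun _ _ => ?_
  · rintro ⟨a, b, c⟩ ht ⟨a', b', c'⟩ ht' heq
    simp only [Prod.mk.injEq] at heq
    obtain ⟨rfl, rfl⟩ := heq
    rw [X.functional (mT.1 ht).1 (mT.1 ht').1]
  · rintro ⟨a, b, c⟩ ht
    exact mem_comp.2 ⟨b, mT.1 ht⟩
  · rintro ⟨a, c⟩ hac hn
    obtain ⟨b, hb⟩ := mem_comp.1 hac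
    exact absurd ⟨(a, b, c), mT.2 hb, rfl⟩ hn
  · abel

theorem supp_eq_zero_iff (X : StrandDiagram Z) : X.supp = 0 ↔ X.moving = ∅ := by
  constructor
  · intro h
    rw [Finset.eq_empty_iff_forall_notMem]
    rintro ⟨i, j⟩ hij
    obtain ⟨h1, h2⟩ := mem_moving.1 hij
    have hj := j.isLt
    rw [Fin.lt_def] at h2
    have := congrFun h ⟨i.val, by omega⟩
    rw [supp, Pi.zero_apply, Nat.cast_eq_zero, Finset.card_eq_zero] at this
    exact (Finset.eq_empty_iff_forall_notMem.1 this (i, j))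
      (Finset.mem_filter.2 ⟨h1, le_refl _, h2⟩)
  · intro h
    rw [supp_eq_sum_moving, h, Finset.sum_empty]

theorem initialChain_sub_injective {n : ℕ} {i j i' j' : Fin n} (h : i < j) (h' : i' < j')
    (heq : initialChain j - initialChain i = initialChain j' - initialChain i') :
    i = i' ∧ j = j' := by
  have key : ∀ q : ℕ, (i.val ≤ q ∧ q < j.val) ↔ (i'.val ≤ q ∧ q < j'.val) := by
    intro q
    have h1 := j.isLt
    have h2 := j'.isLt
    rw [Fin.lt_def] at h h'
    by_cases hq : q < n - 1
    · have := congrFun heq ⟨q, hq⟩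
      simp only [initialChain, Pi.sub_apply] at this
      split_ifs at this <;> omega
    · omega
  rw [Fin.lt_def] at h h'
  rw [Fin.ext_iff, Fin.ext_iff]
  have k1 := key i.val
  have k2 := key i'.val
  have k3 := key (j.val - 1)
  have k4 := key (j'.val - 1)
  omega

theorem reverseChain_initialChain_sub (p q : Fin (4 * k)) :
    reverseChain (initialChain q - initialChain p) =
      -(initialChain p.rev - initialChain q.rev) := by
  funext t
  have := t.isLt
  have := p.isLt
  have := q.isLt
  simp only [reverseChain, initialChain, Pi.sub_apply, Pi.neg_apply, Fin.val_rev]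
  split_ifs <;> omega

/-! ### The function `ι` -/

/-- Count each crossing at the strand `τ` that begins later. A strand crossing `τ` in this way
covers both sides of the initial point of `τ` and adds `1` to the multiplicity there, while `τ`
itself covers one side and adds `1/2`. So each moving strand leaves a surplus of at least `1/2` of
multiplicity over crossings. -/
theorem iota_le (X : StrandDiagram Z) : X.iota ≤ -(X.moving.card : ℚ) / 2 := by
  have key : ∀ τ ∈ X.moving,
      ((X.moving.filter fun σ => σ.1 < τ.1 ∧ τ.2 < σ.2).card : ℚ) + 1 / 2 ≤
        multAt X.supp τ.1 := by
    rintro ⟨i, j⟩ h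
    obtain ⟨h1, h2⟩ := mem_moving.1 h
    have e1 : (X.moving.filter fun σ => σ.1 < i ∧ j < σ.2).card ≤
        (X.strands.filter fun σ => σ.1 < i ∧ i ≤ σ.2).card := by
      refine Finset.card_le_card fun σ hσ => ?_
      simp only [moving, Finset.mem_filter] at hσ ⊢
      exact ⟨hσ.1.1, hσ.2.1, (h2.trans hσ.2.2).le⟩
    have e2 : (X.moving.filter fun σ => σ.1 < i ∧ j < σ.2).card + 1 ≤
        (X.strands.filter fun σ => σ.1 ≤ i ∧ i < σ.2).card := by
      rw [← Finset.card_insert_of_notMem (a := (i, j)) (by simp)]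
      refine Finset.card_le_card fun σ hσ => ?_
      simp only [moving, Finset.mem_filter, Finset.mem_insert] at hσ ⊢
      rcases hσ with rfl | hσ
      · exact ⟨h1, le_refl _, h2⟩
      · exact ⟨hσ.1.1, hσ.2.1.le, h2.trans hσ.2.2⟩
    rw [multAt, multBefore_supp, multAfter_supp]
    have e1' : ((X.moving.filter fun σ => σ.1 < i ∧ j < σ.2).card : ℚ) ≤
        (X.strands.filter fun σ => σ.1 < i ∧ i ≤ σ.2).card := by exact_mod_cast e1
    have e2' : ((X.moving.filter fun σ => σ.1 < i ∧ j < σ.2).card : ℚ) + 1 ≤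
        (X.strands.filter fun σ => σ.1 ≤ i ∧ i < σ.2).card := by exact_mod_cast e2
    push_cast
    linarith
  have hinv : (X.inv : ℚ) =
      ∑ τ ∈ X.moving, ((X.moving.filter fun σ => σ.1 < τ.1 ∧ τ.2 < σ.2).card : ℚ) := by
    rw [inv, Finset.card_filter, Finset.sum_product_right]
    simp only [Finset.card_filter]
    push_cast
    rfl
  have hs := Finset.sum_le_sum key
  rw [Finset.sum_add_distrib, Finset.sum_const, nsmul_eq_mul, ← hinv] at hs
  rw [iota]
  linarith

/-- The case of equality in `iota_le`: there is no crossing, and only the strand itself touches its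
initial point. -/
theorem iota_of_moving_eq_singleton {X : StrandDiagram Z} {i j : Fin (4 * k)}
    (h : X.moving = {(i, j)}) : X.iota = -1 / 2 := by
  have hij : (i, j) ∈ X.moving := by simp [h]
  have hlt := (mem_moving.1 hij).2
  have hm : ∀ σ, σ ∈ X.strands → σ.1 < σ.2 → σ = (i, j) := by
    rintro σ h1 h2
    have : σ ∈ X.moving := Finset.mem_filter.2 ⟨h1, h2⟩
    simpa [h] using this
  have e1 : (X.strands.filter fun σ => σ.1 < i ∧ i ≤ σ.2) = ∅ := by
    rw [Finset.filter_eq_empty_iff]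
    rintro σ h1 ⟨h2, h3⟩
    rw [hm σ h1 (h2.trans_le h3)] at h2
    exact lt_irrefl _ h2
  have e2 : (X.strands.filter fun σ => σ.1 ≤ i ∧ i < σ.2) = {(i, j)} := by
    ext σ
    rw [Finset.mem_filter, Finset.mem_singleton]
    constructor
    · rintro ⟨h1, h2, h3⟩
      exact hm σ h1 (h2.trans_lt h3)
    · rintro rfl
      exact ⟨(mem_moving.1 hij).1, le_refl _, hlt⟩
  have e3 : X.inv = 0 := by
    rw [inv, h, Finset.card_eq_zero, Finset.filter_eq_empty_iff]
    intro c hc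
    simp only [Finset.singleton_product_singleton, Finset.mem_singleton] at hc
    subst hc
    simp
  rw [iota, e3, h, Finset.sum_singleton, multAt, multBefore_supp, multAfter_supp, e1, e2]
  norm_num

end StrandDiagram

/-! ### Degrees related by a one-chain -/

section Gradings

variable {k : ℕ} {Z : PointedMatchedCircle k}

theorem multBefore_reverseChain (α : Fin (4 * k - 1) → ℤ) (p : Fin (4 * k)) :
    multBefore (-reverseChain α) p = multAfter α p.rev := by
  have := p.isLt
  simp only [multBefore, multAfter, reverseChain, Pi.neg_apply, neg_neg, Fin.val_rev]
  split_ifs with h1 h2 h2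
  · congr 1
    apply Fin.ext
    simp only [Fin.val_rev]
    omega
  · omega
  · omega
  · rfl

theorem multAfter_reverseChain (α : Fin (4 * k - 1) → ℤ) (p : Fin (4 * k)) :
    multAfter (-reverseChain α) p = multBefore α p.rev := by
  have := p.isLt
  simp only [multBefore, multAfter, reverseChain, Pi.neg_apply, neg_neg, Fin.val_rev]
  split_ifs with h1 h2 h2
  · congr 1
    apply Fin.ext
    simp only [Fin.val_rev]
    omega
  · omega
  · omega
  · rfl

/-- Reflection exchanges the two sides of a marked point, which keeps the average multiplicity but
changes the sign of the boundary. Because of this sign the twists in the group laws of `G'(Z)` and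
`G'(-Z)` cancel for corresponding chains. -/
theorem multBoundary_reverseChain (α β : Fin (4 * k - 1) → ℤ) :
    multBoundary (-reverseChain α) (-reverseChain β) = -multBoundary α β := by
  rw [multBoundary, multBoundary, ← Finset.sum_neg_distrib, ← Equiv.sum_comp Fin.revPerm]
  refine Finset.sum_congr rfl fun p _ => ?_
  simp only [boundaryAt, multAt, multBefore_reverseChain, multAfter_reverseChain,
    Fin.revPerm_apply, Fin.rev_rev]
  push_cast
  ring

theorem GradingGroup.lam_zpow (n : ℤ) :
    (GradingGroup.lam Z ^ n).maslov = n ∧ (GradingGroup.lam Z ^ n).chain = 0 := by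
  have h1 : (GradingGroup.lam Z).maslov = 1 := rfl
  have h2 : (GradingGroup.lam Z).chain = 0 := rfl
  induction n using Int.induction_on with
  | zero => exact ⟨by simp [one_maslov], by simp [one_chain]⟩
  | succ n ih =>
    rw [zpow_add_one, mul_maslov, mul_chain, ih.1, ih.2, h1, h2, multBoundary_zero_left]
    simp
  | pred n ih =>
    rw [zpow_sub_one, mul_maslov, mul_chain, inv_maslov, inv_chain, ih.1, ih.2, h1, h2,
      neg_zero, multBoundary_zero_left]
    refine ⟨?_, by simp⟩
    push_cast
    ring

/-- Without parity changes the congruence forces an integral Maslov component. -/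
theorem GradingGroup.eq_lam_zpow {g : GradingGroup Z} (h : g.chain = 0) :
    ∃ n : ℤ, g = GradingGroup.lam Z ^ n := by
  obtain ⟨c, hc⟩ := g.congruence
  refine ⟨c, GradingGroup.ext ?_ ?_⟩
  · rw [(lam_zpow c).1, hc, h, parityChanges_zero]
    simp
  · rw [(lam_zpow c).2, h]

variable {S : Type*} [MulAction (GradingGroup Z) S] [MulAction (GradingGroup Z.reverse) S]

variable (Z) in
/-- The degree `s` is obtained from `t` by the action of an element of the amalgamated product of
`G'(Z)` and `G'(-Z)` with total Maslov component `n` and with chains `α` and `r_* α`, up to the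
sign that comes from the orientation. -/
def Related (α : Fin (4 * k - 1) → ℤ) (n : ℚ) (s t : S) : Prop :=
  ∃ (g : GradingGroup Z) (h : GradingGroup Z.reverse), g.chain = α ∧ h.chain = -reverseChain α ∧
    g.maslov + h.maslov = n ∧ s = g • h • t

theorem reverseChain_add (α β : Fin (4 * k - 1) → ℤ) :
    reverseChain (α + β) = reverseChain α + reverseChain β := by
  funext q
  simp [reverseChain, add_comm]

theorem reverseChain_zero : reverseChain (0 : Fin (4 * k - 1) → ℤ) = 0 := by
  funext q
  simp [reverseChain]

theorem reverseChain_neg (α : Fin (4 * k - 1) → ℤ) : reverseChain (-α) = -reverseChain α := by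
  funext q
  simp [reverseChain]

theorem Related.refl (s : S) : Related Z 0 0 s s :=
  ⟨1, 1, rfl, by rw [reverseChain_zero, neg_zero]; rfl, by simp [GradingGroup.one_maslov],
    by rw [one_smul, one_smul]⟩

/-- The summand `1` comes from moving `λ⁻¹` to the other side of the degree condition on terms of
the differential. -/
theorem Related.of_gr {X : StrandDiagram Z} {Y : StrandDiagram Z.reverse} {s t : S}
    (hsupp : reverseChain X.supp = -Y.supp)
    (h : X.gr • Y.gr • t = (GradingGroup.lam Z)⁻¹ • s) :
    Related Z X.supp (X.iota + Y.iota + 1) s t := by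
  have hlam : (GradingGroup.lam Z).chain = 0 := rfl
  refine ⟨GradingGroup.lam Z * X.gr, Y.gr, ?_, ?_, ?_, ?_⟩
  · rw [GradingGroup.mul_chain, hlam, zero_add]
    rfl
  · rw [hsupp, neg_neg]
    rfl
  · rw [GradingGroup.mul_maslov, hlam, multBoundary_zero_right]
    change 1 + X.iota + 0 + Y.iota = _
    ring
  · rw [mul_smul, h, smul_inv_smul]

namespace IsLambdaFreeGradingSet

variable (hS : IsLambdaFreeGradingSet Z S)
include hS

/-- The two group laws contribute `m(β, ∂α)` with opposite signs by `multBoundary_reverseChain`, so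
the total Maslov components simply add. -/
theorem related_trans {α β : Fin (4 * k - 1) → ℤ} {m n : ℚ} {s t u : S}
    (h1 : Related Z α m s t) (h2 : Related Z β n t u) : Related Z (α + β) (m + n) s u := by
  obtain ⟨g, h, rfl, hh, rfl, rfl⟩ := h1
  obtain ⟨g', h', rfl, hh', rfl, rfl⟩ := h2
  refine ⟨g * g', h * h', rfl, ?_, ?_, ?_⟩
  · rw [GradingGroup.mul_chain, hh, hh', reverseChain_add, neg_add]
  · rw [GradingGroup.mul_maslov, GradingGroup.mul_maslov, hh, hh', multBoundary_reverseChain]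
    ring
  · rw [mul_smul, mul_smul, hS.commute g' h]

theorem related_symm {α : Fin (4 * k - 1) → ℤ} {m : ℚ} {s t : S}
    (h1 : Related Z α m s t) : Related Z (-α) (-m) t s := by
  obtain ⟨g, h, rfl, hh, rfl, rfl⟩ := h1
  refine ⟨g⁻¹, h⁻¹, rfl, ?_, ?_, ?_⟩
  · rw [GradingGroup.inv_chain, hh, reverseChain_neg]
  · rw [GradingGroup.inv_maslov, GradingGroup.inv_maslov, hh, multBoundary_reverseChain]
    ring
  · rw [hS.commute g h, inv_smul_smul, inv_smul_smul]

theorem lam_zpow_agree (n : ℤ) (s : S) :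
    GradingGroup.lam Z.reverse ^ n • s = GradingGroup.lam Z ^ n • s := by
  induction n using Int.induction_on generalizing s with
  | zero => rw [zpow_zero, zpow_zero, one_smul, one_smul]
  | succ n ih => rw [zpow_add_one, zpow_add_one, mul_smul, mul_smul, hS.lam_agree, ih]
  | pred n ih =>
    rw [zpow_sub_one, zpow_sub_one, mul_smul, mul_smul, ih]
    congr 1
    rw [inv_smul_eq_iff, ← hS.lam_agree, smul_inv_smul]

/-- With chain zero both group elements are powers of `λ`. Their exponents add up because the two
actions of `λ` agree, and the sum vanishes because the action is free. -/
theorem related_self {n : ℚ} {s : S} (h : Related Z 0 n s s) : n = 0 := by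
  obtain ⟨g, h, hg, hh, hn, hs⟩ := h
  rw [reverseChain_zero, neg_zero] at hh
  obtain ⟨a, rfl⟩ := GradingGroup.eq_lam_zpow hg
  obtain ⟨b, rfl⟩ := GradingGroup.eq_lam_zpow hh
  rw [hS.lam_zpow_agree, ← mul_smul, ← zpow_add] at hs
  rw [(GradingGroup.lam_zpow a).1, (GradingGroup.lam_zpow b).1] at hn
  have : a + b = 0 := by
    by_contra hne
    exact hS.lam_free s _ hne hs.symm
  rw [← hn]
  exact_mod_cast this

/-- Going forth by one relation and back by the other is a loop with chain zero, so `related_self`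
applies. -/
theorem related_unique {α : Fin (4 * k - 1) → ℤ} {m n : ℚ} {s t : S}
    (h1 : Related Z α m s t) (h2 : Related Z α n s t) : m = n := by
  have := hS.related_trans h1 (hS.related_symm h2)
  rw [add_neg_cancel] at this
  have := hS.related_self this
  linarith

end IsLambdaFreeGradingSet

end Gradings

/-! ### Degrees of the generators of a bimodule -/

section Degrees

open StrandDiagram

variable {k : ℕ} {Z : PointedMatchedCircle k}
variable {S : Type*} [MulAction (GradingGroup Z) S] [MulAction (GradingGroup Z.reverse) S]

variable (Z) in
/-- The degrees `deg` are compatible with the chords of length one. -/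
def CompatibleDegrees (deg : Finset (Fin (2 * k)) → S) : Prop :=
  ∀ (B : Finset (Fin (2 * k))) (i j : Fin (4 * k)), j.val = i.val + 1 → Z.M i ∉ B → Z.M j ∉ B →
    Related Z (initialChain j - initialChain i) 0 (deg (insert (Z.M i) B))
      (deg (insert (Z.M j) B))

variable (hS : IsLambdaFreeGradingSet Z S)

include hS in
theorem IsLambdaFreeGradingSet.related_trans_sub {p q r : Fin (4 * k)} {s t u : S}
    (h1 : Related Z (initialChain q - initialChain p) 0 s t)
    (h2 : Related Z (initialChain r - initialChain q) 0 t u) :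
    Related Z (initialChain r - initialChain p) 0 s u := by
  have := hS.related_trans h1 h2
  rwa [add_zero, add_comm, sub_add_sub_cancel] at this

include hS in
theorem IsLambdaFreeGradingSet.related_symm_sub {p q : Fin (4 * k)} {s t : S}
    (h1 : Related Z (initialChain q - initialChain p) 0 s t) :
    Related Z (initialChain p - initialChain q) 0 t s := by
  have := hS.related_symm h1
  rwa [neg_zero, neg_sub] at this

variable {deg : Finset (Fin (2 * k)) → S}

namespace CompatibleDegrees

variable (hdeg : CompatibleDegrees Z deg)
include hdeg hS

/-- A chord is split into chords of length one, taking its two parts in the order dictated by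
whether the splitting point is occupied. -/
theorem related_of_lt : ∀ (B : Finset (Fin (2 * k))) (i j : Fin (4 * k)), i < j →
    Z.M i ≠ Z.M j → Z.M i ∉ B → Z.M j ∉ B →
    Related Z (initialChain j - initialChain i) 0 (deg (insert (Z.M i) B))
      (deg (insert (Z.M j) B)) := by
  refine Z.chord_induction hdeg ?_ ?_ ?_
  · intro B i r j _ _ _ _ _ _ _ _ h1 h2
    exact hS.related_trans_sub h1 h2
  · intro B i r j _ _ _ _ _ _ _ _ h1 h2
    rw [Finset.insert_comm (Z.M i) (Z.M j)] at h2
    rw [Finset.insert_comm (Z.M i) (Z.M r), Finset.insert_comm (Z.M j) (Z.M r)]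
    have := hS.related_trans h1 h2
    rwa [add_zero, sub_add_sub_cancel] at this
  · intro B i r s j h1 h2 h3 h4 h5 h6 h7 h8 ih
    have hir : i < r := Fin.lt_def.2 (by omega)
    have hrs : r < s := Fin.lt_def.2 (by omega)
    have hsj : s < j := Fin.lt_def.2 (by omega)
    have e1 := ih B i r hir (by omega) (by rwa [h5]) h7 (by rwa [h5])
    have e2 := ih B r s hrs (by omega) (by rw [h5, ← h4]; exact h6.symm) (by rwa [h5])
      (by rwa [← h4])
    have e3 := ih B s j hsj (by omega) (by rwa [← h4]) (by rwa [← h4]) h8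
    -- The crosswise case is harmless here: the three unit steps pass alternately between the
    -- idempotents at the ends, since `r` has the same pair as `j` and `s` the same pair as `i`.
    exact hS.related_trans_sub (hS.related_trans_sub e1 e2) e3

theorem related_of_ne (B : Finset (Fin (2 * k))) (i j : Fin (4 * k)) (hij : Z.M i ≠ Z.M j)
    (hi : Z.M i ∉ B) (hj : Z.M j ∉ B) :
    Related Z (initialChain j - initialChain i) 0 (deg (insert (Z.M i) B))
      (deg (insert (Z.M j) B)) := by
  rcases lt_trichotomy i j with h | rfl | h
  · exact hdeg.related_of_lt hS B i j h hij hi hj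
  · exact absurd rfl hij
  · exact hS.related_symm_sub (hdeg.related_of_lt hS B j i h hij.symm hj hi)

/-- The loop is a detour through a pair with the other occupancy. If the pair of `p` is occupied,
its strand goes to a vacant pair and returns to `q`. If it is vacant, a strand of an occupied pair
goes to `q` and returns from `p`. Hence both an occupied and a vacant pair are required. -/
theorem related_loop {I : Finset (Fin (2 * k))} {a b : Fin (2 * k)} (ha : a ∈ I) (hb : b ∉ I)
    {p q : Fin (4 * k)} (hpq : Z.M p = Z.M q) :
    Related Z (initialChain q - initialChain p) 0 (deg I) (deg I) := by
  by_cases hp : Z.M p ∈ I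
  · obtain ⟨r, rfl⟩ := exists_point Z b
    have hne : Z.M p ≠ Z.M r := fun h => hb (h ▸ hp)
    have hr : Z.M r ∉ I.erase (Z.M p) := fun h => hb (Finset.mem_of_mem_erase h)
    have h1 := hdeg.related_of_ne hS _ p r hne (Finset.notMem_erase _ I) hr
    have h2 := hdeg.related_of_ne hS (I.erase (Z.M p)) r q (hpq ▸ hne.symm) hr
      (hpq ▸ Finset.notMem_erase _ I)
    rw [← hpq] at h2
    rw [Finset.insert_erase hp] at h1 h2
    exact hS.related_trans_sub h1 h2
  · obtain ⟨r, rfl⟩ := exists_point Z a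
    have hne : Z.M r ≠ Z.M p := fun h => hp (h ▸ ha)
    have hp' : Z.M p ∉ I.erase (Z.M r) := fun h => hp (Finset.mem_of_mem_erase h)
    have h1 := hdeg.related_of_ne hS _ r q (hpq ▸ hne) (Finset.notMem_erase _ I) (hpq ▸ hp')
    have h2 := hdeg.related_of_ne hS _ p r hne.symm hp' (Finset.notMem_erase _ I)
    rw [← hpq] at h1
    rw [Finset.insert_erase ha] at h1 h2
    have := hS.related_trans h1 h2
    rwa [add_zero, sub_add_sub_cancel] at this

/-- Elements of `I \ J` are exchanged one at a time for elements of `J \ I`, moving along chains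
between the chosen representatives `v`. -/
theorem related_of_card_eq {v : Fin (2 * k) → Fin (4 * k)} (hv : ∀ a, Z.M (v a) = a)
    {I J : Finset (Fin (2 * k))} (hIJ : I.card = J.card) :
    Related Z (∑ a ∈ J, initialChain (v a) - ∑ a ∈ I, initialChain (v a)) 0
      (deg I) (deg J) := by
  induction hn : (I \ J).card generalizing I with
  | zero =>
    have : I = J := Finset.eq_of_subset_of_card_le
      (Finset.sdiff_eq_empty_iff_subset.1 (Finset.card_eq_zero.1 hn)) hIJ.ge
    rw [this, sub_self]
    exact Related.refl _
  | succ n ih =>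
    obtain ⟨a, ha⟩ := Finset.card_pos.1 (by omega : 0 < (I \ J).card)
    obtain ⟨b, hb⟩ := Finset.card_pos.1
      (by rw [← Finset.card_sdiff_comm hIJ]; omega : 0 < (J \ I).card)
    rw [Finset.mem_sdiff] at ha hb
    have hab : a ≠ b := fun h => hb.2 (h ▸ ha.1)
    have hb' : b ∉ I.erase a := fun h => hb.2 (Finset.mem_of_mem_erase h)
    have h1 := hdeg.related_of_ne hS (I.erase a) (v a) (v b) (by rwa [hv, hv])
      (by rw [hv]; exact Finset.notMem_erase _ _) (by rwa [hv])
    rw [hv, hv, Finset.insert_erase ha.1] at h1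
    have h2 : (insert b (I.erase a)).card = J.card := by
      rw [Finset.card_insert_of_notMem hb', Finset.card_erase_add_one ha.1, hIJ]
    have h3 : (insert b (I.erase a) \ J).card = n := by
      rw [Finset.insert_sdiff_of_mem _ hb.1, Finset.erase_sdiff_comm,
        Finset.card_erase_of_mem (Finset.mem_sdiff.2 ha), hn]
      rfl
    have h4 := hS.related_trans h1 (ih h2 h3)
    rw [Finset.sum_insert hb', add_zero] at h4
    have h5 := Finset.add_sum_erase I (fun a => initialChain (v a)) ha.1
    rw [← h5]
    convert h4 using 1
    abel

/-- Up to loops between matched points, `supp X` is the difference of the representatives of the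
terminal and the initial pairs: horizontal pairs cancel, and each end of a moving strand differs
from its representative by such a loop. -/
theorem related_supp (X : StrandDiagram Z) (hX : X.initialPairs ≠ Finset.univ) :
    Related Z X.supp 0 (deg X.initialPairs) (deg X.terminalPairs) := by
  choose v hv using exists_point Z
  have hadm := X.admissible
  have d1 : Disjoint X.horizontalPairs (X.moving.image fun σ => Z.M σ.1) := by
    rw [Finset.disjoint_right]
    intro a ha
    obtain ⟨⟨i, j⟩, h, rfl⟩ := Finset.mem_image.1 ha
    exact hadm.initial_notMem _ _ h
  have d2 : Disjoint X.horizontalPairs (X.moving.image fun σ => Z.M σ.2) := by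
    rw [Finset.disjoint_right]
    intro a ha
    obtain ⟨⟨i, j⟩, h, rfl⟩ := Finset.mem_image.1 ha
    exact hadm.terminal_notMem _ _ h
  have i1 : Set.InjOn (fun σ : Fin (4 * k) × Fin (4 * k) => Z.M σ.1) X.moving := by
    rintro ⟨i, j⟩ h ⟨i', j'⟩ h' heq
    obtain ⟨rfl, rfl⟩ := hadm.initial_inj _ _ _ _ h h' heq.symm
    rfl
  have i2 : Set.InjOn (fun σ : Fin (4 * k) × Fin (4 * k) => Z.M σ.2) X.moving := by
    rintro ⟨i, j⟩ h ⟨i', j'⟩ h' heq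
    obtain ⟨rfl, rfl⟩ := hadm.terminal_inj _ _ _ _ h h' heq.symm
    rfl
  have eI : X.initialPairs = X.horizontalPairs ∪ X.moving.image fun σ => Z.M σ.1 := by
    conv_lhs => rw [← X.build_moving, initialPairs_build hadm]
  have eJ : X.terminalPairs = X.horizontalPairs ∪ X.moving.image fun σ => Z.M σ.2 := by
    conv_lhs => rw [← X.build_moving, terminalPairs_build hadm]
  have hcard : X.initialPairs.card = X.terminalPairs.card := by
    rw [eI, eJ, Finset.card_union_of_disjoint d1, Finset.card_union_of_disjoint d2,
      Finset.card_image_of_injOn i1, Finset.card_image_of_injOn i2]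
  have h1 := hdeg.related_of_card_eq hS hv hcard
  -- `X` has as many terminal as initial pairs, so a vacant pair remains for the detours in
  -- `related_loop`.
  obtain ⟨b, hb⟩ : ∃ b, b ∉ X.terminalPairs := by
    by_contra! h
    apply hX
    rw [← Finset.card_eq_iff_eq_univ, hcard, Finset.card_eq_iff_eq_univ]
    exact Finset.eq_univ_of_forall h
  -- The corrections from representatives to actual endpoints are all made at the terminal
  -- idempotent, which a moving strand makes nonempty.
  have h2 : ∀ F ⊆ X.moving, Related Z (∑ σ ∈ F, ((initialChain σ.2 - initialChain (v (Z.M σ.2))) +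
      (initialChain (v (Z.M σ.1)) - initialChain σ.1))) 0 (deg X.terminalPairs)
      (deg X.terminalPairs) := by
    intro F
    induction F using Finset.induction_on with
    | empty => exact fun _ => Related.refl _
    | insert σ F hσ ih =>
      intro hF
      rw [Finset.insert_subset_iff] at hF
      have ha : Z.M σ.2 ∈ X.terminalPairs := by
        rw [eJ]
        exact Finset.mem_union_right _ (Finset.mem_image_of_mem _ hF.1)
      have e1 := hdeg.related_loop hS ha hb (p := v (Z.M σ.2)) (q := σ.2) (hv _)
      have e2 := hdeg.related_loop hS ha hb (p := σ.1) (q := v (Z.M σ.1)) (hv _).symm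
      have := hS.related_trans (hS.related_trans e1 e2) (ih hF.2)
      rw [Finset.sum_insert hσ]
      simpa using this
  have h3 := hS.related_trans h1 (h2 _ subset_rfl)
  rw [add_zero] at h3
  convert h3 using 1
  rw [supp_eq_sum_moving, eI, eJ, Finset.sum_union d1, Finset.sum_union d2, Finset.sum_image i1,
    Finset.sum_image i2]
  simp only [Finset.sum_add_distrib, Finset.sum_sub_distrib]
  abel

/-- Generators of the right degree and with corresponding supports have exactly one non-horizontal
strand on either side. -/
theorem moving_eq_singleton {X : StrandDiagram Z} {Y : StrandDiagram Z.reverse}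
    (hinit : Y.initialPairs = X.initialPairsᶜ) (hsupp : reverseChain X.supp = -Y.supp)
    (hgr : X.gr • Y.gr • deg X.terminalPairs = (GradingGroup.lam Z)⁻¹ • deg X.initialPairs) :
    ∃ i j, i < j ∧ X.moving = {(i, j)} ∧ Y.moving = {(j.rev, i.rev)} := by
  have h1 := Related.of_gr hsupp hgr
  have hXY : X.moving = ∅ ↔ Y.moving = ∅ := by
    rw [← supp_eq_zero_iff, ← supp_eq_zero_iff]
    constructor
    · intro h
      rwa [h, reverseChain_zero, zero_eq_neg] at hsupp
    · intro h
      rw [h, neg_zero] at hsupp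
      funext q
      have := congrFun hsupp q.rev
      simpa [reverseChain] using this
  have h2 : Related Z X.supp 0 (deg X.initialPairs) (deg X.terminalPairs) := by
    -- If all pairs are occupied on the left, `Y` has no strands at all, so `X` has empty support
    -- and is horizontal.
    by_cases hX : X.initialPairs = Finset.univ
    · have hY : Y.moving = ∅ := by
        rw [hX, Finset.compl_univ] at hinit
        rw [Finset.eq_empty_iff_forall_notMem]
        rintro ⟨i, j⟩ h
        have : Z.reverse.M i ∈ Y.initialPairs := mem_initialPairs.2 ⟨i, j, (mem_moving.1 h).1, rfl⟩
        rw [hinit] at this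
        exact Finset.notMem_empty _ this
      have hX' := hXY.2 hY
      have : X.initialPairs = X.terminalPairs := by
        conv_lhs => rw [← X.build_moving, initialPairs_build X.admissible]
        conv_rhs => rw [← X.build_moving, terminalPairs_build X.admissible]
        rw [hX', Finset.image_empty, Finset.image_empty]
      rw [(supp_eq_zero_iff X).2 hX', this]
      exact Related.refl _
    · exact hdeg.related_supp hS X hX
  -- This is the equation `ι(X) + ι(Y) + 1 = 0`. It excludes horizontal diagrams, for which `ι = 0`,
  -- and with `iota_le` it allows at most two moving strands in total.
  have h3 := hS.related_unique h1 h2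
  have h4 := X.iota_le
  have h5 := Y.iota_le
  have hX : X.moving ≠ ∅ := by
    intro h
    have hY := hXY.1 h
    rw [iota, iota, inv, inv, h, hY] at h3
    norm_num at h3
  have hY : Y.moving ≠ ∅ := fun h => hX (hXY.2 h)
  have c1 := Finset.card_pos.2 (Finset.nonempty_iff_ne_empty.2 hX)
  have c2 := Finset.card_pos.2 (Finset.nonempty_iff_ne_empty.2 hY)
  have c3 : X.moving.card + Y.moving.card ≤ 2 := by
    have : (X.moving.card : ℚ) + Y.moving.card ≤ 2 := by linarith
    exact_mod_cast this
  obtain ⟨⟨i, j⟩, eX⟩ := Finset.card_eq_one.1 (by omega : X.moving.card = 1)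
  obtain ⟨⟨u, w⟩, eY⟩ := Finset.card_eq_one.1 (by omega : Y.moving.card = 1)
  have hij : i < j := (mem_moving.1 (eX ▸ Finset.mem_singleton_self _ : (i, j) ∈ X.moving)).2
  have huw : u < w := (mem_moving.1 (eY ▸ Finset.mem_singleton_self _ : (u, w) ∈ Y.moving)).2
  refine ⟨i, j, hij, eX, ?_⟩
  rw [supp_eq_sum_moving, supp_eq_sum_moving, eX, eY, Finset.sum_singleton, Finset.sum_singleton,
    reverseChain_initialChain_sub, neg_inj] at hsupp
  obtain ⟨e1, e2⟩ := initialChain_sub_injective (Fin.rev_lt_rev.2 hij) huw hsupp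
  rw [eY, e1, e2]

end CompatibleDegrees

end Degrees

/-! ### Coefficients with respect to the basis of pairs of strands diagrams -/

section Coefficients

open StrandDiagram

variable {k : ℕ} {Z : PointedMatchedCircle k}

theorem biBasis_apply (X : StrandDiagram Z) (Y : StrandDiagram Z.reverse) :
    biBasis Z (X, Y) = StrandAlg.basis Z X ⊗ₜ[ZMod 2] StrandAlg.basis Z.reverse Y :=
  Module.Basis.tensorProduct_apply _ _ _ _

theorem biBasis_repr_tmul (u : StrandAlg Z) (v : StrandAlg Z.reverse) (X : StrandDiagram Z)
    (Y : StrandDiagram Z.reverse) :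
    (biBasis Z).repr (u ⊗ₜ[ZMod 2] v) (X, Y) =
      (StrandAlg.basis Z).repr u X * (StrandAlg.basis Z.reverse).repr v Y := by
  rw [biBasis, Module.Basis.tensorProduct_repr_tmul_apply, smul_eq_mul, mul_comm]

theorem repr_map (f : BiAlg Z →ₗ[ZMod 2] BiAlg Z) (u : BiAlg Z)
    (Q : StrandDiagram Z × StrandDiagram Z.reverse) :
    (biBasis Z).repr (f u) Q =
      ∑ P, (biBasis Z).repr u P * (biBasis Z).repr (f (biBasis Z P)) Q := by
  conv_lhs => rw [← (biBasis Z).sum_repr u]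
  simp only [map_sum, map_smul, Finsupp.finsetSum_apply, Finsupp.smul_apply, smul_eq_mul]

open Classical in
theorem biBasis_mul (X X' : StrandDiagram Z) (Y Y' : StrandDiagram Z.reverse) :
    biBasis Z (X, Y) * biBasis Z (X', Y') =
      if Composable X X' ∧ Composable Y Y' then biBasis Z (comp X X', comp Y Y') else 0 := by
  rw [biBasis_apply, biBasis_apply, Algebra.TensorProduct.tmul_mul_tmul,
    StrandAlg.basis_mul_basis, StrandAlg.basis_mul_basis, StrandAlg.basicMul, StrandAlg.basicMul]
  by_cases h : Composable X X' <;> by_cases h' : Composable Y Y' <;>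
    simp [h, h', biBasis_apply]

open Classical in
theorem repr_biBasis_mul (P Q W : StrandDiagram Z × StrandDiagram Z.reverse) :
    (biBasis Z).repr (biBasis Z P * biBasis Z Q) W =
      if (Composable P.1 Q.1 ∧ Composable P.2 Q.2) ∧ comp P.1 Q.1 = W.1 ∧ comp P.2 Q.2 = W.2
      then 1 else 0 := by
  obtain ⟨X, Y⟩ := P
  obtain ⟨X', Y'⟩ := Q
  obtain ⟨X'', Y''⟩ := W
  rw [biBasis_mul]
  by_cases h : Composable X X' ∧ Composable Y Y'
  · rw [if_pos h, Module.Basis.repr_self, Finsupp.single_apply]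
    simp [h]
  · rw [if_neg h, map_zero, Finsupp.zero_apply, if_neg fun h' => h h'.1]

theorem repr_mul (u v : BiAlg Z) (W : StrandDiagram Z × StrandDiagram Z.reverse) :
    (biBasis Z).repr (u * v) W = ∑ P, ∑ Q, (biBasis Z).repr u P * ((biBasis Z).repr v Q *
      (biBasis Z).repr (biBasis Z P * biBasis Z Q) W) := by
  have h1 := repr_map (LinearMap.mulRight (ZMod 2) v) u W
  simp only [LinearMap.mulRight_apply] at h1
  rw [h1]
  refine Finset.sum_congr rfl fun P _ => ?_
  have h2 := repr_map (LinearMap.mulLeft (ZMod 2) (biBasis Z P)) v W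
  simp only [LinearMap.mulLeft_apply] at h2
  rw [h2, Finset.mul_sum]

theorem exists_of_repr_mul_ne_zero {u v : BiAlg Z} {W : StrandDiagram Z × StrandDiagram Z.reverse}
    (h : (biBasis Z).repr (u * v) W ≠ 0) :
    ∃ P Q, (biBasis Z).repr u P ≠ 0 ∧ (biBasis Z).repr v Q ≠ 0 ∧ Composable P.1 Q.1 ∧
      Composable P.2 Q.2 ∧ comp P.1 Q.1 = W.1 ∧ comp P.2 Q.2 = W.2 := by
  classical
  rw [repr_mul] at h
  obtain ⟨P, -, hP⟩ := Finset.exists_ne_zero_of_sum_ne_zero h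
  obtain ⟨Q, -, hQ⟩ := Finset.exists_ne_zero_of_sum_ne_zero hP
  have h1 := left_ne_zero_of_mul hQ
  have h2 := left_ne_zero_of_mul (right_ne_zero_of_mul hQ)
  have h3 := right_ne_zero_of_mul (right_ne_zero_of_mul hQ)
  rw [repr_biBasis_mul] at h3
  obtain ⟨⟨h4, h5⟩, h6, h7⟩ := (ite_ne_right_iff.1 h3).1
  exact ⟨P, Q, h1, h2, h4, h5, h6, h7⟩

theorem compIdem_mul_biBasis (S : Finset (Fin (2 * k))) (X : StrandDiagram Z)
    (Y : StrandDiagram Z.reverse) :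
    compIdem Z S * biBasis Z (X, Y) =
      if X.initialPairs = S ∧ Y.initialPairs = Sᶜ then biBasis Z (X, Y) else 0 := by
  classical
  have h : compIdem Z S = biBasis Z (idem Z S, idem Z.reverse Sᶜ) := (biBasis_apply _ _).symm
  rw [h, biBasis_mul, composable_idem_left, composable_idem_left]
  by_cases h' : X.initialPairs = S ∧ Y.initialPairs = Sᶜ
  · obtain ⟨rfl, h2⟩ := h'
    rw [← h2, idem_comp, idem_comp]
    simp
  · rw [if_neg h', if_neg fun h2 => h' ⟨h2.1.symm, h2.2.symm⟩]

theorem biBasis_mul_compIdem (S : Finset (Fin (2 * k))) (X : StrandDiagram Z)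
    (Y : StrandDiagram Z.reverse) :
    biBasis Z (X, Y) * compIdem Z S =
      if X.terminalPairs = S ∧ Y.terminalPairs = Sᶜ then biBasis Z (X, Y) else 0 := by
  classical
  have h : compIdem Z S = biBasis Z (idem Z S, idem Z.reverse Sᶜ) := (biBasis_apply _ _).symm
  rw [h, biBasis_mul, composable_idem_right, composable_idem_right]
  by_cases h' : X.terminalPairs = S ∧ Y.terminalPairs = Sᶜ
  · obtain ⟨rfl, h2⟩ := h'
    rw [← h2, comp_idem, comp_idem]
    simp
  · rw [if_neg h', if_neg fun h2 => h' ⟨h2.1.symm, h2.2.symm⟩]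

theorem repr_compIdem_mul (S : Finset (Fin (2 * k))) (u : BiAlg Z) (X : StrandDiagram Z)
    (Y : StrandDiagram Z.reverse) :
    (biBasis Z).repr (compIdem Z S * u) (X, Y) =
      if X.initialPairs = S ∧ Y.initialPairs = Sᶜ then (biBasis Z).repr u (X, Y) else 0 := by
  have h := repr_map (LinearMap.mulLeft (ZMod 2) (compIdem Z S)) u (X, Y)
  simp only [LinearMap.mulLeft_apply] at h
  rw [h, Finset.sum_eq_single (X, Y)]
  · rw [compIdem_mul_biBasis]
    split_ifs <;> simp
  · rintro ⟨X', Y'⟩ - hne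
    rw [compIdem_mul_biBasis]
    split_ifs
    · rw [Module.Basis.repr_self, Finsupp.single_eq_of_ne hne.symm, mul_zero]
    · simp
  · simp

theorem repr_mul_compIdem (S : Finset (Fin (2 * k))) (u : BiAlg Z) (X : StrandDiagram Z)
    (Y : StrandDiagram Z.reverse) :
    (biBasis Z).repr (u * compIdem Z S) (X, Y) =
      if X.terminalPairs = S ∧ Y.terminalPairs = Sᶜ then (biBasis Z).repr u (X, Y) else 0 := by
  have h := repr_map (LinearMap.mulRight (ZMod 2) (compIdem Z S)) u (X, Y)
  simp only [LinearMap.mulRight_apply] at h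
  rw [h, Finset.sum_eq_single (X, Y)]
  · rw [biBasis_mul_compIdem]
    split_ifs <;> simp
  · rintro ⟨X', Y'⟩ - hne
    rw [biBasis_mul_compIdem]
    split_ifs
    · rw [Module.Basis.repr_self, Finsupp.single_eq_of_ne hne.symm, mul_zero]
    · simp
  · simp

theorem repr_biDiff (u : BiAlg Z) (X : StrandDiagram Z) (Y : StrandDiagram Z.reverse) :
    (biBasis Z).repr (biDiff Z u) (X, Y) =
      ∑ X', (biBasis Z).repr u (X', Y) *
          (StrandAlg.basis Z).repr (StrandAlg.basicDiff X') X +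
        ∑ Y', (biBasis Z).repr u (X, Y') *
          (StrandAlg.basis Z.reverse).repr (StrandAlg.basicDiff Y') Y := by
  classical
  have hd : ∀ (W : PointedMatchedCircle k) (V : StrandDiagram W),
      StrandAlg.diff W (StrandAlg.basis W V) = StrandAlg.basicDiff V := fun W V => by
    rw [StrandAlg.diff, Module.Basis.constr_basis]
  rw [repr_map]
  have h : ∀ P : StrandDiagram Z × StrandDiagram Z.reverse,
      (biBasis Z).repr (biDiff Z (biBasis Z P)) (X, Y) =
        (if P.2 = Y then (StrandAlg.basis Z).repr (StrandAlg.basicDiff P.1) X else 0) +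
        (if P.1 = X then (StrandAlg.basis Z.reverse).repr (StrandAlg.basicDiff P.2) Y else 0) := by
    rintro ⟨X', Y'⟩
    rw [biBasis_apply, biDiff, LinearMap.add_apply, TensorProduct.map_tmul,
      TensorProduct.map_tmul, LinearMap.id_apply, LinearMap.id_apply, map_add, Finsupp.add_apply,
      biBasis_repr_tmul, biBasis_repr_tmul, hd, hd, Module.Basis.repr_self,
      Module.Basis.repr_self, Finsupp.single_apply, Finsupp.single_apply]
    simp
  simp only [h, mul_add, Finset.sum_add_distrib, Fintype.sum_prod_type]
  congr 1
  · simp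
  · rw [Finset.sum_comm]
    simp

theorem biDiff_compIdem (S : Finset (Fin (2 * k))) : biDiff Z (compIdem Z S) = 0 := by
  have h : ∀ (W : PointedMatchedCircle k) (T : Finset (Fin (2 * k))),
      StrandAlg.diff W (StrandAlg.idempotent W T) = 0 := fun W T => by
    rw [StrandAlg.diff, StrandAlg.idempotent, Module.Basis.constr_basis, basicDiff_idem]
  rw [biDiff, compIdem, LinearMap.add_apply, TensorProduct.map_tmul, TensorProduct.map_tmul, h, h,
    TensorProduct.zero_tmul, TensorProduct.tmul_zero, add_zero]

open Classical in
theorem repr_chordElement (i j : Fin (4 * k)) (X : StrandDiagram Z) :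
    (StrandAlg.basis Z).repr (StrandAlg.chordElement Z i j) X =
      if X.moving = {(i, j)} then 1 else 0 := by
  rw [StrandAlg.chordElement, map_sum, Finsupp.finsetSum_apply, Finset.sum_eq_single X]
  · split_ifs <;> simp
  · intro Y _ hne
    split_ifs
    · rw [Module.Basis.repr_self, Finsupp.single_eq_of_ne hne.symm]
    · simp
  · simp

/-- The pair `(X, Y)` occurs in `I · ã(ξ) · J` for the chord `ξ = [i, j]` and the pairs `I` and `J`
of complementary idempotents that belong to `S` and `T`. -/
structure IsChordTerm (S T : Finset (Fin (2 * k))) (i j : Fin (4 * k)) (X : StrandDiagram Z)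
    (Y : StrandDiagram Z.reverse) : Prop where
  initial_left : X.initialPairs = S
  initial_right : Y.initialPairs = Sᶜ
  terminal_left : X.terminalPairs = T
  terminal_right : Y.terminalPairs = Tᶜ
  moving_left : X.moving = {(i, j)}
  moving_right : Y.moving = {(j.rev, i.rev)}

open Classical in
theorem repr_chord_term (S T : Finset (Fin (2 * k))) (i j : Fin (4 * k)) (X : StrandDiagram Z)
    (Y : StrandDiagram Z.reverse) :
    (biBasis Z).repr (compIdem Z S * chordPair Z i j * compIdem Z T) (X, Y) =
      if IsChordTerm S T i j X Y then 1 else 0 := by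
  rw [repr_mul_compIdem, repr_compIdem_mul, chordPair, biBasis_repr_tmul, repr_chordElement,
    repr_chordElement]
  by_cases h : IsChordTerm S T i j X Y
  · rw [if_pos ⟨h.3, h.4⟩, if_pos ⟨h.1, h.2⟩, if_pos h.5, if_pos h.6, if_pos h, mul_one]
  · rw [if_neg h]
    split_ifs with h1 h2 h3 h4 <;> simp
    exact h ⟨h2.1, h2.2, h1.1, h1.2, h3, h4⟩

/-- The moving strands and the initial idempotents determine both factors by `ext_of_moving`, so `I
· ã(ξ) · J` never has more than one term. -/
theorem IsChordTerm.unique {S T : Finset (Fin (2 * k))} {i j : Fin (4 * k)} {X X' : StrandDiagram Z}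
    {Y Y' : StrandDiagram Z.reverse} (h : IsChordTerm S T i j X Y)
    (h' : IsChordTerm S T i j X' Y') : X = X' ∧ Y = Y' :=
  ⟨ext_of_moving (h.moving_left.trans h'.moving_left.symm)
    (h.initial_left.trans h'.initial_left.symm),
  ext_of_moving (h.moving_right.trans h'.moving_right.symm)
    (h.initial_right.trans h'.initial_right.symm)⟩

theorem IsChordTerm.eq_biBasis {S T : Finset (Fin (2 * k))} {i j : Fin (4 * k)}
    {X : StrandDiagram Z} {Y : StrandDiagram Z.reverse} (h : IsChordTerm S T i j X Y) :
    compIdem Z S * chordPair Z i j * compIdem Z T = biBasis Z (X, Y) := by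
  classical
  apply (biBasis Z).repr.injective
  ext ⟨X', Y'⟩
  rw [repr_chord_term, Module.Basis.repr_self, Finsupp.single_apply]
  refine if_congr ⟨fun h' => ?_, fun h' => ?_⟩ rfl rfl
  · obtain ⟨rfl, rfl⟩ := h.unique h'
    rfl
  · obtain ⟨rfl, rfl⟩ := Prod.mk.inj h'
    exact h

/-- Supports are additive under concatenation, so the elements whose terms all have corresponding
supports form a subalgebra, and it contains the generators of the diagonal one. -/
theorem supp_of_mem_diagonalSubalgebra {u : BiAlg Z} (hu : u ∈ diagonalSubalgebra Z)
    {X : StrandDiagram Z} {Y : StrandDiagram Z.reverse} (h : (biBasis Z).repr u (X, Y) ≠ 0) :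
    reverseChain X.supp = -Y.supp := by
  classical
  let A : NonUnitalSubalgebra (ZMod 2) (BiAlg Z) :=
    { carrier := {u | ∀ P : StrandDiagram Z × StrandDiagram Z.reverse,
        (biBasis Z).repr u P ≠ 0 → reverseChain P.1.supp = -P.2.supp}
      add_mem' := by
        intro u v hu hv P hP
        rw [map_add, Finsupp.add_apply] at hP
        by_cases h : (biBasis Z).repr u P = 0
        · exact hv P fun h' => hP (by rw [h, h', add_zero])
        · exact hu P h
      zero_mem' := by
        intro P hP
        simp at hP
      smul_mem' := by
        intro c u hu P hP
        rw [map_smul, Finsupp.smul_apply] at hP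
        exact hu P (right_ne_zero_of_smul hP)
      mul_mem' := by
        intro u v hu hv W hW
        obtain ⟨P, Q, h1, h2, h3, h4, h5, h6⟩ := exists_of_repr_mul_ne_zero hW
        rw [← h5, ← h6, supp_comp h3, supp_comp h4, reverseChain_add, hu P h1, hv Q h2, neg_add] }
  have hle : diagonalSubalgebra Z ≤ A := by
    refine NonUnitalAlgebra.adjoin_le ?_
    rintro _ ⟨X, Y, S, T, hXY, rfl⟩ ⟨X', Y'⟩ hP
    have e : (StrandAlg.idempotent Z S * StrandAlg.basis Z X * StrandAlg.idempotent Z T) ⊗ₜ[ZMod 2]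
        (StrandAlg.idempotent Z.reverse Sᶜ * StrandAlg.basis Z.reverse Y *
          StrandAlg.idempotent Z.reverse Tᶜ) = compIdem Z S * biBasis Z (X, Y) * compIdem Z T := by
      rw [compIdem, compIdem, biBasis_apply, Algebra.TensorProduct.tmul_mul_tmul,
        Algebra.TensorProduct.tmul_mul_tmul]
    rw [e, repr_mul_compIdem, repr_compIdem_mul] at hP
    have h1 := (ite_ne_right_iff.1 (ite_ne_right_iff.1 hP).2).2
    rw [Module.Basis.repr_self, Finsupp.single_apply] at h1
    obtain ⟨rfl, rfl⟩ := Prod.mk.inj (ite_ne_right_iff.1 h1).1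
    exact hXY
  exact hle hu (X, Y) h

end Coefficients

/-! ### The coefficients of the differential -/

section Differential

open StrandDiagram

variable {k : ℕ} {Z : PointedMatchedCircle k}
variable {M : Type*} [AddCommGroup M] [Module (BiAlg Z) M] {D : M →+ M}
variable {x : Finset (Fin (2 * k)) → M} {a : Finset (Fin (2 * k)) → Finset (Fin (2 * k)) → BiAlg Z}

theorem biAlg_zero_smul (m : M) : (0 : BiAlg Z) • m = 0 := zero_smul (BiAlg Z) m

theorem biAlg_neg_smul (u : BiAlg Z) (m : M) : -u • m = -(u • m) := neg_smul u m

theorem biAlg_neg_mul (u v : BiAlg Z) : -u * v = -(u * v) := neg_mul u v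

theorem IsComplementaryGenerators.coeff_unique (hx : IsComplementaryGenerators Z x)
    {c d : Finset (Fin (2 * k)) → BiAlg Z} (hc : ∀ S, c S * compIdem Z S = c S)
    (hd : ∀ S, d S * compIdem Z S = d S) (h : ∑ S, c S • x S = ∑ S, d S • x S) : c = d :=
  (hx.existsUnique_coeff (∑ S, c S • x S)).unique ⟨hc, rfl⟩ ⟨hd, h⟩

variable (hD : IsDGModule Z D) (hx : IsComplementaryGenerators Z x) (ha : IsCoefficients Z D x a)

section

include hD hx ha

/-- The idempotent `I` is a cycle and fixes `x(I)`, hence it also fixes `∂x(I)`; the coefficients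
are unique. -/
theorem IsCoefficients.idem_mul (I J : Finset (Fin (2 * k))) :
    compIdem Z I * a I J = a I J := by
  have h1 := hD.leibniz (compIdem Z I) (x I)
  rw [hx.idem_smul, biDiff_compIdem, biAlg_zero_smul, zero_add, ha.diff_gen, Finset.smul_sum] at h1
  simp only [← mul_smul] at h1
  refine (congrFun (hx.coeff_unique (c := a I) (d := fun J => compIdem Z I * a I J)
    (ha.mul_idem I) (fun J => ?_) h1) J).symm
  rw [mul_assoc, ha.mul_idem]

/-- The structure equation of a type DD bimodule, read off from `∂²x(I) = 0`. The factor `K` puts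
the coefficient of `x(K)` into the normal form in which it is unique. -/
theorem IsCoefficients.sq_relation (I K : Finset (Fin (2 * k))) :
    biDiff Z (a I K) * compIdem Z K + ∑ J, a I J * a J K = 0 := by
  have h1 := hD.sq_zero (x I)
  have h2 : D (D (x I)) = ∑ K, (biDiff Z (a I K) * compIdem Z K + ∑ J, a I J * a J K) • x K := by
    rw [ha.diff_gen, map_sum]
    simp only [hD.leibniz, ha.diff_gen, add_smul, Finset.sum_smul, Finset.sum_add_distrib,
      mul_smul, hx.idem_smul, Finset.smul_sum]
    congr 1
    exact Finset.sum_comm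
  refine congrFun (hx.coeff_unique
    (c := fun K => biDiff Z (a I K) * compIdem Z K + ∑ J, a I J * a J K) (d := 0)
    (fun K => ?_) (fun K => ?_) ?_) K
  · simp only [add_mul, Finset.sum_mul, mul_assoc, compIdem_mul_self, ha.mul_idem]
  · rw [Pi.zero_apply, zero_mul]
  · rw [← h2, h1]
    simp [biAlg_zero_smul]

theorem IsCoefficients.pairs_of_repr_ne_zero {I J : Finset (Fin (2 * k))} {X : StrandDiagram Z}
    {Y : StrandDiagram Z.reverse} (h : (biBasis Z).repr (a I J) (X, Y) ≠ 0) :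
    (X.initialPairs = I ∧ Y.initialPairs = Iᶜ) ∧ X.terminalPairs = J ∧ Y.terminalPairs = Jᶜ := by
  rw [← ha.mul_idem, ← ha.idem_mul hD hx, repr_mul_compIdem, repr_compIdem_mul] at h
  exact ⟨(ite_ne_right_iff.1 (ite_ne_right_iff.1 h).2).1, (ite_ne_right_iff.1 h).1⟩

end

variable {S : Type*} [MulAction (GradingGroup Z) S] [MulAction (GradingGroup Z.reverse) S]
variable {deg : Finset (Fin (2 * k)) → S}

theorem exists_coeff_of_mem_homogeneousPart (hx : IsComplementaryGenerators Z x) {s : S} {m : M}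
    (hm : m ∈ homogeneousPart Z x deg s) :
    ∃ c : Finset (Fin (2 * k)) → BiAlg Z, (∀ T, c T * compIdem Z T = c T) ∧
      m = ∑ T, c T • x T ∧ ∀ T X Y, (biBasis Z).repr (c T) (X, Y) ≠ 0 →
        X.gr • Y.gr • deg T = s := by
  classical
  induction hm using AddSubgroup.closure_induction with
  | mem m hm =>
    obtain ⟨X, Y, T, hs, rfl⟩ := hm
    -- The factor `compIdem Z T` normalizes the coefficient without changing the element, since `x
    -- T` is fixed by this idempotent. If `X ⊗ Y` ends elsewhere, both become zero.
    refine ⟨Pi.single T (biBasis Z (X, Y) * compIdem Z T), fun T' => ?_, ?_, fun T' X' Y' h => ?_⟩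
    · rcases eq_or_ne T' T with rfl | hne
      · rw [Pi.single_eq_same, mul_assoc, compIdem_mul_self]
      · rw [Pi.single_eq_of_ne hne, zero_mul]
    · rw [Finset.sum_eq_single T]
      · rw [Pi.single_eq_same, mul_smul, hx.idem_smul]
      · intro T' _ hne
        rw [Pi.single_eq_of_ne hne, biAlg_zero_smul]
      · simp
    · rcases eq_or_ne T' T with rfl | hne
      · rw [Pi.single_eq_same, repr_mul_compIdem, Module.Basis.repr_self,
          Finsupp.single_apply] at h
        obtain ⟨rfl, rfl⟩ := Prod.mk.inj (ite_ne_right_iff.1 (ite_ne_right_iff.1 h).2).1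
        exact hs
      · rw [Pi.single_eq_of_ne hne, map_zero] at h
        exact absurd rfl h
  | zero =>
    exact ⟨0, fun T => by simp, by simp [biAlg_zero_smul], fun T X Y h => absurd (by simp) h⟩
  | add m n _ _ hm hn =>
    obtain ⟨c, c1, rfl, c3⟩ := hm
    obtain ⟨d, d1, rfl, d3⟩ := hn
    refine ⟨c + d, fun T => ?_, ?_, fun T X Y h => ?_⟩
    · rw [Pi.add_apply, add_mul, c1, d1]
    · simp only [Pi.add_apply, add_smul, Finset.sum_add_distrib]
    · rw [Pi.add_apply, map_add, Finsupp.add_apply] at h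
      by_cases h' : (biBasis Z).repr (c T) (X, Y) = 0
      · exact d3 T X Y fun h'' => h (by rw [h', h'', add_zero])
      · exact c3 T X Y h'
  | neg m _ hm =>
    obtain ⟨c, c1, rfl, c3⟩ := hm
    refine ⟨-c, fun T => ?_, ?_, fun T X Y h => ?_⟩
    · rw [Pi.neg_apply, biAlg_neg_mul, c1]
    · simp only [Pi.neg_apply, biAlg_neg_smul, Finset.sum_neg_distrib]
    · rw [Pi.neg_apply, map_neg, Finsupp.neg_apply] at h
      exact c3 T X Y (neg_ne_zero.1 h)

theorem IsCoefficients.gr_of_repr_ne_zero (hx : IsComplementaryGenerators Z x)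
    (ha : IsCoefficients Z D x a) (hdeg : IsGradedBy Z D x deg)
    {I J : Finset (Fin (2 * k))} {X : StrandDiagram Z} {Y : StrandDiagram Z.reverse}
    (h : (biBasis Z).repr (a I J) (X, Y) ≠ 0) :
    X.gr • Y.gr • deg J = (GradingGroup.lam Z)⁻¹ • deg I := by
  obtain ⟨c, c1, c2, c3⟩ := exists_coeff_of_mem_homogeneousPart hx (hdeg I)
  rw [ha.diff_gen] at c2
  rw [hx.coeff_unique (ha.mul_idem I) c1 c2] at h
  exact c3 J X Y h

/-! ### The basic generators that belong to a chord -/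

variable (Z) in
/-- The left factor of the generator for the chord `[i, j]` with further occupied pairs `B`. -/
noncomputable def chordLeft (B : Finset (Fin (2 * k))) (i j : Fin (4 * k)) : StrandDiagram Z :=
  build Z {(i, j)} B

variable (Z) in
/-- The right factor of the generator for the chord `[i, j]` with further occupied pairs `B`. -/
noncomputable def chordRight (B : Finset (Fin (2 * k))) (i j : Fin (4 * k)) :
    StrandDiagram Z.reverse :=
  build Z.reverse {(j.rev, i.rev)} (insert (Z.M i) (insert (Z.M j) B))ᶜ

theorem reverse_M_rev (p : Fin (4 * k)) : Z.reverse.M p.rev = Z.M p := by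
  change Z.M p.rev.rev = Z.M p
  rw [Fin.rev_rev]

theorem admissible_chordRight (B : Finset (Fin (2 * k))) {i j : Fin (4 * k)} (hij : i < j) :
    Admissible Z.reverse {(j.rev, i.rev)} (insert (Z.M i) (insert (Z.M j) B))ᶜ :=
  admissible_singleton (Fin.rev_lt_rev.2 hij) (by simp [reverse_M_rev]) (by simp [reverse_M_rev])

/-- The left strand frees the pair of `i` and occupies that of `j`, while the mirrored strand on the
right does the opposite, so the idempotents remain complementary. -/
theorem isChordTerm {B : Finset (Fin (2 * k))} {i j : Fin (4 * k)} (hij : i < j)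
    (hne : Z.M i ≠ Z.M j) (hi : Z.M i ∉ B) (hj : Z.M j ∉ B) :
    IsChordTerm (insert (Z.M i) B) (insert (Z.M j) B) i j (chordLeft Z B i j)
      (chordRight Z B i j) := by
  have a1 := admissible_singleton hij hi hj
  have a2 := admissible_chordRight (Z := Z) B hij
  refine ⟨?_, ?_, ?_, ?_, moving_build a1, moving_build a2⟩
  · rw [chordLeft, initialPairs_build a1]
    ext
    simp [or_comm]
  · rw [chordRight, initialPairs_build a2]
    ext b
    simp only [Finset.image_singleton, reverse_M_rev, Finset.mem_union, Finset.mem_compl,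
      Finset.mem_insert, Finset.mem_singleton]
    grind
  · rw [chordLeft, terminalPairs_build a1]
    ext
    simp [or_comm]
  · rw [chordRight, terminalPairs_build a2]
    ext b
    simp only [Finset.image_singleton, reverse_M_rev, Finset.mem_union, Finset.mem_compl,
      Finset.mem_insert, Finset.mem_singleton]
    grind

/-- The set `B` consists of the horizontal pairs of `X`. Complementarity then determines `Y`. -/
theorem IsChordTerm.exists_eq {I J : Finset (Fin (2 * k))} {i j : Fin (4 * k)}
    {X : StrandDiagram Z} {Y : StrandDiagram Z.reverse} (h : IsChordTerm I J i j X Y) :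
    ∃ B, i < j ∧ Z.M i ≠ Z.M j ∧ Z.M i ∉ B ∧ Z.M j ∉ B ∧ I = insert (Z.M i) B ∧
      J = insert (Z.M j) B ∧ X = chordLeft Z B i j ∧ Y = chordRight Z B i j := by
  have hX : (i, j) ∈ X.moving := by simp [h.moving_left]
  have hY : (j.rev, i.rev) ∈ Y.moving := by simp [h.moving_right]
  have hij := (mem_moving.1 hX).2
  have adm := X.admissible
  have hi := adm.initial_notMem _ _ hX
  have hj := adm.terminal_notMem _ _ hX
  have eI : I = insert (Z.M i) X.horizontalPairs := by
    rw [← h.initial_left]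
    conv_lhs => rw [← X.build_moving, initialPairs_build adm, h.moving_left]
    ext
    simp [or_comm]
  have eJ : J = insert (Z.M j) X.horizontalPairs := by
    rw [← h.terminal_left]
    conv_lhs => rw [← X.build_moving, terminalPairs_build adm, h.moving_left]
    ext
    simp [or_comm]
  -- If the ends were matched, the strand of `Y` would begin at a pair that is also initial for `X`.
  -- Such chords thus give no terms.
  have hne : Z.M i ≠ Z.M j := by
    intro heq
    have : Z.reverse.M j.rev ∈ Y.initialPairs :=
      mem_initialPairs.2 ⟨_, _, (mem_moving.1 hY).1, rfl⟩
    rw [h.initial_right, reverse_M_rev, ← heq, eI] at this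
    simp at this
  have hu := h.unique (eI ▸ eJ ▸ isChordTerm hij hne hi hj)
  exact ⟨X.horizontalPairs, hij, hne, hi, hj, eI, eJ, hu.1, hu.2⟩

end Differential

/-! ### The relations between the coefficients of chords -/

section ChordCoefficients

open StrandDiagram

variable {k : ℕ} {Z : PointedMatchedCircle k}

theorem IsChordTerm.eq_of_insert {B J : Finset (Fin (2 * k))} {i j : Fin (4 * k)}
    {X : StrandDiagram Z} {Y : StrandDiagram Z.reverse}
    (h : IsChordTerm (insert (Z.M i) B) J i j X Y) (hi : Z.M i ∉ B) :
    J = insert (Z.M j) B ∧ X = chordLeft Z B i j ∧ Y = chordRight Z B i j := by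
  obtain ⟨B', -, -, hi', -, hI, hJ, hX, hY⟩ := h.exists_eq
  have : B = B' := by
    rw [← Finset.erase_insert hi, hI, Finset.erase_insert hi']
  subst this
  exact ⟨hJ, hX, hY⟩

variable {a : Finset (Fin (2 * k)) → Finset (Fin (2 * k)) → BiAlg Z}

theorem repr_sum_mul_eq_single {I K : Finset (Fin (2 * k))}
    {W : StrandDiagram Z × StrandDiagram Z.reverse} (J₀ : Finset (Fin (2 * k)))
    (P₀ Q₀ : StrandDiagram Z × StrandDiagram Z.reverse)
    (hl : Composable P₀.1 Q₀.1 ∧ comp P₀.1 Q₀.1 = W.1)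
    (hr : Composable P₀.2 Q₀.2 ∧ comp P₀.2 Q₀.2 = W.2)
    (huniq : ∀ J P Q, (biBasis Z).repr (a I J) P ≠ 0 → (biBasis Z).repr (a J K) Q ≠ 0 →
      comp P.1 Q.1 = W.1 → comp P.2 Q.2 = W.2 → J = J₀ ∧ P = P₀ ∧ Q = Q₀) :
    (biBasis Z).repr (∑ J, a I J * a J K) W =
      (biBasis Z).repr (a I J₀) P₀ * (biBasis Z).repr (a J₀ K) Q₀ := by
  classical
  have key : ∀ J P Q, (biBasis Z).repr (a I J) P * ((biBasis Z).repr (a J K) Q *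
      (biBasis Z).repr (biBasis Z P * biBasis Z Q) W) ≠ 0 → J = J₀ ∧ P = P₀ ∧ Q = Q₀ := by
    intro J P Q h
    have h3 := right_ne_zero_of_mul (right_ne_zero_of_mul h)
    rw [repr_biBasis_mul] at h3
    obtain ⟨-, h4, h5⟩ := (ite_ne_right_iff.1 h3).1
    exact huniq J P Q (left_ne_zero_of_mul h) (left_ne_zero_of_mul (right_ne_zero_of_mul h)) h4 h5
  rw [map_sum, Finsupp.finsetSum_apply,
    Finset.sum_congr rfl fun J _ => repr_mul (a I J) (a J K) W]
  rw [Finset.sum_eq_single J₀, Finset.sum_eq_single P₀, Finset.sum_eq_single Q₀]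
  · rw [repr_biBasis_mul, if_pos ⟨⟨hl.1, hr.1⟩, hl.2, hr.2⟩, mul_one]
  · intro Q _ hne
    by_contra h
    exact hne (key _ _ _ h).2.2
  · simp
  · intro P _ hne
    refine Finset.sum_eq_zero fun Q _ => ?_
    by_contra h
    exact hne (key _ _ _ h).2.1
  · simp
  · intro J _ hne
    refine Finset.sum_eq_zero fun P _ => Finset.sum_eq_zero fun Q _ => ?_
    by_contra h
    exact hne (key _ _ _ h).1
  · simp

/-- The coefficient of the basic generator of a chord in the differential. -/
noncomputable def chordCoeff (a : Finset (Fin (2 * k)) → Finset (Fin (2 * k)) → BiAlg Z)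
    (B : Finset (Fin (2 * k))) (i j : Fin (4 * k)) : ZMod 2 :=
  (biBasis Z).repr (a (insert (Z.M i) B) (insert (Z.M j) B)) (chordLeft Z B i j, chordRight Z B i j)

variable (hF : ∀ I J X Y, (biBasis Z).repr (a I J) (X, Y) ≠ 0 → ∃ i j, IsChordTerm I J i j X Y)
  (hsq : ∀ I K, biDiff Z (a I K) * compIdem Z K + ∑ J, a I J * a J K = 0)
include hF hsq

/-- The pair of `r` is vacant on the left, hence horizontal on the right. In the structure equation
one looks at the term with the unbroken chord on the left and the chord broken at `r` on the right.
It arises once from the differential of the right factor and once from the product of the terms for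
`[i, r]` and `[r, j]`. -/
theorem chordCoeff_free {B : Finset (Fin (2 * k))} {i r j : Fin (4 * k)} (hir : i < r) (hrj : r < j)
    (h1 : Z.M i ≠ Z.M r) (h2 : Z.M r ≠ Z.M j) (h3 : Z.M i ≠ Z.M j)
    (hi : Z.M i ∉ B) (hr : Z.M r ∉ B) (hj : Z.M j ∉ B) :
    chordCoeff a B i j = chordCoeff a B i r * chordCoeff a B r j := by
  set C : Finset (Fin (2 * k)) := (insert (Z.M i) (insert (Z.M r) (insert (Z.M j) B)))ᶜ with hC
  have e1 : (insert (Z.M i) (insert (Z.M j) B))ᶜ = insert (Z.reverse.M r.rev) C := by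
    ext b; rw [reverse_M_rev, hC]; simp; grind
  have e2 : (insert (Z.M i) (insert (Z.M r) B))ᶜ = insert (Z.reverse.M j.rev) C := by
    ext b; rw [reverse_M_rev, hC]; simp; grind
  have e3 : (insert (Z.M r) (insert (Z.M j) B))ᶜ = insert (Z.reverse.M i.rev) C := by
    ext b; rw [reverse_M_rev, hC]; simp; grind
  have r1 := Fin.rev_lt_rev.2 hrj
  have r2 := Fin.rev_lt_rev.2 hir
  have n1 : Z.reverse.M j.rev ≠ Z.reverse.M r.rev := by simpa [reverse_M_rev] using h2.symm
  have n2 : Z.reverse.M r.rev ≠ Z.reverse.M i.rev := by simpa [reverse_M_rev] using h1.symm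
  have n3 : Z.reverse.M j.rev ≠ Z.reverse.M i.rev := by simpa [reverse_M_rev] using h3.symm
  have m1 : Z.reverse.M j.rev ∉ C := by simp [reverse_M_rev, hC]
  have m2 : Z.reverse.M r.rev ∉ C := by simp [reverse_M_rev, hC]
  have m3 : Z.reverse.M i.rev ∉ C := by simp [reverse_M_rev, hC]
  have adm := admissible_pair r1 r2 n1 n2 m1 m2 m3
  set Y := build Z.reverse {(j.rev, r.rev), (r.rev, i.rev)} C with hY
  have hYm : Y.moving = {(j.rev, r.rev), (r.rev, i.rev)} := moving_build adm
  have hterm := isChordTerm (hir.trans hrj) h3 hi hj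
  have hYt : Y.terminalPairs = (insert (Z.M j) B)ᶜ := by
    rw [hY, terminalPairs_build adm]
    ext b
    rw [hC]
    simp only [Finset.image_insert, Finset.image_singleton, reverse_M_rev, Finset.mem_union,
      Finset.mem_compl, Finset.mem_insert, Finset.mem_singleton]
    grind
  have hrel := congrArg (fun u => (biBasis Z).repr u (chordLeft Z B i j, Y))
    (hsq (insert (Z.M i) B) (insert (Z.M j) B))
  simp only [map_add, Finsupp.add_apply, map_zero, Finsupp.zero_apply] at hrel
  -- Differentiating the left factor contributes nothing: it leaves the right factor alone, and a
  -- chord term has one moving strand there, whereas `Y` has two.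
  rw [repr_mul_compIdem, if_pos ⟨hterm.terminal_left, hYt⟩, repr_biDiff,
    Finset.sum_eq_zero, zero_add, Finset.sum_eq_single (chordRight Z B i j),
    repr_sum_mul_eq_single (insert (Z.M r) B) (chordLeft Z B i r, chordRight Z B i r)
      (chordLeft Z B r j, chordRight Z B r j)] at hrel
  · rw [chordRight, e1, repr_basicDiff_chord r1 r2 n1 n2 m1 m2 m3, ← e1, mul_one] at hrel
    exact CharTwo.add_eq_zero.1 hrel
  · exact composable_free hir hrj hi hr hj
  · simp only [chordRight, e2, e3]
    exact composable_occupied r1 r2 n1 n2 n3 m1 m2 m3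
  · rintro J ⟨X₁, Y₁⟩ ⟨X₂, Y₂⟩ g1 g2 - g3
    obtain ⟨s, t, f1⟩ := hF _ _ _ _ g1
    obtain ⟨u, v, f2⟩ := hF _ _ _ _ g2
    have g4 : (comp Y₁ Y₂).moving = {(j.rev, r.rev), (r.rev, i.rev)} := by
      rw [← hYm]
      exact congrArg moving g3
    -- The broken right factor alone determines the two chords and their order; the idempotents then
    -- determine the terms.
    obtain ⟨q1, q2, q3, q4⟩ :=
      moving_of_comp_eq_pair r1 r2 f1.moving_right f2.moving_right g4
    obtain rfl := Fin.rev_injective q1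
    obtain rfl := Fin.rev_injective q2
    obtain rfl := Fin.rev_injective q3
    obtain rfl := Fin.rev_injective q4
    obtain ⟨rfl, rfl, rfl⟩ := f1.eq_of_insert hi
    obtain ⟨-, rfl, rfl⟩ := f2.eq_of_insert hr
    exact ⟨rfl, rfl, rfl⟩
  · intro Y' _ hne
    by_contra h
    obtain ⟨s, t, f⟩ := hF _ _ _ _ (left_ne_zero_of_mul h)
    have := f.moving_left.symm.trans hterm.moving_left
    simp only [Finset.singleton_inj, Prod.mk.injEq] at this
    obtain ⟨rfl, rfl⟩ := this
    exact hne (f.unique hterm).2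
  · simp
  · intro X' _
    by_contra h
    obtain ⟨s, t, f⟩ := hF _ _ _ _ (left_ne_zero_of_mul h)
    have := congrArg Finset.card (f.moving_right.symm.trans hYm)
    rw [Finset.card_singleton, Finset.card_pair] at this
    · omega
    · intro h
      exact r1.ne (Prod.mk.inj h).1

/-- As in `chordCoeff_free` with the two factors exchanged: `r` is horizontal on the left, so the
chord is broken there, and the product has `[r, j]` before `[i, r]`. -/
theorem chordCoeff_occupied {B : Finset (Fin (2 * k))} {i r j : Fin (4 * k)} (hir : i < r)
    (hrj : r < j) (h1 : Z.M i ≠ Z.M r) (h2 : Z.M r ≠ Z.M j) (h3 : Z.M i ≠ Z.M j)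
    (hi : Z.M i ∉ B) (hr : Z.M r ∉ B) (hj : Z.M j ∉ B) :
    chordCoeff a (insert (Z.M r) B) i j =
      chordCoeff a (insert (Z.M i) B) r j * chordCoeff a (insert (Z.M j) B) i r := by
  set C : Finset (Fin (2 * k)) := (insert (Z.M i) (insert (Z.M r) (insert (Z.M j) B)))ᶜ with hC
  have e1 : (insert (Z.M i) (insert (Z.M j) (insert (Z.M r) B)))ᶜ = C := by
    rw [hC, Finset.insert_comm (Z.M j)]
  have e2 : (insert (Z.M r) (insert (Z.M j) (insert (Z.M i) B)))ᶜ = C := by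
    rw [hC, Finset.insert_comm (Z.M j), Finset.insert_comm (Z.M r)]
  have r1 := Fin.rev_lt_rev.2 hrj
  have r2 := Fin.rev_lt_rev.2 hir
  have m1 : Z.reverse.M j.rev ∉ C := by simp [reverse_M_rev, hC]
  have m2 : Z.reverse.M r.rev ∉ C := by simp [reverse_M_rev, hC]
  have m3 : Z.reverse.M i.rev ∉ C := by simp [reverse_M_rev, hC]
  have hi' : Z.M i ∉ insert (Z.M r) B := by simp [h1, hi]
  have hj' : Z.M j ∉ insert (Z.M r) B := by simp [h2.symm, hj]
  have hr' : Z.M r ∉ insert (Z.M i) B := by simp [h1.symm, hr]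
  have hi'' : Z.M i ∉ insert (Z.M j) B := by simp [h3, hi]
  have adm := admissible_pair hir hrj h1 h2 hi hr hj
  set X := build Z {(i, r), (r, j)} B with hX
  have hXm : X.moving = {(i, r), (r, j)} := moving_build adm
  have hterm := isChordTerm (hir.trans hrj) h3 hi' hj'
  have hXt : X.terminalPairs = insert (Z.M j) (insert (Z.M r) B) := by
    rw [hX, terminalPairs_build adm]
    ext b
    simp only [Finset.image_insert, Finset.image_singleton, Finset.mem_union,
      Finset.mem_insert, Finset.mem_singleton]
    tauto
  have hrel := congrArg (fun u => (biBasis Z).repr u (X, chordRight Z (insert (Z.M r) B) i j))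
    (hsq (insert (Z.M i) (insert (Z.M r) B)) (insert (Z.M j) (insert (Z.M r) B)))
  simp only [map_add, Finsupp.add_apply, map_zero, Finsupp.zero_apply] at hrel
  rw [repr_mul_compIdem, if_pos ⟨hXt, hterm.terminal_right⟩, repr_biDiff,
    Finset.sum_eq_single (chordLeft Z (insert (Z.M r) B) i j), Finset.sum_eq_zero (s := Finset.univ)
      (f := fun Y' : StrandDiagram Z.reverse => _), add_zero,
    repr_sum_mul_eq_single (insert (Z.M j) (insert (Z.M i) B))
      (chordLeft Z (insert (Z.M i) B) r j, chordRight Z (insert (Z.M i) B) r j)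
      (chordLeft Z (insert (Z.M j) B) i r, chordRight Z (insert (Z.M j) B) i r)] at hrel
  · rw [chordLeft, repr_basicDiff_chord hir hrj h1 h2 hi hr hj, mul_one] at hrel
    rw [chordCoeff, chordCoeff, chordCoeff, Finset.insert_comm (Z.M r) (Z.M i),
      Finset.insert_comm (Z.M i) (Z.M j), Finset.insert_comm (Z.M r) (Z.M j)]
    exact CharTwo.add_eq_zero.1 hrel
  · exact composable_occupied hir hrj h1 h2 h3 hi hr hj
  · simp only [chordRight]
    rw [e1, e2]
    exact composable_free r1 r2 m1 m2 m3
  · rintro J ⟨X₁, Y₁⟩ ⟨X₂, Y₂⟩ g1 g2 g3 -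
    obtain ⟨s, t, f1⟩ := hF _ _ _ _ g1
    obtain ⟨u, v, f2⟩ := hF _ _ _ _ g2
    have g4 : (comp X₁ X₂).moving = {(i, r), (r, j)} := by
      rw [← hXm]
      exact congrArg moving g3
    obtain ⟨rfl, rfl, rfl, rfl⟩ :=
      moving_of_comp_eq_pair hir hrj f1.moving_left f2.moving_left g4
    rw [Finset.insert_comm] at f1
    obtain ⟨rfl, rfl, rfl⟩ := f1.eq_of_insert hr'
    rw [Finset.insert_comm] at f2
    obtain ⟨-, rfl, rfl⟩ := f2.eq_of_insert hi''
    exact ⟨rfl, rfl, rfl⟩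
  · intro Y' _
    by_contra h
    obtain ⟨s, t, f⟩ := hF _ _ _ _ (left_ne_zero_of_mul h)
    have := congrArg Finset.card (f.moving_left.symm.trans hXm)
    rw [Finset.card_singleton, Finset.card_pair] at this
    · omega
    · intro h
      exact hir.ne (Prod.mk.inj h).1
  · intro X' _ hne
    by_contra h
    obtain ⟨s, t, f⟩ := hF _ _ _ _ (left_ne_zero_of_mul h)
    have := f.moving_right.symm.trans hterm.moving_right
    simp only [Finset.singleton_inj, Prod.mk.injEq] at this
    obtain rfl := Fin.rev_injective this.1
    obtain rfl := Fin.rev_injective this.2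
    exact hne (f.unique hterm).1
  · simp

end ChordCoefficients

/-! ### All chord coefficients are one; comparison with `DD(Id)` -/

section Rigidity

open StrandDiagram

variable {k : ℕ} {Z : PointedMatchedCircle k}
variable {a : Finset (Fin (2 * k)) → Finset (Fin (2 * k)) → BiAlg Z}

/-- If the chords of length one occur in the differential, then all chords do. For a chord of length
three with crosswise matched points one compares two splittings of a longer chord; here the genus
has to be greater than one. -/
theorem chordCoeff_eq_one (hk : 1 < k)
    (hF : ∀ I J X Y, (biBasis Z).repr (a I J) (X, Y) ≠ 0 → ∃ i j, IsChordTerm I J i j X Y)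
    (hsq : ∀ I K, biDiff Z (a I K) * compIdem Z K + ∑ J, a I J * a J K = 0)
    (hone : ∀ B i j, j.val = i.val + 1 → Z.M i ∉ B → Z.M j ∉ B → chordCoeff a B i j = 1) :
    ∀ B i j, i < j → Z.M i ≠ Z.M j → Z.M i ∉ B → Z.M j ∉ B → chordCoeff a B i j = 1 := by
  refine Z.chord_induction hone ?_ ?_ ?_
  · intro B i r j hir hrj h1 h2 h3 hi hr hj e1 e2
    rw [chordCoeff_free hF hsq hir hrj h1 h2 h3 hi hr hj, e1, e2, mul_one]
  · intro B i r j hir hrj h1 h2 h3 hi hr hj e1 e2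
    rw [chordCoeff_occupied hF hsq hir hrj h1 h2 h3 hi hr hj, e1, e2, mul_one]
  · intro B i r s j hr hs hj his hrj hij hi hj' ih
    have lir : i < r := Fin.lt_def.2 (by omega)
    have lrs : r < s := Fin.lt_def.2 (by omega)
    have lsj : s < j := Fin.lt_def.2 (by omega)
    have hir : Z.M i ≠ Z.M r := by rwa [hrj]
    have hrs : Z.M r ≠ Z.M s := by rw [hrj, ← his]; exact hij.symm
    have hsj : Z.M s ≠ Z.M j := by rwa [← his]
    -- The chord is extended by the point `e` after `j`, or by the point `d` before `i` if `j` is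
    -- the last point.
    by_cases hlast : j.val + 1 < 4 * k
    · obtain ⟨e, he⟩ : ∃ e : Fin (4 * k), e.val = j.val + 1 := ⟨⟨j.val + 1, hlast⟩, rfl⟩
      have lje : j < e := Fin.lt_def.2 (by omega)
      have hje : Z.M j ≠ Z.M e := Z.M_ne_of_succ he
      have hie : Z.M i ≠ Z.M e := fun h => Z.not_three (lir.trans lrs).ne (lsj.trans lje).ne
        (lir.trans (lrs.trans (lsj.trans lje))).ne h (his ▸ h)
      have hre : Z.M r ≠ Z.M e := by rwa [hrj]
      have hse : Z.M s ≠ Z.M e := by rwa [← his]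
      by_cases heB : Z.M e ∈ B
      · obtain ⟨B, he', rfl⟩ : ∃ B', Z.M e ∉ B' ∧ B = insert (Z.M e) B' :=
          ⟨B.erase (Z.M e), Finset.notMem_erase _ _, (Finset.insert_erase heB).symm⟩
        simp only [Finset.mem_insert, not_or] at hi hj'
        have hr' : Z.M r ∉ B := by rw [hrj]; exact hj'.2
        have hs' : Z.M s ∉ B := by rw [← his]; exact hi.2
        -- The splittings of `[i, e]` at `j` and at `r` concern the same coefficient because `j` and
        -- `r` belong to the same pair. Apart from `[i, j]`, everything reduces to chords of length
        -- at most two.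
        have q1 := chordCoeff_occupied hF hsq (lir.trans (lrs.trans lsj)) lje hij hje hie hi.2 hj'.2
          he'
        have q2 := chordCoeff_occupied hF hsq lir (lrs.trans (lsj.trans lje)) hir hre hie hi.2 hr'
          he'
        have q3 := chordCoeff_occupied hF hsq lrs (lsj.trans lje) hrs hse hre hr' hs' he'
        rw [ih _ s e (lsj.trans lje) (by omega) hse (by simp [hrs.symm, hs'])
            (by simp [hre.symm, he']),
          ih _ r s lrs (by omega) hrs (by simp [hre, hr']) (by simp [hse, hs']), ← his] at q3
        rw [q3, ih _ i r lir (by omega) hir (by simp [hie, hi.2]) (by simp [hre, hr']), hrj, q1,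
          ih _ j e lje (by omega) hje (by simp [hij.symm, hj'.2]) (by simp [hie.symm, he'])] at q2
        simpa using q2
      · have hr' : Z.M r ∉ B := by rwa [hrj]
        have hs' : Z.M s ∉ B := by rwa [← his]
        -- Writing `c` for coefficients, `c[i,j] · c[j,e] = c[i,e] = c[i,r] · c[r,s] · c[s,e]`, and
        -- all factors other than `c[i,j]` are known to be `1`.
        have q1 := chordCoeff_free hF hsq (lir.trans (lrs.trans lsj)) lje hij hje hie hi hj' heB
        have q2 := chordCoeff_free hF hsq lir (lrs.trans (lsj.trans lje)) hir hre hie hi hr' heB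
        have q3 := chordCoeff_free hF hsq lrs (lsj.trans lje) hrs hse hre hr' hs' heB
        rw [ih _ r s lrs (by omega) hrs hr' hs',
          ih _ s e (lsj.trans lje) (by omega) hse hs' heB] at q3
        rw [q3, ih _ i r lir (by omega) hir hi hr', q1, ih _ j e lje (by omega) hje hj' heB] at q2
        simpa using q2
    · have hjlt := j.isLt
      -- Here `j` is the last of `4k > 4` points and `i` the fourth from the end, so a point
      -- precedes `i`. This is where the genus enters.
      obtain ⟨d, hd⟩ : ∃ d : Fin (4 * k), i.val = d.val + 1 :=
        ⟨⟨i.val - 1, by omega⟩, by simp only; omega⟩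
      have ldi : d < i := Fin.lt_def.2 (by omega)
      have hdi : Z.M d ≠ Z.M i := Z.M_ne_of_succ hd
      have hdj : Z.M d ≠ Z.M j := fun h => Z.not_three (ldi.trans lir).ne (lrs.trans lsj).ne
        (ldi.trans (lir.trans (lrs.trans lsj))).ne h hrj
      have hdr : Z.M d ≠ Z.M r := by rwa [hrj]
      have hds : Z.M d ≠ Z.M s := by rwa [← his]
      by_cases hdB : Z.M d ∈ B
      · obtain ⟨B, hd', rfl⟩ : ∃ B', Z.M d ∉ B' ∧ B = insert (Z.M d) B' :=
          ⟨B.erase (Z.M d), Finset.notMem_erase _ _, (Finset.insert_erase hdB).symm⟩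
        simp only [Finset.mem_insert, not_or] at hi hj'
        have hr' : Z.M r ∉ B := by rw [hrj]; exact hj'.2
        have hs' : Z.M s ∉ B := by rw [← his]; exact hi.2
        have q1 := chordCoeff_occupied hF hsq ldi (lir.trans (lrs.trans lsj)) hdi hij hdj hd' hi.2
          hj'.2
        have q2 := chordCoeff_occupied hF hsq (ldi.trans (lir.trans lrs)) lsj hds hsj hdj hd' hs'
          hj'.2
        have q3 := chordCoeff_occupied hF hsq (ldi.trans lir) lrs hdr hrs hds hd' hr' hs'
        rw [ih _ r s lrs (by omega) hrs (by simp [hdr.symm, hr']) (by simp [hds.symm, hs']),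
          ih _ d r (ldi.trans lir) (by omega) hdr (by simp [hds, hd']) (by simp [hrs, hr']),
          hrj] at q3
        rw [q3, ih _ s j lsj (by omega) hsj (by simp [hds.symm, hs']) (by simp [hdj.symm, hj'.2]),
          ← his, q1, ih _ d i ldi (by omega) hdi (by simp [hdj, hd']) (by simp [hij, hi.2])] at q2
        simpa using q2
      · have hr' : Z.M r ∉ B := by rwa [hrj]
        have hs' : Z.M s ∉ B := by rwa [← his]
        have q1 := chordCoeff_free hF hsq ldi (lir.trans (lrs.trans lsj)) hdi hij hdj hdB hi hj'
        have q2 := chordCoeff_free hF hsq (ldi.trans (lir.trans lrs)) lsj hds hsj hdj hdB hs' hj'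
        have q3 := chordCoeff_free hF hsq (ldi.trans lir) lrs hdr hrs hds hdB hr' hs'
        rw [ih _ d r (ldi.trans lir) (by omega) hdr hdB hr',
          ih _ r s lrs (by omega) hrs hr' hs'] at q3
        rw [q3, ih _ s j lsj (by omega) hsj hs' hj', q1, ih _ d i ldi (by omega) hdi hdB hi] at q2
        simpa using q2

/-- A pair of diagrams belongs to at most one chord, so no terms on the right cancel and both sides
have coefficient one exactly at the chord terms. -/
theorem eq_sum_chords
    (hF : ∀ I J X Y, (biBasis Z).repr (a I J) (X, Y) ≠ 0 → ∃ i j, IsChordTerm I J i j X Y)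
    (hone : ∀ B i j, i < j → Z.M i ≠ Z.M j → Z.M i ∉ B → Z.M j ∉ B → chordCoeff a B i j = 1)
    (I J : Finset (Fin (2 * k))) :
    a I J = ∑ i, ∑ j, if i < j then compIdem Z I * chordPair Z i j * compIdem Z J else 0 := by
  classical
  apply (biBasis Z).repr.injective
  ext ⟨X, Y⟩
  have hr : ∀ i j : Fin (4 * k), (biBasis Z).repr
      (if i < j then compIdem Z I * chordPair Z i j * compIdem Z J else 0) (X, Y) =
      if IsChordTerm I J i j X Y then 1 else 0 := by
    intro i j
    split_ifs with h1 h2 h2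
    · rw [repr_chord_term, if_pos h2]
    · rw [repr_chord_term, if_neg h2]
    · obtain ⟨B, hlt, -⟩ := h2.exists_eq
      exact absurd hlt h1
    · simp
  simp only [map_sum, Finsupp.finsetSum_apply, hr]
  by_cases h : ∃ i j, IsChordTerm I J i j X Y
  · obtain ⟨i, j, hij⟩ := h
    have hu : ∀ i' j', IsChordTerm I J i' j' X Y → i' = i ∧ j' = j := by
      intro i' j' h'
      have := h'.moving_left.symm.trans hij.moving_left
      simpa using this
    rw [Finset.sum_eq_single i, Finset.sum_eq_single j, if_pos hij]
    · obtain ⟨B, hlt, hne, hi, hj, rfl, rfl, rfl, rfl⟩ := hij.exists_eq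
      exact hone B i j hlt hne hi hj
    · intro j' _ hne
      exact if_neg fun h' => hne (hu _ _ h').2
    · simp
    · intro i' _ hne
      exact Finset.sum_eq_zero fun j' _ => if_neg fun h' => hne (hu _ _ h').1
    · simp
  · rw [Finset.sum_eq_zero fun i _ => Finset.sum_eq_zero fun j _ => if_neg fun h' => h ⟨i, j, h'⟩]
    by_contra h'
    exact h (hF I J X Y h')

/-! ### From the bimodule to its chord coefficients, and the isomorphism -/

variable {M : Type*} [AddCommGroup M] [Module (BiAlg Z) M] {D : M →+ M}
variable {x : Finset (Fin (2 * k)) → M}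
variable {S : Type*} [MulAction (GradingGroup Z) S] [MulAction (GradingGroup Z.reverse) S]
variable {deg : Finset (Fin (2 * k)) → S}

/-- For a chord of length one each factor has `ι = -1/2`, and the shift by `λ` adds `1`, so the
total Maslov component is zero. -/
theorem compatibleDegrees (hx : IsComplementaryGenerators Z x) (ha : IsCoefficients Z D x a)
    (hdiag : ∀ I J, a I J ∈ diagonalSubalgebra Z) (hdeg : IsGradedBy Z D x deg)
    (hone : ∀ (B : Finset (Fin (2 * k))) (i j : Fin (4 * k)), j.val = i.val + 1 → Z.M i ∉ B →
      Z.M j ∉ B → chordCoeff a B i j = 1) :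
    CompatibleDegrees Z deg := by
  intro B i j hij hi hj
  have hlt : i < j := Fin.lt_def.2 (by omega)
  have hterm := isChordTerm hlt (Z.M_ne_of_succ hij) hi hj
  have hne : (biBasis Z).repr (a (insert (Z.M i) B) (insert (Z.M j) B))
      (chordLeft Z B i j, chordRight Z B i j) ≠ 0 := by
    have h1 := hone B i j hij hi hj
    rw [chordCoeff] at h1
    rw [h1]
    exact one_ne_zero
  have h := Related.of_gr (supp_of_mem_diagonalSubalgebra (hdiag _ _) hne)
    (ha.gr_of_repr_ne_zero hx hdeg hne)
  rw [iota_of_moving_eq_singleton hterm.moving_left, iota_of_moving_eq_singleton hterm.moving_right,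
    supp_eq_sum_moving, hterm.moving_left, Finset.sum_singleton] at h
  norm_num at h
  exact h

theorem isChordTerm_of_repr_ne_zero (hD : IsDGModule Z D) (hx : IsComplementaryGenerators Z x)
    (ha : IsCoefficients Z D x a) (hdiag : ∀ I J, a I J ∈ diagonalSubalgebra Z)
    (hS : IsLambdaFreeGradingSet Z S) (hdeg : IsGradedBy Z D x deg)
    (hcomp : CompatibleDegrees Z deg) {I J : Finset (Fin (2 * k))} {X : StrandDiagram Z}
    {Y : StrandDiagram Z.reverse} (h : (biBasis Z).repr (a I J) (X, Y) ≠ 0) :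
    ∃ i j, IsChordTerm I J i j X Y := by
  have hgr := ha.gr_of_repr_ne_zero hx hdeg h
  obtain ⟨⟨rfl, h2⟩, rfl, h4⟩ := ha.pairs_of_repr_ne_zero hD hx h
  obtain ⟨i, j, -, h5, h6⟩ :=
    hcomp.moving_eq_singleton hS h2 (supp_of_mem_diagonalSubalgebra (hdiag _ _) h) hgr
  exact ⟨i, j, rfl, h2, rfl, h4, h5, h6⟩

/-- The map `c ↦ ∑ c S • x S` from `DD(Id)` to a module with generators `x S`. -/
noncomputable def fromDDId (x : Finset (Fin (2 * k)) → M) : DDId Z →ₗ[BiAlg Z] M where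
  toFun c := ∑ S, c.1 S • x S
  map_add' c d := by
    simp only [Submodule.coe_add, Pi.add_apply, add_smul, Finset.sum_add_distrib]
  map_smul' b c := by
    simp only [Submodule.coe_smul, Pi.smul_apply, smul_eq_mul, mul_smul, Finset.smul_sum,
      RingHom.id_apply]

theorem fromDDId_bijective (hx : IsComplementaryGenerators Z x) :
    Function.Bijective (fromDDId x : DDId Z →ₗ[BiAlg Z] M) := by
  constructor
  · intro c d h
    exact Subtype.ext (hx.coeff_unique c.2 d.2 h)
  · intro m
    obtain ⟨c, ⟨hc, rfl⟩, -⟩ := hx.existsUnique_coeff m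
    exact ⟨⟨c, hc⟩, rfl⟩

/-- By the Leibniz rule only the values on generators matter. The idempotent on the left of each
chord term is absorbed by `c_S = c_S · I(S)`. -/
theorem fromDDId_ddIdDiff (hD : IsDGModule Z D) (hx : IsComplementaryGenerators Z x)
    (ha : IsCoefficients Z D x a)
    (hsum : ∀ I J, a I J =
      ∑ i, ∑ j, if i < j then compIdem Z I * chordPair Z i j * compIdem Z J else 0)
    (c : DDId Z) : D (fromDDId x c) = fromDDId x (ddIdDiff Z c) := by
  have h1 : ∀ S T, (∑ i, ∑ j, if i < j then c.1 S * chordPair Z i j * compIdem Z T else 0) =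
      c.1 S * a S T := by
    intro S T
    rw [hsum, Finset.mul_sum]
    refine Finset.sum_congr rfl fun i _ => ?_
    rw [Finset.mul_sum]
    refine Finset.sum_congr rfl fun j _ => ?_
    rw [mul_ite, mul_zero, ← mul_assoc, ← mul_assoc, c.2 S]
  have h2 : fromDDId x (ddIdDiff Z c) =
      ∑ T, (biDiff Z (c.1 T) * compIdem Z T + ∑ S, c.1 S * a S T) • x T := by
    simp only [← h1]
    rfl
  rw [h2]
  change D (∑ S, c.1 S • x S) = _
  simp only [map_sum, hD.leibniz, ha.diff_gen, add_smul, Finset.sum_smul, Finset.sum_add_distrib,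
    mul_smul, hx.idem_smul, Finset.smul_sum]
  congr 1
  exact Finset.sum_comm

end Rigidity

end BorderedFloer

theorem mainTheorem10 {k : ℕ} (hk : 1 < k) (Z : BorderedFloer.PointedMatchedCircle k)
    {M : Type*} [AddCommGroup M] [Module (BorderedFloer.BiAlg Z) M] (D : M →+ M)
    (hD : BorderedFloer.IsDGModule Z D)
    (x : Finset (Fin (2 * k)) → M) (hx : BorderedFloer.IsComplementaryGenerators Z x)
    (a : Finset (Fin (2 * k)) → Finset (Fin (2 * k)) → BorderedFloer.BiAlg Z)
    (ha : BorderedFloer.IsCoefficients Z D x a)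
    (hdiag : ∀ I J, a I J ∈ BorderedFloer.diagonalSubalgebra Z)
    {S : Type*} [MulAction (BorderedFloer.GradingGroup Z) S]
    [MulAction (BorderedFloer.GradingGroup Z.reverse) S]
    (hS : BorderedFloer.IsLambdaFreeGradingSet Z S)
    (deg : Finset (Fin (2 * k)) → S) (hdeg : BorderedFloer.IsGradedBy Z D x deg)
    (hchord : ∀ (I J : Finset (Fin (2 * k))) (i j : Fin (4 * k)), j.val = i.val + 1 →
      ∀ XY : BorderedFloer.StrandDiagram Z × BorderedFloer.StrandDiagram Z.reverse,
        BorderedFloer.compIdem Z I * BorderedFloer.chordPair Z i j * BorderedFloer.compIdem Z J =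
          BorderedFloer.biBasis Z XY →
        (BorderedFloer.biBasis Z).repr (a I J) XY ≠ 0) :
    ∃ f : M ≃ₗ[BorderedFloer.BiAlg Z] BorderedFloer.DDId Z,
      ∀ m, f (D m) = BorderedFloer.ddIdDiff Z (f m) := by
  open BorderedFloer in
  have hone : ∀ (B : Finset (Fin (2 * k))) (i j : Fin (4 * k)), j.val = i.val + 1 → Z.M i ∉ B →
      Z.M j ∉ B → chordCoeff a B i j = 1 := by
    intro B i j hij hi hj
    have hterm := isChordTerm (Fin.lt_def.2 (by omega)) (Z.M_ne_of_succ hij) hi hj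
    -- A nonzero coefficient in `𝔽₂` is one. Neighbouring points are never matched, so every unit
    -- chord with both pairs outside `B` gives a basic generator to which the hypothesis applies.
    exact Fin.eq_one_of_ne_zero _ (hchord _ _ i j hij _ hterm.eq_biBasis)
  have hcomp := BorderedFloer.compatibleDegrees hx ha hdiag hdeg hone
  have hF := fun I J X Y => BorderedFloer.isChordTerm_of_repr_ne_zero (I := I) (J := J) (X := X)
    (Y := Y) hD hx ha hdiag hS hdeg hcomp
  have hall := BorderedFloer.chordCoeff_eq_one hk hF (ha.sq_relation hD hx) hone
  have hsum := BorderedFloer.eq_sum_chords hF hall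
  refine ⟨(LinearEquiv.ofBijective _ (BorderedFloer.fromDDId_bijective hx)).symm, fun m => ?_⟩
  obtain ⟨c, rfl⟩ := (LinearEquiv.ofBijective _ (BorderedFloer.fromDDId_bijective hx)).surjective m
  rw [LinearEquiv.symm_apply_apply, LinearEquiv.symm_apply_eq]
  exact BorderedFloer.fromDDId_ddIdDiff hD hx ha hsum c
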